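/- Let $\lambda>2$ be a rational number. An (a,b)-module is a free $\mathbb{C}[[b]]$-module of finite rank with a $\mathbb{C}$-linear, $b$-adically continuous operator $a$ such that $ab-ba=b^2$. For $\mu\in\,]0,1]\cap\mathbb{Q}$ let $\Xi_\mu^{(N)}=\bigoplus_{j=0}^N\mathbb{C}[[b]]\,e_{\mu,j}$ with $a e_{\mu,j}=\mu b\,e_{\mu,j}+b\,e_{\mu,j-1}$ (where $e_{\mu,-1}=0$), and let $\Xi_\Lambda^{(N)}=\bigoplus_{\mu\in\Lambda}\Xi_\mu^{(N)}$ for $\Lambda\subset\,]0,1]\cap\mathbb{Q}$ finite. A $[\lambda]$-primitive theme is an (a,b)-module isomorphic to the sub-(a,b)-module generated by one element of some $\Xi_\mu^{(N)}$, with $\mu\equiv\lambda$ mod $\mathbb{Z}$. A rank $3$ such theme $E$ has fundamental invariants $\lambda_1=\lambda$, $p_1=p_2=1$ when it has a filtration $0=F_0\subset F_1\subset F_2\subset F_3=E$ by $a$-stable submodules whose successive quotients are free of rank one on a generator $e$ with $ae=\lambda b\,e$. It is called invariant when it has an endomorphism (a $\mathbb{C}[[b]]$-linear map commuting with $a$)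 of rank $2$. For $\alpha,\beta\in\mathbb{C}^*$ and $\gamma\in\mathbb{C}$ let $E(\alpha,\beta,\gamma)=\tilde{\mathcal A}/\tilde{\mathcal A}(a-\lambda b)(1+\beta b+\gamma b^2)^{-1}(a-\lambda b)(1+\alpha b)^{-1}(a-\lambda b)$, where $\tilde{\mathcal A}$ is the $b$-completion of $\mathbb{C}\langle a,b\rangle/(ab-ba-b^2)$; that is, the free $\mathbb{C}[[b]]$-module with basis $e_1,e_2,e_3$ and $(a-\lambda b)e_3=(1+\alpha b)e_2$, $(a-\lambda b)e_2=(1+\beta b+\gamma b^2)e_1$, $(a-\lambda b)e_1=0$. These are the canonical forms of the rank $3$ themes with invariants $\lambda_1=\lambda$, $p_1=p_2=1$. On a reduced complex space $X$, a holomorphic family of such themes is a locally free sheaf $\mathbb{E}$ of finite type of $\mathcal{O}_X[[b]]$-modules with an action of $a$, whose fibers $E(x)$ are rank $3$ $[\lambda]$-primitive themes with these invariants, and which is locally isomorphic to the sheaf generated by a holomorphic map $\varphi$ to some $\Xi_\Lambda^{(2)}$ such that $\varphi,a\varphi,a^2\varphi$ is a basis of the sheaf generated by the $a^\nu\varphi$,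 whose fiber at $x$ is the submodule generated by $\varphi(x)$. The family is universal near $x_0\in X$ when, for every reduced complex space $Y$ with a base point $y_0$ and every holomorphic family $\mathbb{H}$ of such themes on $Y$ with $H(y_0)\simeq E(x_0)$, there is a holomorphic map $f$ from a neighbourhood of $y_0$ to $X$ with $f(y_0)=x_0$ and $f^*\mathbb{E}\simeq\mathbb{H}$ near $y_0$, and the germ of $f$ at $y_0$ is unique. Then every $E(\alpha,\beta,\gamma)$ with $\alpha\beta\neq0$ is a rank $3$ $[\lambda]$-primitive theme with fundamental invariants $\lambda_1=\lambda$, $p_1=p_2=1$, and: (1) For $\alpha\ne\beta$ in $\mathbb{C}^*$ and any $\gamma$, the theme $E(\alpha,\beta,\gamma)$ is not invariant and its canonical form is not unique: it is isomorphic to $E(\alpha',\beta',\gamma')$ for some $(\alpha',\beta',\gamma')\neq(\alpha,\beta,\gamma)$ in $(\mathbb{C}^*)^2\times\mathbb{C}$. (2) For $\alpha\in\mathbb{C}^*$ and any $\gamma$, the theme $E(\alpha,\alpha,\gamma)$ is invariant, but no holomorphic family of such themes, on any reduced complex space $X$, is universal near a point $x_0\in X$ with $E(x_0)\simeq E(\alpha,\alpha,\gamma)$.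 (3) For $\alpha\neq\beta$ in $\mathbb{C}^*$ and any $\gamma$, there is a holomorphic family of such themes on a smooth complex space of dimension $2$ which is universal near each point of this space, in which no isomorphism class appears twice, and which has a fiber isomorphic to $E(\alpha,\beta,\gamma)$. -/

import Mathlib

open Filter Topology

/-- The ring `ℂ[[b]]`; the variable `b` is `PowerSeries.X`. -/
abbrev Cb : Type := PowerSeries ℂ

/-- The variable `b` of `ℂ[[b]]`. -/
noncomputable abbrev bVar : Cb := PowerSeries.X

/-- A complex number as a constant series. -/
noncomputable abbrev cst (c : ℂ) : Cb := PowerSeries.C c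

/-- Derivative with respect to `b`. -/
noncomputable abbrev bDeriv (S : Cb) : Cb := PowerSeries.derivative ℂ S

/-- A `ℂ[[b]]`-module with an operator `a` such that `a S = S a + b² S'` for `S ∈ ℂ[[b]]`, i.e. `a` is
`ℂ`-linear, `b`-adically continuous and `a b - b a = b²`.  It is an (a,b)-module when it is
moreover free of finite rank over `ℂ[[b]]`. -/
class ABModule (E : Type*) [AddCommGroup E] [Module Cb E] where
  a : E →+ E
  a_smul : ∀ (S : Cb) (v : E), a (S • v) = S • a v + (bVar ^ 2 * bDeriv S) • v

/-- The iterate `a^j v`. -/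
def aPow {E : Type*} [AddCommGroup E] [Module Cb E] [ABModule E] (j : ℕ) (v : E) : E :=
  (ABModule.a : E →+ E)^[j] v

/-- A `ℂ[[b]]`-linear map that commutes with `a`. -/
def IsABLinear {E F : Type*} [AddCommGroup E] [Module Cb E] [ABModule E]
    [AddCommGroup F] [Module Cb F] [ABModule F] (θ : E →ₗ[Cb] F) : Prop :=
  ∀ v : E, θ (ABModule.a v) = ABModule.a (θ v)

/-- `E` and `F` are isomorphic. -/
def ABIsomorphic (E F : Type*) [AddCommGroup E] [Module Cb E] [ABModule E]
    [AddCommGroup F] [Module Cb F] [ABModule F] : Prop :=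
  ∃ θ : E →ₗ[Cb] F, IsABLinear θ ∧ Function.Bijective θ

/-- The underlying module of `Ξ_Λ^{(N)} = ⊕_{μ ∈ Λ} ⊕_{j ≤ N} ℂ[[b]] e_{μ,j}`. -/
def Xi (Λ : Finset ℚ) (N : ℕ) : Type := Λ → Fin (N + 1) → Cb

noncomputable instance (Λ : Finset ℚ) (N : ℕ) : AddCommGroup (Xi Λ N) :=
  inferInstanceAs (AddCommGroup (Λ → Fin (N + 1) → Cb))

noncomputable instance (Λ : Finset ℚ) (N : ℕ) : Module Cb (Xi Λ N) :=
  inferInstanceAs (Module Cb (Λ → Fin (N + 1) → Cb))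

/-- `a e_{μ,0} = μ b e_{μ,0}` and `a e_{μ,j} = μ b e_{μ,j} + b e_{μ,j-1}`. -/
noncomputable instance (Λ : Finset ℚ) (N : ℕ) : ABModule (Xi Λ N) where
  a :=
    { toFun := fun x μ j =>
        cst ((μ : ℚ) : ℂ) * bVar * x μ j + bVar ^ 2 * bDeriv (x μ j)
          + (if h : (j : ℕ) + 1 < N + 1 then bVar * x μ ⟨(j : ℕ) + 1, h⟩ else 0)
      map_zero' := by
        funext μ j
        change _ * (0 : Cb) + _ * bDeriv (0 : Cb) + (if h : _ then _ * (0 : Cb) else 0) = (0 : Cb)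
        simp
      map_add' := fun x y => by
        funext μ j
        change _ * (x μ j + y μ j) + _ * bDeriv (x μ j + y μ j)
            + (if h : _ then _ * (x μ _ + y μ _) else 0) = (_ + (dite _ _ _)) + (_ + (dite _ _ _))
        simp only [bDeriv, map_add]
        split_ifs <;> ring }
  a_smul := fun S x => by
    funext μ j
    change _ * (S * x μ j) + _ * bDeriv (S * x μ j)
        + (if h : _ then _ * (S * x μ _) else 0)
        = S * (_ + (dite _ _ _)) + (bVar ^ 2 * bDeriv S) * x μ j
    simp only [bDeriv, Derivation.leibniz, smul_eq_mul, smul_eq_mul]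
    split_ifs <;> ring

/-- The underlying module `ℂ[[b]] e₁ ⊕ ℂ[[b]] e₂ ⊕ ℂ[[b]] e₃` of the theme `E(α,β,γ)`
with fundamental invariants `λ₁ = lam`, `p₁ = p₂ = 1`. -/
@[nolint unusedArguments]
def CanonicalTheme (_lam : ℚ) (_α _β _γ : ℂ) : Type := Fin 3 → Cb

noncomputable instance (lam : ℚ) (α β γ : ℂ) : AddCommGroup (CanonicalTheme lam α β γ) :=
  inferInstanceAs (AddCommGroup (Fin 3 → Cb))

noncomputable instance (lam : ℚ) (α β γ : ℂ) : Module Cb (CanonicalTheme lam α β γ) :=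
  inferInstanceAs (Module Cb (Fin 3 → Cb))

/-- The operator `a` of `E(α,β,γ)` in the coordinates `x 0 e₁ + x 1 e₂ + x 2 e₃`. -/
noncomputable def canonicalA (lam : ℚ) (α β γ : ℂ) (x : Fin 3 → Cb) : Fin 3 → Cb :=
  ![cst (lam : ℂ) * bVar * x 0 + bVar ^ 2 * bDeriv (x 0)
      + (1 + cst β * bVar + cst γ * bVar ^ 2) * x 1,
    cst (lam : ℂ) * bVar * x 1 + bVar ^ 2 * bDeriv (x 1) + (1 + cst α * bVar) * x 2,
    cst (lam : ℂ) * bVar * x 2 + bVar ^ 2 * bDeriv (x 2)]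

theorem canonicalA_zero (lam : ℚ) (α β γ : ℂ) : canonicalA lam α β γ 0 = 0 := by
  funext i
  fin_cases i <;> simp [canonicalA]

theorem canonicalA_add (lam : ℚ) (α β γ : ℂ) (x y : Fin 3 → Cb) :
    canonicalA lam α β γ (x + y) = canonicalA lam α β γ x + canonicalA lam α β γ y := by
  funext i
  fin_cases i <;> simp [canonicalA] <;> ring

theorem canonicalA_smul (lam : ℚ) (α β γ : ℂ) (S : Cb) (x : Fin 3 → Cb) :
    canonicalA lam α β γ (S • x)
      = S • canonicalA lam α β γ x + (bVar ^ 2 * bDeriv S) • x := by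
  funext i
  fin_cases i <;> simp [canonicalA] <;> ring

/-- `(a - λ b) e₃ = (1 + α b) e₂`, `(a - λ b) e₂ = (1 + β b + γ b²) e₁`, `(a - λ b) e₁ = 0`; that is,
the quotient of the `b`-completed algebra generated by `a` and `b` by the left ideal of
`(a - λ b) (1 + β b + γ b²)⁻¹ (a - λ b) (1 + α b)⁻¹ (a - λ b)`, with `e₃` the class of `1`. -/
noncomputable instance (lam : ℚ) (α β γ : ℂ) : ABModule (CanonicalTheme lam α β γ) where
  a :=
    { toFun := canonicalA lam α β γ
      map_zero' := canonicalA_zero lam α β γ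
      map_add' := canonicalA_add lam α β γ }
  a_smul := canonicalA_smul lam α β γ

/-- `E` is a `[lam]`-primitive theme: it is isomorphic to the submodule generated over `ℂ[[b]]` and `a`
by one element `φ` of some `Ξ_μ^{(N)}`, where `μ ∈ ]0,1]` is congruent to `lam` modulo `ℤ`. -/
def IsPrimitiveTheme (lam : ℚ) (E : Type*) [AddCommGroup E] [Module Cb E] [ABModule E] : Prop :=
  ∃ μ : ℚ, 0 < μ ∧ μ ≤ 1 ∧ (∃ m : ℤ, lam = μ + m) ∧
    ∃ (N : ℕ) (φ : Xi {μ} N) (θ : E →ₗ[Cb] Xi {μ} N),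
      IsABLinear θ ∧ Function.Injective θ ∧
        LinearMap.range θ = Submodule.span Cb (Set.range fun ν : ℕ => aPow ν φ)

/-- `E` has a filtration `0 = F₀ ⊂ F₁ ⊂ ⋯ ⊂ F_k = E` by submodules stable by `a` with
`F_j / F_{j-1}` free of rank one on a generator `e` with `a e = λ_j b e`; here
`F_j` is spanned by the first `j` vectors of a basis.
For a primitive theme the `F_j` are its normal submodules. The integers `p_j` are given by
`λ_{j+1} = λ_j + p_j - 1`. -/
def HasFundamentalInvariants {k : ℕ} (lams : Fin k → ℚ)
    (E : Type*) [AddCommGroup E] [Module Cb E] [ABModule E] : Prop :=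
  ∃ e : Module.Basis (Fin k) Cb E, ∀ j : Fin k,
    ABModule.a (e j) - (cst (lams j : ℂ) * bVar) • e j ∈ Submodule.span Cb (e '' {i | i < j})

/-- `E` is a primitive theme of rank `k` with fundamental invariants `λ₁, …, λ_k`. -/
def IsThemeWithInvariants {k : ℕ} (lams : Fin k → ℚ)
    (E : Type*) [AddCommGroup E] [Module Cb E] [ABModule E] : Prop :=
  (∀ j, IsPrimitiveTheme (lams j) E) ∧ HasFundamentalInvariants lams E

/-- A theme of rank `k` is invariant when it has an endomorphism of rank `k - 1`. -/
def IsInvariantTheme (E : Type*) [AddCommGroup E] [Module Cb E] [ABModule E] : Prop :=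
  ∃ u : E →ₗ[Cb] E, IsABLinear u ∧
    Module.finrank Cb (LinearMap.range u) + 1 = Module.finrank Cb E

universe u v w w'

/-- `e` identifies `U` with the subset `A` of `ℂⁿ` in such a way that the functions
satisfying `H` at a point are those which are, near this point, restrictions to `A` of holomorphic functions of
`n` variables. -/
def IsHolChart {M : Type u} [TopologicalSpace M] (H : (M → ℂ) → M → Prop) {n : ℕ}
    {U : Set M} {A : Set (Fin n → ℂ)} (e : U ≃ₜ A) : Prop :=
  ∀ (f : M → ℂ) (y : U), H f y ↔
    ∃ G : (Fin n → ℂ) → ℂ, AnalyticAt ℂ G (e y) ∧ ∀ᶠ z : U in 𝓝 y, f z = G (e z)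

/-- A reduced complex space: a Hausdorff space with a sheaf of `ℂ`-valued functions, locally isomorphic to
the zero set of finitely many holomorphic functions on an open subset of some `ℂⁿ`.
`IsHolAt f x` says that `f` is a section of the sheaf on some neighbourhood of `x`. -/
class ReducedComplexSpace (M : Type u) [TopologicalSpace M] where
  t2 : T2Space M
  IsHolAt : (M → ℂ) → M → Prop
  exists_chart : ∀ x : M, ∃ (U : Set M) (n m : ℕ) (D : Set (Fin n → ℂ))
    (F : Fin m → (Fin n → ℂ) → ℂ),
    IsOpen U ∧ x ∈ U ∧ IsOpen D ∧ (∀ i, AnalyticOnNhd ℂ (F i) D) ∧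
      ∃ e : U ≃ₜ {z : Fin n → ℂ | z ∈ D ∧ ∀ i, F i z = 0}, IsHolChart IsHolAt e

/-- `M` is smooth of pure dimension `d`: it is locally isomorphic to open subsets of `ℂᵈ`. -/
def IsSmoothOfDim (d : ℕ) (M : Type u) [TopologicalSpace M] [ReducedComplexSpace M] : Prop :=
  ∀ x : M, ∃ (U : Set M) (D : Set (Fin d → ℂ)), IsOpen U ∧ x ∈ U ∧ IsOpen D ∧
    ∃ e : U ≃ₜ D, IsHolChart (ReducedComplexSpace.IsHolAt (M := M)) e

/-- `f` restricts to a holomorphic map on the open set `U`. -/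
def IsHolMapOn {M : Type u} {N : Type v} [TopologicalSpace M] [ReducedComplexSpace M]
    [TopologicalSpace N] [ReducedComplexSpace N] (f : M → N) (U : Set M) : Prop :=
  ContinuousOn f U ∧ ∀ y ∈ U, ∀ g : N → ℂ,
    ReducedComplexSpace.IsHolAt g (f y) → ReducedComplexSpace.IsHolAt (g ∘ f) y

/-- `S` is a section of `𝒪[[b]]` near `x`: there is a neighbourhood of `x` on which
all the coefficients of `S` are holomorphic. -/
def IsHolSeriesAt {M : Type u} [TopologicalSpace M] [ReducedComplexSpace M]
    (S : M → Cb) (x : M) : Prop :=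
  ∀ᶠ z in 𝓝 x, ∀ n : ℕ, ReducedComplexSpace.IsHolAt (fun y => PowerSeries.coeff n (S y)) z

/-- A sheaf of `𝒪_M`-(a,b)-modules on the reduced complex space `M`, given by its fibers and its sections:
since `M` is reduced, a section of the locally free sheaf on an open set is determined by its
values in the fibers. `IsHolAt t x` says that `t` is a section of the sheaf near `x`. -/
structure ABFamily (M : Type u) [TopologicalSpace M] [ReducedComplexSpace M] where
  fib : M → Type w
  [grp : ∀ x, AddCommGroup (fib x)]
  [mod : ∀ x, Module Cb (fib x)]
  [ab : ∀ x, ABModule (fib x)]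
  IsHolAt : (∀ x, fib x) → M → Prop
  /-- The sheaf is locally free of finite type over `𝒪_M[[b]]`, with the given fibers. -/
  exists_frame : ∀ x₀ : M, ∃ (U : Set M) (k : ℕ) (s : Fin k → ∀ x, fib x),
    IsOpen U ∧ x₀ ∈ U ∧ ∀ x ∈ U,
      (LinearIndependent Cb (fun i => s i x) ∧
        Submodule.span Cb (Set.range fun i => s i x) = ⊤) ∧
      ∀ t : ∀ x, fib x, IsHolAt t x ↔ ∃ g : Fin k → M → Cb,
        (∀ i, IsHolSeriesAt (g i) x) ∧ ∀ᶠ z in 𝓝 x, t z = ∑ i, g i z • s i z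
  /-- The sheaf is stable by `a`. -/
  a_hol : ∀ (t : ∀ x, fib x) (x : M), IsHolAt t x → IsHolAt (fun y => ABModule.a (t y)) x

attribute [instance] ABFamily.grp ABFamily.mod ABFamily.ab

/-- The map `φ : U → Ξ_Λ^{(N)}` is holomorphic and `k`-thematic on `U`: the sheaf generated by the
`a^ν φ` has basis `φ, a φ, …, a^{k-1} φ` and its fiber at `x` is the submodule
of `Ξ_Λ^{(N)}` generated by `φ(x)`. -/
def IsThematicOn {M : Type u} [TopologicalSpace M] [ReducedComplexSpace M] {Λ : Finset ℚ} {N : ℕ}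
    (k : ℕ) (φ : M → Xi Λ N) (U : Set M) : Prop :=
  (∀ x ∈ U, ∀ μ j, IsHolSeriesAt (fun y => φ y μ j) x) ∧
  (∀ x ∈ U, LinearIndependent Cb (fun j : Fin k => aPow j (φ x))) ∧
  ∃ S : Fin k → M → Cb, (∀ j, ∀ x ∈ U, IsHolSeriesAt (S j) x) ∧
    ∀ x ∈ U, aPow k (φ x) = ∑ j : Fin k, S j x • aPow j (φ x)

/-- The restriction of `𝔼` to `U` is isomorphic, as a sheaf with its action of `a`, to the subsheaf of
`Ξ_{U,Λ}^{(N)}` with basis `φ, a φ, …, a^{k-1} φ`. -/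
def ABFamily.IsIsoThematicOn {M : Type u} [TopologicalSpace M] [ReducedComplexSpace M]
    (𝔼 : ABFamily.{u, w} M) {Λ : Finset ℚ} {N : ℕ}
    (k : ℕ) (φ : M → Xi Λ N) (U : Set M) : Prop :=
  ∃ θ : ∀ x, 𝔼.fib x →ₗ[Cb] Xi Λ N, ∀ x ∈ U,
    IsABLinear (θ x) ∧ Function.Injective (θ x) ∧
    LinearMap.range (θ x) = Submodule.span Cb (Set.range fun j : Fin k => aPow j (φ x)) ∧
    ∀ t : ∀ x, 𝔼.fib x, 𝔼.IsHolAt t x ↔ ∃ g : Fin k → M → Cb,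
      (∀ j, IsHolSeriesAt (g j) x) ∧
        ∀ᶠ z in 𝓝 x, θ z (t z) = ∑ j : Fin k, g j z • aPow j (φ z)

/-- `𝔼` is a holomorphic family of primitive themes of rank `k` with fundamental invariants
`λ₁, …, λ_k`. -/
def ABFamily.IsHolFamily {M : Type u} [TopologicalSpace M] [ReducedComplexSpace M]
    (𝔼 : ABFamily.{u, w} M) {k : ℕ} (lams : Fin k → ℚ) : Prop :=
  (∀ x, IsThemeWithInvariants lams (𝔼.fib x)) ∧
  ∀ x₀ : M, ∃ (U : Set M) (Λ : Finset ℚ) (φ : M → Xi Λ (k - 1)),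
    IsOpen U ∧ x₀ ∈ U ∧ (∀ μ ∈ Λ, 0 < μ ∧ μ ≤ 1) ∧
      IsThematicOn k φ U ∧ 𝔼.IsIsoThematicOn k φ U

/-- Sections near `y` of the pull back of `𝔼` by `f`, whose fiber at `y` is `E(f(y))`: they are, locally,
the combinations with coefficients in `𝒪[[b]]` of pull backs of sections of `𝔼`. -/
def ABFamily.IsPullbackHolAt {M : Type u} {N : Type v}
    [TopologicalSpace M] [ReducedComplexSpace M] [TopologicalSpace N] [ReducedComplexSpace N]
    (𝔼 : ABFamily.{u, w} M) (f : N → M) (t : ∀ y, 𝔼.fib (f y)) (y : N) : Prop :=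
  ∃ (n : ℕ) (s : Fin n → ∀ x, 𝔼.fib x) (g : Fin n → N → Cb),
    (∀ i, 𝔼.IsHolAt (s i) (f y)) ∧ (∀ i, IsHolSeriesAt (g i) y) ∧
      ∀ᶠ z in 𝓝 y, t z = ∑ i, g i z • s i (f z)

/-- `f` is a holomorphic map on an open neighbourhood of `y₀` with `f y₀ = x₀`, such that the
pull back of `𝔼` by `f` is isomorphic to `ℍ` on this neighbourhood. -/
def IsClassifyingMapAt {M : Type u} {N : Type v}
    [TopologicalSpace M] [ReducedComplexSpace M] [TopologicalSpace N] [ReducedComplexSpace N]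
    (𝔼 : ABFamily.{u, w} M) (x₀ : M) (ℍ : ABFamily.{v, w'} N) (y₀ : N) (f : N → M) : Prop :=
  f y₀ = x₀ ∧ ∃ U : Set N, IsOpen U ∧ y₀ ∈ U ∧ IsHolMapOn f U ∧
    ∃ θ : ∀ y, 𝔼.fib (f y) →ₗ[Cb] ℍ.fib y, ∀ y ∈ U,
      IsABLinear (θ y) ∧ Function.Bijective (θ y) ∧
      ∀ t : ∀ y, 𝔼.fib (f y), 𝔼.IsPullbackHolAt f t y ↔ ℍ.IsHolAt (fun z => θ z (t z)) y

/-- `𝔼` is universal near `x₀`: every holomorphic family `ℍ` of themes with the same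
fundamental invariants, whose fiber at `y₀` is isomorphic to that of `𝔼` at `x₀`, is near `y₀`
the pull back of `𝔼` by a holomorphic map sending `y₀` to `x₀`, and the germ of this map at `y₀`
is unique. -/
def ABFamily.IsUniversalNear {M : Type u} [TopologicalSpace M] [ReducedComplexSpace M]
    (𝔼 : ABFamily.{u, w} M) {k : ℕ} (lams : Fin k → ℚ) (x₀ : M) : Prop :=
  ∀ (N : Type v) [TopologicalSpace N] [ReducedComplexSpace N] (ℍ : ABFamily.{v, w'} N) (y₀ : N),
    ℍ.IsHolFamily lams → ABIsomorphic (ℍ.fib y₀) (𝔼.fib x₀) →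
      (∃ f : N → M, IsClassifyingMapAt 𝔼 x₀ ℍ y₀ f) ∧
      ∀ f f' : N → M, IsClassifyingMapAt 𝔼 x₀ ℍ y₀ f → IsClassifyingMapAt 𝔼 x₀ ℍ y₀ f' →
        f =ᶠ[𝓝 y₀] f'

/-! Homomorphisms E(α,β,γ) → E(α',β',γ') can be computed completely. On the basis e₁, e₂, e₃
commutation with a becomes a system of equations b²s' = p + qb + db². Such an equation is solvable
only for p = q = 0, and then s = const + db. So a homomorphism is given by a diagonal constant c and
constants k, l with α'c = αc, β'c = βc and (β' - α)k = (γ - γ')c (`hom_canonicalTheme`). An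
isomorphism has c ≠ 0, hence α and β are invariants of the isomorphism class. If α ≠ β, the last
relation is solved by some k for all γ, γ', so γ carries no information; if α = β, it forces γ = γ'.
For an endomorphism it reads (β - α)k = 0, and rank 2 means c = 0, k ≠ 0, which is possible exactly
when α = β.

Universality fails at α = β because γ matters only there. Over ℂ² with coordinates (s,t), the family
E(α, αeˢ, γ + t(eˢ - 1)) is isomorphic to the pull back of E(α, αeˢ, γ + t) by (s,t) ↦ (s, t(eˢ -
1)) and also, after a shear, by (s,t) ↦ (s,0). With a universal family, a classifying map f of E(α,
αeˢ, γ + t) would satisfy f(s, t(eˢ - 1)) = f(s,0). The identity theorem for s ≠ 0, followed by s →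
0, makes f constant on s = 0 (`eq_of_constant_on_curves`), although the themes E(α,α,γ + t) are
pairwise non isomorphic (`not_isUniversalNear`).

For α ≠ β the family E(α,β,0) over pairs of distinct nonzero numbers is universal. Classifying maps
are unique because α and β are invariants. They exist because every holomorphic family is locally a
family of canonical themes with holomorphic parameters (`exists_local_canonical_form`), from which a
shear removes γ. To get this, compare coefficients of powers of b in Ξ: each fiber of a thematic
family has the same image as an explicitly embedded canonical theme (`exists_eq_embCoord`,
`exists_range_eq_range_themeEmb`). Unlike the isomorphism class, this embedded submodule determines
γ too: α, β, γ are rational functions of finitely many coefficients of the generator φ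
(`params_of_embCoord`), hence holomorphic. -/

/-! ### Holomorphic functions on a reduced complex space -/

namespace ReducedComplexSpace

variable {M : Type u} [TopologicalSpace M] [ReducedComplexSpace M]

/-- In a chart the `F i` are restrictions of ambient holomorphic functions, with which Φ is
composed. The algebraic operations below are derived from this. -/
theorem isHolAt_comp_analyticAt {k : ℕ} {F : Fin k → M → ℂ} {x : M} (hF : ∀ i, IsHolAt (F i) x)
    {Φ : (Fin k → ℂ) → ℂ} (hΦ : AnalyticAt ℂ Φ (fun i => F i x)) :
    IsHolAt (fun y => Φ (fun i => F i y)) x := by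
  obtain ⟨U, n, m, D, P, hU, hx, -, -, e, he⟩ := exists_chart x
  have hF' := fun i => (he (F i) ⟨x, hx⟩).1 (hF i)
  choose G hG hFG using hF'
  refine (he _ ⟨x, hx⟩).2 ⟨fun z => Φ (fun i => G i z), ?_, ?_⟩
  · have h0 : (fun i => F i x) = fun i => G i (e ⟨x, hx⟩) := by
      funext i
      exact (hFG i).self_of_nhds
    rw [h0] at hΦ
    exact AnalyticAt.fun_comp hΦ (AnalyticAt.pi hG)
  · filter_upwards [eventually_all.2 hFG] with z hz
    simp only [hz]

theorem isHolAt_const (c : ℂ) (x : M) : IsHolAt (fun _ : M => c) x :=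
  isHolAt_comp_analyticAt (F := Fin.elim0) (Φ := fun _ => c) (fun i => i.elim0) analyticAt_const

theorem IsHolAt.comp_analyticAt {f : M → ℂ} {x : M} (hf : IsHolAt f x) {Φ : ℂ → ℂ}
    (hΦ : AnalyticAt ℂ Φ (f x)) : IsHolAt (fun y => Φ (f y)) x :=
  isHolAt_comp_analyticAt (F := fun _ : Fin 1 => f) (Φ := fun z => Φ (z 0)) (fun _ => hf)
    (AnalyticAt.fun_comp (g := Φ) (f := fun z : Fin 1 → ℂ => z 0) hΦ
      ((ContinuousLinearMap.proj (R := ℂ) (φ := fun _ : Fin 1 => ℂ) 0).analyticAt _))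

theorem analyticAt_coord {n : ℕ} (i : Fin n) (z : Fin n → ℂ) :
    AnalyticAt ℂ (fun z : Fin n → ℂ => z i) z :=
  (ContinuousLinearMap.proj (R := ℂ) (φ := fun _ : Fin n => ℂ) i).analyticAt _

theorem IsHolAt.add {f g : M → ℂ} {x : M} (hf : IsHolAt f x) (hg : IsHolAt g x) :
    IsHolAt (fun y => f y + g y) x :=
  isHolAt_comp_analyticAt (F := ![f, g]) (Φ := fun z => z 0 + z 1)
    (by simp [Fin.forall_fin_two, hf, hg]) ((analyticAt_coord 0 _).add (analyticAt_coord 1 _))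

theorem IsHolAt.mul {f g : M → ℂ} {x : M} (hf : IsHolAt f x) (hg : IsHolAt g x) :
    IsHolAt (fun y => f y * g y) x :=
  isHolAt_comp_analyticAt (F := ![f, g]) (Φ := fun z => z 0 * z 1)
    (by simp [Fin.forall_fin_two, hf, hg]) ((analyticAt_coord 0 _).mul (analyticAt_coord 1 _))

theorem IsHolAt.neg {f : M → ℂ} {x : M} (hf : IsHolAt f x) : IsHolAt (fun y => -f y) x :=
  hf.comp_analyticAt (Φ := fun z => -z) analyticAt_id.neg

theorem IsHolAt.sub {f g : M → ℂ} {x : M} (hf : IsHolAt f x) (hg : IsHolAt g x) :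
    IsHolAt (fun y => f y - g y) x := by
  simpa only [sub_eq_add_neg] using hf.add hg.neg

theorem IsHolAt.inv {f : M → ℂ} {x : M} (hf : IsHolAt f x) (h0 : f x ≠ 0) :
    IsHolAt (fun y => (f y)⁻¹) x :=
  hf.comp_analyticAt (Φ := fun z => z⁻¹) (analyticAt_inv h0)

theorem IsHolAt.div {f g : M → ℂ} {x : M} (hf : IsHolAt f x) (hg : IsHolAt g x) (h0 : g x ≠ 0) :
    IsHolAt (fun y => f y / g y) x := by
  simpa only [div_eq_mul_inv] using hf.mul (hg.inv h0)

theorem isHolAt_sum {ι : Type*} (s : Finset ι) {f : ι → M → ℂ} {x : M}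
    (hf : ∀ i ∈ s, IsHolAt (f i) x) : IsHolAt (fun y => ∑ i ∈ s, f i y) x := by
  classical
  induction s using Finset.induction_on with
  | empty => simpa using isHolAt_const 0 x
  | insert a s ha ih =>
    simp only [Finset.sum_insert ha]
    exact (hf a (by simp)).add (ih fun i hi => hf i (by simp [hi]))

theorem IsHolAt.congr {f g : M → ℂ} {x : M} (hf : IsHolAt f x) (h : f =ᶠ[𝓝 x] g) :
    IsHolAt g x := by
  obtain ⟨U, n, m, D, P, hU, hx, -, -, e, he⟩ := exists_chart x
  obtain ⟨G, hG, hfG⟩ := (he f ⟨x, hx⟩).1 hf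
  refine (he g ⟨x, hx⟩).2 ⟨G, hG, ?_⟩
  filter_upwards [hfG, continuous_subtype_val.continuousAt.eventually h] with z hz hz'
  rw [← hz, hz']

theorem IsHolAt.continuousAt {f : M → ℂ} {x : M} (hf : IsHolAt f x) : ContinuousAt f x := by
  obtain ⟨U, n, m, D, P, hU, hx, -, -, e, he⟩ := exists_chart x
  obtain ⟨G, hG, hfG⟩ := (he f ⟨x, hx⟩).1 hf
  have h1 : ContinuousAt (fun z : U => G (e z)) ⟨x, hx⟩ :=
    ContinuousAt.comp' (f := fun z : U => (e z : Fin n → ℂ)) hG.continuousAt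
      (continuous_subtype_val.comp e.continuous).continuousAt
  have h2 : ContinuousAt (fun z : U => f z) ⟨x, hx⟩ :=
    h1.congr (by filter_upwards [hfG] with z hz using hz.symm)
  exact (hU.isOpenEmbedding_subtypeVal.continuousAt_iff (g := f) (x := ⟨x, hx⟩)).1 h2

theorem IsHolAt.eventually {f : M → ℂ} {x : M} (hf : IsHolAt f x) :
    ∀ᶠ y in 𝓝 x, IsHolAt f y := by
  obtain ⟨U, n, m, D, P, hU, hx, -, -, e, he⟩ := exists_chart x
  obtain ⟨G, hG, hfG⟩ := (he f ⟨x, hx⟩).1 hf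
  have h1 : ∀ᶠ z : U in 𝓝 ⟨x, hx⟩, AnalyticAt ℂ G (e z) :=
    (continuous_subtype_val.comp e.continuous).continuousAt.eventually
      (f := fun z : U => (e z : Fin n → ℂ)) hG.eventually_analyticAt
  have h2 : ∀ᶠ z : U in 𝓝 ⟨x, hx⟩, IsHolAt f z := by
    filter_upwards [h1, hfG.eventually_nhds] with z hz hz'
    exact (he f z).2 ⟨G, hz, hz'⟩
  rw [nhds_subtype_eq_comap, eventually_comap] at h2
  filter_upwards [h2, hU.mem_nhds hx] with z hz hzU using hz ⟨z, hzU⟩ rfl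

end ReducedComplexSpace

/-! ### Power series in b with holomorphic coefficients -/

namespace IsHolSeriesAt

open ReducedComplexSpace

variable {M : Type u} [TopologicalSpace M] [ReducedComplexSpace M] {S T : M → Cb} {x : M}

theorem const (s : Cb) (x : M) : IsHolSeriesAt (fun _ : M => s) x :=
  Eventually.of_forall fun _ _ => isHolAt_const _ _

theorem of_cst {f : M → ℂ} (hf : IsHolAt f x) : IsHolSeriesAt (fun y => cst (f y)) x := by
  filter_upwards [hf.eventually] with z hz n
  simp only [cst, PowerSeries.coeff_C]
  split_ifs
  · exact hz
  · exact isHolAt_const _ _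

theorem add (hS : IsHolSeriesAt S x) (hT : IsHolSeriesAt T x) :
    IsHolSeriesAt (fun y => S y + T y) x := by
  filter_upwards [hS, hT] with z hz hz' n
  simpa only [map_add] using (hz n).add (hz' n)

theorem mul (hS : IsHolSeriesAt S x) (hT : IsHolSeriesAt T x) :
    IsHolSeriesAt (fun y => S y * T y) x := by
  filter_upwards [hS, hT] with z hz hz' n
  simp only [PowerSeries.coeff_mul]
  exact isHolAt_sum _ fun p _ => (hz p.1).mul (hz' p.2)

theorem neg (hS : IsHolSeriesAt S x) : IsHolSeriesAt (fun y => -S y) x := by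
  filter_upwards [hS] with z hz n
  simpa only [map_neg] using (hz n).neg

theorem sub (hS : IsHolSeriesAt S x) (hT : IsHolSeriesAt T x) :
    IsHolSeriesAt (fun y => S y - T y) x := by
  simpa only [sub_eq_add_neg] using hS.add hT.neg

theorem sum {ι : Type*} (s : Finset ι) {f : ι → M → Cb}
    (hf : ∀ i ∈ s, IsHolSeriesAt (f i) x) : IsHolSeriesAt (fun y => ∑ i ∈ s, f i y) x := by
  classical
  induction s using Finset.induction_on with
  | empty => simpa using const 0 x
  | insert a s ha ih =>
    simp only [Finset.sum_insert ha]
    exact (hf a (by simp)).add (ih fun i hi => hf i (by simp [hi]))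

theorem deriv (hS : IsHolSeriesAt S x) : IsHolSeriesAt (fun y => bDeriv (S y)) x := by
  filter_upwards [hS] with z hz n
  simp only [bDeriv, PowerSeries.coeff_derivative]
  exact (hz (n + 1)).mul (isHolAt_const _ _)

theorem congr (hS : IsHolSeriesAt S x) (h : S =ᶠ[𝓝 x] T) : IsHolSeriesAt T x := by
  filter_upwards [hS, h.eventually_nhds] with z hz hz' n
  refine (hz n).congr ?_
  filter_upwards [hz'] with y hy using by rw [hy]

theorem coeff (hS : IsHolSeriesAt S x) (n : ℕ) :
    IsHolAt (fun y => PowerSeries.coeff n (S y)) x :=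
  hS.self_of_nhds n

theorem of_X_pow_mul {k : ℕ} (hS : IsHolSeriesAt (fun y => PowerSeries.X ^ k * S y) x) :
    IsHolSeriesAt S x := by
  filter_upwards [hS] with z hz n
  simpa only [PowerSeries.coeff_X_pow_mul] using hz (n + k)

/-- One neighbourhood has to serve all coefficients: the one where the coefficients of S are
holomorphic and its constant term does not vanish. The recursion for the coefficients of the inverse
divides by nothing but this constant term. -/
theorem inv (hS : IsHolSeriesAt S x) (h0 : PowerSeries.constantCoeff (S x) ≠ 0) :
    IsHolSeriesAt (fun y => (S y)⁻¹) x := by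
  have hc : ∀ᶠ z in 𝓝 x, PowerSeries.constantCoeff (S z) ≠ 0 := by
    have h1 := (hS.coeff 0).continuousAt
    simp only [PowerSeries.coeff_zero_eq_constantCoeff] at h1
    exact h1.eventually_ne h0
  filter_upwards [hS, hc] with z hz hz0 n
  have hi : IsHolAt (fun y => (PowerSeries.constantCoeff (S y))⁻¹) z := by
    have h1 := hz 0
    simp only [PowerSeries.coeff_zero_eq_constantCoeff] at h1
    exact h1.inv hz0
  induction n using Nat.strong_induction_on with
  | _ n ih =>
    simp only [fun y => PowerSeries.coeff_inv n (S y)]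
    split_ifs with hn
    · exact hi
    · refine hi.neg.mul (isHolAt_sum _ fun p _ => ?_)
      split_ifs with hp
      · exact (hz _).mul (ih _ hp)
      · exact isHolAt_const _ _

/-- The product with the adjugate and the inverse of the determinant of a holomorphic matrix. -/
theorem adjugate_mulVec {A : M → Matrix (Fin 3) (Fin 3) Cb} {t : M → Fin 3 → Cb}
    (hA : ∀ i j, IsHolSeriesAt (fun y => A y i j) x) (ht : ∀ i, IsHolSeriesAt (fun y => t y i) x)
    (h0 : IsUnit (A x).det) (i : Fin 3) :
    IsHolSeriesAt (fun y => (A y).det⁻¹ * ((A y).adjugate.mulVec (t y)) i) x := by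
  refine mul (inv ?_ ?_) ?_
  · simp only [Matrix.det_fin_three]
    exact (((((((hA _ _).mul (hA _ _)).mul (hA _ _)).sub (((hA _ _).mul (hA _ _)).mul (hA _ _))).sub
      (((hA _ _).mul (hA _ _)).mul (hA _ _))).add (((hA _ _).mul (hA _ _)).mul (hA _ _))).add
      (((hA _ _).mul (hA _ _)).mul (hA _ _))).sub (((hA _ _).mul (hA _ _)).mul (hA _ _))
  · exact ((PowerSeries.isUnit_iff_constantCoeff).1 h0).ne_zero
  · simp only [Matrix.mulVec, dotProduct]
    refine sum _ fun j _ => mul ?_ (ht j)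
    -- The two sign patterns in which the 2×2 minors occur in the explicit adjugate.
    have h2 : ∀ p q r s p' q' r' s' : Fin 3,
        IsHolSeriesAt (fun y => A y p q * A y r s - A y p' q' * A y r' s') x :=
      fun p q r s p' q' r' s' => ((hA _ _).mul (hA _ _)).sub ((hA _ _).mul (hA _ _))
    have h3 : ∀ p q r s p' q' r' s' : Fin 3,
        IsHolSeriesAt (fun y => -(A y p q * A y r s) + A y p' q' * A y r' s') x :=
      fun p q r s p' q' r' s' => ((hA _ _).mul (hA _ _)).neg.add ((hA _ _).mul (hA _ _))
    simp only [Matrix.adjugate_fin_three]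
    fin_cases i <;> fin_cases j <;>
      simp only [Fin.zero_eta, Fin.mk_one, Fin.reduceFinMk, Matrix.of_apply, Matrix.cons_val,
        Matrix.cons_val_zero, Matrix.cons_val_one] <;> first | exact h2 _ _ _ _ _ _ _ _ | exact h3 _ _ _ _ _ _ _ _

end IsHolSeriesAt

theorem Matrix.mulVec_det_inv_adjugate {A : Matrix (Fin 3) (Fin 3) Cb} (h : IsUnit A.det)
    (t : Fin 3 → Cb) : A.mulVec (fun i => A.det⁻¹ * (A.adjugate.mulVec t) i) = t := by
  have h1 : (fun i => A.det⁻¹ * (A.adjugate.mulVec t) i) = A.det⁻¹ • A.adjugate.mulVec t := rfl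
  rw [h1, Matrix.mulVec_smul, Matrix.mulVec_mulVec, Matrix.mul_adjugate, Matrix.smul_mulVec,
    Matrix.one_mulVec, smul_smul, PowerSeries.inv_mul_cancel, one_smul]
  exact ((PowerSeries.isUnit_iff_constantCoeff).1 h).ne_zero

/-! ### The embedding of a canonical theme into Ξ -/

/-- This is a bⁿ = bⁿ(a + nb) for a = b² d/db: multiplication by bⁿ shifts the eigenvalue by n. -/
theorem bDeriv_X_pow_mul (n : ℕ) (s : Cb) :
    bVar ^ 2 * bDeriv (bVar ^ n * s) = bVar ^ n * (bVar ^ 2 * bDeriv s) + n * bVar ^ (n + 1) * s := by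
  cases n with
  | zero => simp
  | succ n =>
    simp only [bDeriv, Derivation.leibniz, Derivation.leibniz_pow, smul_eq_mul, nsmul_eq_mul,
      PowerSeries.derivative_X, Nat.add_sub_cancel]
    ring

theorem bDeriv_cst_mul (c : ℂ) (s : Cb) : bDeriv (cst c * s) = cst c * bDeriv s := by
  simp [bDeriv, Derivation.leibniz]

/-- The coordinates on `e_{μ,0}, e_{μ,1}, e_{μ,2}` of the image of `x 0 e₁ + x 1 e₂ + x 2 e₃` under the
embedding of `E(α,β,γ)` into `Ξ_μ^{(2)}`, where `λ = μ + k + 2`. -/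
noncomputable def embCoord (k : ℕ) (α β γ : ℂ) (x : Fin 3 → Cb) : Fin 3 → Cb :=
  -- On e_{μ,0}, a - λb sends bⁿ to (n - k - 2) bⁿ⁺¹, so degree k + 2 is resonant: a term of degree
  -- k + 3 on e_{μ,j} is reached only through b^(k+2) e_{μ,j+1}. This places β, γ and αβ in the
  -- resonant degree; 1/2 comes from the factor -2 in degree k.
  ![bVar ^ (k + 2) * x 0 + (cst γ * (bVar ^ (k + 3) * x 1) - bVar ^ (k + 1) * x 1)
      + (cst (1 / 2) * (bVar ^ k * x 2) - cst (β - α) * (bVar ^ (k + 1) * x 2)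
        + cst (α * γ) * (bVar ^ (k + 3) * x 2)),
    cst β * (bVar ^ (k + 2) * x 1) + (cst γ * (bVar ^ (k + 2) * x 2)
      - cst β * (bVar ^ (k + 1) * x 2)),
    cst (α * β) * (bVar ^ (k + 2) * x 2)]

theorem embCoord_add (k : ℕ) (α β γ : ℂ) (x y : Fin 3 → Cb) :
    embCoord k α β γ (x + y) = embCoord k α β γ x + embCoord k α β γ y := by
  funext i
  fin_cases i <;> simp [embCoord] <;> ring

theorem embCoord_smul (k : ℕ) (α β γ : ℂ) (S : Cb) (x : Fin 3 → Cb) :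
    embCoord k α β γ (S • x) = S • embCoord k α β γ x := by
  funext i
  fin_cases i <;> simp [embCoord] <;> ring

theorem cst_two : cst 2 = 2 := map_ofNat PowerSeries.C 2

theorem cst_ne_zero {c : ℂ} (hc : c ≠ 0) : cst c ≠ 0 := by
  simpa [cst] using hc

/-- The system is triangular, with diagonal b^(k+2), β b^(k+2), αβ b^(k+2). This is where αβ ≠ 0
enters. -/
theorem embCoord_eq_zero {k : ℕ} {α β γ : ℂ} (hα : α ≠ 0) (hβ : β ≠ 0) {x : Fin 3 → Cb}
    (h : embCoord k α β γ x = 0) : x = 0 := by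
  have hX : ∀ n : ℕ, bVar ^ n ≠ (0 : Cb) := fun n => pow_ne_zero _ PowerSeries.X_ne_zero
  have h2 : x 2 = 0 := by
    have := congrFun h 2
    simpa [embCoord, hα, hβ, PowerSeries.X_ne_zero] using this
  have h1 : x 1 = 0 := by
    have := congrFun h 1
    simpa [embCoord, h2, hβ, PowerSeries.X_ne_zero] using this
  have h0 : x 0 = 0 := by
    have := congrFun h 0
    simpa [embCoord, h1, h2, PowerSeries.X_ne_zero] using this
  funext i
  fin_cases i <;> assumption

/-- The operator `a` of `Ξ_μ^{(2)}` in coordinates. -/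
noncomputable def xiA (μ : ℂ) (x : Fin 3 → Cb) : Fin 3 → Cb :=
  ![cst μ * bVar * x 0 + bVar ^ 2 * bDeriv (x 0) + bVar * x 1,
    cst μ * bVar * x 1 + bVar ^ 2 * bDeriv (x 1) + bVar * x 2,
    cst μ * bVar * x 2 + bVar ^ 2 * bDeriv (x 2)]

theorem a_xi_apply {Λ : Finset ℚ} (x : Xi Λ 2) (μ : Λ) :
    (ABModule.a x : Xi Λ 2) μ = xiA ((μ : ℚ) : ℂ) (x μ) := by
  funext j
  change cst ((μ : ℚ) : ℂ) * bVar * x μ j + bVar ^ 2 * bDeriv (x μ j)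
    + (if h : (j : ℕ) + 1 < 2 + 1 then bVar * x μ ⟨(j : ℕ) + 1, h⟩ else 0) = _
  fin_cases j <;> simp [xiA]

theorem embCoord_canonicalA {lam μ : ℚ} {k : ℕ} (hk : lam = μ + k + 2) (α β γ : ℂ)
    (x : Fin 3 → Cb) :
    embCoord k α β γ (canonicalA lam α β γ x) = xiA (μ : ℂ) (embCoord k α β γ x) := by
  have hl : cst (lam : ℂ) = cst (μ : ℂ) + k + 2 := by
    rw [hk]; simp [cst, cst_two]
  have h12 : cst (1 / 2 : ℂ) * 2 = 1 := by
    rw [← cst_two, cst, cst, ← map_mul]; norm_num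
  have hba : cst (β - α) = cst β - cst α := map_sub _ _ _
  have hag : cst (α * γ) = cst α * cst γ := map_mul _ _ _
  have hab : cst (α * β) = cst α * cst β := map_mul _ _ _
  funext i
  fin_cases i
  · simp only [embCoord, canonicalA, xiA, Fin.zero_eta, Matrix.cons_val_zero, Matrix.cons_val_one,
      Matrix.cons_val, map_add (PowerSeries.derivative ℂ), map_sub (PowerSeries.derivative ℂ),
      bDeriv_cst_mul, mul_add, mul_sub, hl]
    simp only [mul_left_comm (bVar ^ 2) (cst _), bDeriv_X_pow_mul]
    simp only [hba, hag]
    push_cast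
    linear_combination (x 2 * bVar ^ (k+1)) * h12
  · simp only [embCoord, canonicalA, xiA, Fin.mk_one, Matrix.cons_val_zero, Matrix.cons_val_one,
      Matrix.cons_val, map_add (PowerSeries.derivative ℂ), map_sub (PowerSeries.derivative ℂ),
      bDeriv_cst_mul, mul_add, mul_sub, hl, hba, hag, hab]
    simp only [mul_left_comm (bVar ^ 2) (cst _), bDeriv_X_pow_mul]
    push_cast
    ring
  · simp only [embCoord, canonicalA, xiA, Fin.reduceFinMk, Matrix.cons_val_zero, Matrix.cons_val_one,
      Matrix.cons_val, map_add (PowerSeries.derivative ℂ), map_sub (PowerSeries.derivative ℂ),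
      bDeriv_cst_mul, mul_add, mul_sub, hl, hba, hag, hab]
    simp only [mul_left_comm (bVar ^ 2) (cst _), mul_assoc, bDeriv_cst_mul, bDeriv_X_pow_mul]
    push_cast
    ring

/-- The embedding of `E(α,β,γ)` into `Ξ_Λ^{(2)}`, with image in the summand of index `μ`. -/
noncomputable def themeEmb (lam : ℚ) (Λ : Finset ℚ) (μ : ℚ) (k : ℕ) (α β γ : ℂ) :
    CanonicalTheme lam α β γ →ₗ[Cb] Xi Λ 2 where
  toFun x := fun ν => if (ν : ℚ) = μ then embCoord k α β γ x else 0
  map_add' x y := by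
    funext ν
    change (if _ then embCoord k α β γ (x + y) else 0) = (if _ then _ else _) + (if _ then _ else _)
    split_ifs
    · exact embCoord_add k α β γ x y
    · simp
  map_smul' S x := by
    funext ν
    change (if _ then embCoord k α β γ (S • x) else 0) = S • (if _ then _ else _)
    split_ifs
    · exact embCoord_smul k α β γ S x
    · simp

theorem themeEmb_apply (lam : ℚ) (Λ : Finset ℚ) (μ : ℚ) (k : ℕ) (α β γ : ℂ)
    (x : CanonicalTheme lam α β γ) (ν : Λ) :
    themeEmb lam Λ μ k α β γ x ν = if (ν : ℚ) = μ then embCoord k α β γ x else 0 := rfl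

theorem xiA_zero (μ : ℂ) : xiA μ 0 = 0 := by
  funext i
  fin_cases i <;> simp [xiA]

theorem isABLinear_themeEmb {lam : ℚ} (Λ : Finset ℚ) {μ : ℚ} {k : ℕ} (hk : lam = μ + k + 2)
    (α β γ : ℂ) : IsABLinear (themeEmb lam Λ μ k α β γ) := by
  intro x
  funext ν
  rw [a_xi_apply, themeEmb_apply, themeEmb_apply]
  split_ifs with h
  · rw [h]
    exact embCoord_canonicalA hk α β γ x
  · rw [xiA_zero]

theorem themeEmb_injective (lam : ℚ) {Λ : Finset ℚ} {μ : ℚ} (hμ : μ ∈ Λ) (k : ℕ) {α β : ℂ}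
    (hα : α ≠ 0) (hβ : β ≠ 0) (γ : ℂ) : Function.Injective (themeEmb lam Λ μ k α β γ) := by
  rw [injective_iff_map_eq_zero]
  intro x hx
  have h1 := congrFun hx ⟨μ, hμ⟩
  rw [themeEmb_apply, if_pos rfl] at h1
  exact embCoord_eq_zero hα hβ h1

/-! ### Morphisms, cyclic generators, and canonical themes as primitive themes -/

theorem IsABLinear.map_aPow {E F : Type*} [AddCommGroup E] [Module Cb E] [ABModule E]
    [AddCommGroup F] [Module Cb F] [ABModule F] {θ : E →ₗ[Cb] F} (h : IsABLinear θ) (j : ℕ) (v : E) :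
    θ (aPow j v) = aPow j (θ v) := by
  induction j with
  | zero => rfl
  | succ n ih =>
    simp only [aPow, Function.iterate_succ_apply'] at ih ⊢
    rw [h, ih]

theorem IsABLinear.comp {E F G : Type*} [AddCommGroup E] [Module Cb E] [ABModule E]
    [AddCommGroup F] [Module Cb F] [ABModule F] [AddCommGroup G] [Module Cb G] [ABModule G]
    {θ : E →ₗ[Cb] F} {η : F →ₗ[Cb] G} (h : IsABLinear θ) (h' : IsABLinear η) :
    IsABLinear (η ∘ₗ θ) := fun v => by
  simp only [LinearMap.comp_apply, h v, h' (θ v)]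

theorem IsABLinear.symm {E F : Type*} [AddCommGroup E] [Module Cb E] [ABModule E]
    [AddCommGroup F] [Module Cb F] [ABModule F] {θ : E ≃ₗ[Cb] F}
    (h : IsABLinear (θ : E →ₗ[Cb] F)) : IsABLinear (θ.symm : F →ₗ[Cb] E) := fun v => by
  apply θ.injective
  have := h (θ.symm v)
  simp_all

theorem ABIsomorphic.symm {E F : Type*} [AddCommGroup E] [Module Cb E] [ABModule E]
    [AddCommGroup F] [Module Cb F] [ABModule F] (h : ABIsomorphic E F) : ABIsomorphic F E := by
  obtain ⟨θ, hθ, hb⟩ := h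
  have : IsABLinear ((LinearEquiv.ofBijective θ hb : E ≃ₗ[Cb] F) : E →ₗ[Cb] F) := hθ
  exact ⟨_, this.symm, (LinearEquiv.ofBijective θ hb).symm.bijective⟩

theorem ABIsomorphic.trans {E F G : Type*} [AddCommGroup E] [Module Cb E] [ABModule E]
    [AddCommGroup F] [Module Cb F] [ABModule F] [AddCommGroup G] [Module Cb G] [ABModule G]
    (h : ABIsomorphic E F) (h' : ABIsomorphic F G) : ABIsomorphic E G := by
  obtain ⟨θ, hθ, hb⟩ := h
  obtain ⟨η, hη, hb'⟩ := h'
  exact ⟨η ∘ₗ θ, hθ.comp hη, hb'.comp hb⟩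

/-- The generator `e₃` of `E(α,β,γ)`. -/
noncomputable def themeGen (lam : ℚ) (α β γ : ℂ) : CanonicalTheme lam α β γ :=
  (![0, 0, 1] : Fin 3 → Cb)

/-- The matrix of `c, a c, a² c` in the basis `e₁, e₂, e₃` of `E(α,β,γ)`. -/
noncomputable def cyclicMatrix (lam : ℚ) (α β γ : ℂ) (c : CanonicalTheme lam α β γ) :
    Matrix (Fin 3) (Fin 3) Cb :=
  Matrix.of fun i j => (canonicalA lam α β γ)^[j] c i

theorem cyclicMatrix_mulVec (lam : ℚ) (α β γ : ℂ) (c : CanonicalTheme lam α β γ)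
    (g : Fin 3 → Cb) :
    (cyclicMatrix lam α β γ c).mulVec g
      = (∑ j : Fin 3, g j • aPow (j : ℕ) c :
          CanonicalTheme lam α β γ) := by
  rw [Fin.sum_univ_three]
  funext i
  change ∑ j : Fin 3, cyclicMatrix lam α β γ c i j * g j = g 0 * _ + g 1 * _ + g 2 * _
  rw [Fin.sum_univ_three, mul_comm, mul_comm _ (g 1), mul_comm _ (g 2)]
  rfl

theorem isUnit_det_cyclicMatrix {lam : ℚ} {α β γ : ℂ} {c : CanonicalTheme lam α β γ}
    (h : Submodule.span Cb (Set.range fun j : Fin 3 => aPow (j : ℕ) c)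
      = ⊤) : IsUnit (cyclicMatrix lam α β γ c).det := by
  rw [← Matrix.isUnit_iff_isUnit_det, ← Matrix.mulVec_surjective_iff_isUnit]
  intro (t : CanonicalTheme lam α β γ)
  have ht : t ∈ Submodule.span Cb
      (Set.range fun j : Fin 3 => aPow (j : ℕ) c) := by
    rw [h]; trivial
  obtain ⟨g, hg⟩ := (Submodule.mem_span_range_iff_exists_fun Cb).1 ht
  exact ⟨g, (cyclicMatrix_mulVec lam α β γ c g).trans hg⟩

theorem span_cyclic_of_isUnit_det {lam : ℚ} {α β γ : ℂ} {c : CanonicalTheme lam α β γ}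
    (h : IsUnit (cyclicMatrix lam α β γ c).det) :
    Submodule.span Cb (Set.range fun j : Fin 3 => aPow (j : ℕ) c)
      = ⊤ := by
  rw [eq_top_iff]
  intro t _
  rw [← Matrix.isUnit_iff_isUnit_det, ← Matrix.mulVec_surjective_iff_isUnit] at h
  obtain ⟨g, hg⟩ := h t
  exact (Submodule.mem_span_range_iff_exists_fun Cb).2
    ⟨g, (cyclicMatrix_mulVec lam α β γ c g).symm.trans hg⟩

/-- Modulo b one has a e₃ = e₂ and a² e₃ = e₁, so the matrix is antidiagonal with entries 1. -/
theorem isUnit_det_cyclicMatrix_themeGen (lam : ℚ) (α β γ : ℂ) :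
    IsUnit (cyclicMatrix lam α β γ (themeGen lam α β γ)).det := by
  rw [PowerSeries.isUnit_iff_constantCoeff]
  simp [Matrix.det_fin_three, cyclicMatrix, themeGen, canonicalA]

/-- The embedding into Ξ starts with bᵏ, where k = ⌈λ⌉ - 3; the assumption λ > 2 is exactly what
makes k ≥ 0. -/
theorem exists_residue {lam : ℚ} (hlam : 2 < lam) :
    ∃ (μ : ℚ) (k : ℕ), 0 < μ ∧ μ ≤ 1 ∧ lam = μ + k + 2 := by
  have h3 : (3 : ℤ) ≤ ⌈lam⌉ := by
    have : (2 : ℤ) < ⌈lam⌉ := Int.lt_ceil.2 (by exact_mod_cast hlam)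
    omega
  obtain ⟨k, hk⟩ := Int.eq_ofNat_of_zero_le (sub_nonneg.2 h3)
  have hk' : (⌈lam⌉ : ℚ) - 3 = k := by exact_mod_cast hk
  refine ⟨lam - (⌈lam⌉ - 1), k, ?_, ?_, ?_⟩
  · linarith [Int.ceil_lt_add_one lam]
  · linarith [Int.le_ceil lam]
  · linarith

theorem isPrimitiveTheme_canonicalTheme {lam : ℚ} (hlam : 2 < lam) {α β : ℂ} (hα : α ≠ 0)
    (hβ : β ≠ 0) (γ : ℂ) : IsPrimitiveTheme lam (CanonicalTheme lam α β γ) := by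
  obtain ⟨μ, k, h0, h1, hk⟩ := exists_residue hlam
  have hι := isABLinear_themeEmb {μ} hk α β γ
  refine ⟨μ, h0, h1, ⟨k + 2, by rw [hk]; push_cast; ring⟩, 2,
    themeEmb lam {μ} μ k α β γ (themeGen lam α β γ), themeEmb lam {μ} μ k α β γ, hι,
    themeEmb_injective lam (Finset.mem_singleton_self μ) k hα hβ γ, ?_⟩
  have htop : Submodule.span Cb (Set.range fun ν : ℕ => aPow ν (themeGen lam α β γ)) = ⊤ := by
    rw [eq_top_iff, ← span_cyclic_of_isUnit_det (isUnit_det_cyclicMatrix_themeGen lam α β γ)]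
    exact Submodule.span_mono (by rintro _ ⟨j, rfl⟩; exact ⟨j, rfl⟩)
  rw [LinearMap.range_eq_map, ← htop, Submodule.map_span, ← Set.range_comp]
  congr 2
  funext ν
  exact hι.map_aPow ν _

/-- The basis `e₁, e₂, e₃` of `E(α,β,γ)`. -/
noncomputable def themeBasis (lam : ℚ) (α β γ : ℂ) :
    Module.Basis (Fin 3) Cb (CanonicalTheme lam α β γ) := Pi.basisFun Cb (Fin 3)

theorem themeBasis_apply (lam : ℚ) (α β γ : ℂ) (i : Fin 3) :
    themeBasis lam α β γ i = (Pi.single i 1 : Fin 3 → Cb) := Pi.basisFun_apply _ _ _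

theorem a_themeBasis_zero (lam : ℚ) (α β γ : ℂ) :
    ABModule.a (themeBasis lam α β γ 0) = (cst (lam : ℂ) * bVar) • themeBasis lam α β γ 0 := by
  rw [themeBasis_apply]
  funext i
  change canonicalA lam α β γ (Pi.single 0 1) i
    = cst (lam : ℂ) * bVar * (Pi.single 0 1 : Fin 3 → Cb) i
  fin_cases i <;> simp [canonicalA]

theorem a_themeBasis_one (lam : ℚ) (α β γ : ℂ) :
    ABModule.a (themeBasis lam α β γ 1) = (cst (lam : ℂ) * bVar) • themeBasis lam α β γ 1
      + (1 + cst β * bVar + cst γ * bVar ^ 2) • themeBasis lam α β γ 0 := by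
  rw [themeBasis_apply, themeBasis_apply]
  funext i
  change canonicalA lam α β γ (Pi.single 1 1) i
    = cst (lam : ℂ) * bVar * (Pi.single 1 1 : Fin 3 → Cb) i
      + (1 + cst β * bVar + cst γ * bVar ^ 2) * (Pi.single 0 1 : Fin 3 → Cb) i
  fin_cases i <;> simp [canonicalA]

theorem a_themeBasis_two (lam : ℚ) (α β γ : ℂ) :
    ABModule.a (themeBasis lam α β γ 2) = (cst (lam : ℂ) * bVar) • themeBasis lam α β γ 2
      + (1 + cst α * bVar) • themeBasis lam α β γ 1 := by
  rw [themeBasis_apply, themeBasis_apply]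
  funext i
  change canonicalA lam α β γ (Pi.single 2 1) i
    = cst (lam : ℂ) * bVar * (Pi.single 2 1 : Fin 3 → Cb) i
      + (1 + cst α * bVar) * (Pi.single 1 1 : Fin 3 → Cb) i
  fin_cases i <;> simp [canonicalA]

theorem hasFundamentalInvariants_canonicalTheme (lam : ℚ) (α β γ : ℂ) :
    HasFundamentalInvariants (fun _ : Fin 3 => lam) (CanonicalTheme lam α β γ) := by
  refine ⟨themeBasis lam α β γ, fun j => ?_⟩
  fin_cases j
  · simp [a_themeBasis_zero]
  · simp only [Fin.mk_one, a_themeBasis_one, add_sub_cancel_left]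
    exact Submodule.smul_mem _ _ (Submodule.subset_span ⟨0, by simp, rfl⟩)
  · simp only [Fin.reduceFinMk, a_themeBasis_two, add_sub_cancel_left]
    exact Submodule.smul_mem _ _ (Submodule.subset_span ⟨1, by simp [Fin.lt_def], rfl⟩)

theorem isThemeWithInvariants_canonicalTheme {lam : ℚ} (hlam : 2 < lam) {α β : ℂ} (hα : α ≠ 0)
    (hβ : β ≠ 0) (γ : ℂ) :
    IsThemeWithInvariants (fun _ : Fin 3 => lam) (CanonicalTheme lam α β γ) :=
  ⟨fun _ => isPrimitiveTheme_canonicalTheme hlam hα hβ γ,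
    hasFundamentalInvariants_canonicalTheme lam α β γ⟩

/-! ### Homomorphisms between canonical themes, and invariance -/

/-- Terms of degree 0 and 1 are the obstructions to solving b²s' = f. All relations between the
parameters of two canonical themes arise as such obstructions. -/
theorem eq_of_X_sq_mul_eq {s r : Cb} {p q : ℂ}
    (h : bVar ^ 2 * s = cst p + cst q * bVar + bVar ^ 2 * r) : p = 0 ∧ q = 0 ∧ s = r := by
  have h0 := congrArg (PowerSeries.coeff 0) h
  have h1 := congrArg (PowerSeries.coeff 1) h
  have e1 : ∀ t : Cb, PowerSeries.coeff 1 (bVar ^ 2 * t) = 0 := fun t => by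
    rw [PowerSeries.coeff_X_pow_mul']; simp
  have hp : p = 0 := by simpa using h0.symm
  have hq : q = 0 := by
    simp only [map_add, e1, PowerSeries.coeff_succ_mul_X] at h1
    simpa [PowerSeries.coeff_C] using h1.symm
  subst hp hq
  refine ⟨rfl, rfl, mul_left_cancel₀ (pow_ne_zero 2 PowerSeries.X_ne_zero) (a := bVar ^ 2) ?_⟩
  simpa using h

theorem eq_of_bDeriv_eq {s : Cb} {d : ℂ} (h : bDeriv s = cst d) :
    s = cst (PowerSeries.constantCoeff s) + cst d * bVar := by
  refine PowerSeries.derivative.ext ?_ ?_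
  · simpa [bDeriv, Derivation.leibniz] using h
  · simp

/-- The homomorphisms between two canonical themes, in coordinates. -/
theorem hom_canonicalTheme {lam : ℚ} {α β γ α' β' γ' : ℂ}
    {u : CanonicalTheme lam α β γ →ₗ[Cb] CanonicalTheme lam α' β' γ'} (hu : IsABLinear u) :
    ∃ c k l : ℂ, β' * c = β * c ∧ α' * c = α * c ∧ (β' - α) * k = (γ - γ') * c ∧
      ∀ v : CanonicalTheme lam α β γ, u v = (![cst c * v 0 + (cst k + cst ((γ - γ') * c) * bVar) * v 1
        + (cst l + cst (α * (γ - γ') * c - γ' * k) * bVar) * v 2,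
        cst c * v 1 + cst k * v 2, cst c * v 2] : Fin 3 → Cb) := by
  have hx := hu (themeBasis lam α β γ 0)
  have hy := hu (themeBasis lam α β γ 1)
  have hz := hu (themeBasis lam α β γ 2)
  rw [a_themeBasis_zero, map_smul] at hx
  rw [a_themeBasis_one, map_add, map_smul, map_smul] at hy
  rw [a_themeBasis_two, map_add, map_smul, map_smul] at hz
  have huv : ∀ v : CanonicalTheme lam α β γ, u v = v 0 • u (themeBasis lam α β γ 0)
      + v 1 • u (themeBasis lam α β γ 1) + v 2 • u (themeBasis lam α β γ 2) := by
    intro v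
    conv_lhs => rw [← (themeBasis lam α β γ).sum_repr v]
    rw [Fin.sum_univ_three, map_add, map_add, map_smul, map_smul, map_smul]
    rfl
  generalize u (themeBasis lam α β γ 0) = x at *
  generalize u (themeBasis lam α β γ 1) = y at *
  generalize u (themeBasis lam α β γ 2) = z at *
  have hx0 : cst (lam : ℂ) * bVar * x 0 = canonicalA lam α' β' γ' x 0 := congrFun hx 0
  have hx1 : cst (lam : ℂ) * bVar * x 1 = canonicalA lam α' β' γ' x 1 := congrFun hx 1
  have hx2 : cst (lam : ℂ) * bVar * x 2 = canonicalA lam α' β' γ' x 2 := congrFun hx 2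
  have hy0 : cst (lam : ℂ) * bVar * y 0 + (1 + cst β * bVar + cst γ * bVar ^ 2) * x 0
    = canonicalA lam α' β' γ' y 0 := congrFun hy 0
  have hy1 : cst (lam : ℂ) * bVar * y 1 + (1 + cst β * bVar + cst γ * bVar ^ 2) * x 1
    = canonicalA lam α' β' γ' y 1 := congrFun hy 1
  have hy2 : cst (lam : ℂ) * bVar * y 2 + (1 + cst β * bVar + cst γ * bVar ^ 2) * x 2
    = canonicalA lam α' β' γ' y 2 := congrFun hy 2
  have hz0 : cst (lam : ℂ) * bVar * z 0 + (1 + cst α * bVar) * y 0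
    = canonicalA lam α' β' γ' z 0 := congrFun hz 0
  have hz1 : cst (lam : ℂ) * bVar * z 1 + (1 + cst α * bVar) * y 1
    = canonicalA lam α' β' γ' z 1 := congrFun hz 1
  have hz2 : cst (lam : ℂ) * bVar * z 2 + (1 + cst α * bVar) * y 2
    = canonicalA lam α' β' γ' z 2 := congrFun hz 2
  simp only [canonicalA, Matrix.cons_val_zero, Matrix.cons_val_one, Matrix.cons_val] at hx0 hx1 hx2 hy0 hy1 hy2 hz0 hz1 hz2
  have c0 : cst 0 = 0 := map_zero _
  have cm : ∀ p q : ℂ, cst (p * q) = cst p * cst q := fun p q => map_mul _ p q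
  have cs : ∀ p q : ℂ, cst (p - q) = cst p - cst q := fun p q => map_sub _ p q
  have cn : ∀ p : ℂ, cst (-p) = -cst p := fun p => map_neg _ p
  -- The terms in λb cancel, so each component of the commutation relations has this form; solving
  -- it adds one free constant.
  have solve : ∀ (p q d : ℂ) (s : Cb), bVar ^ 2 * bDeriv s
      = cst p + cst q * bVar + bVar ^ 2 * cst d →
      p = 0 ∧ q = 0 ∧ ∃ e : ℂ, s = cst e + cst d * bVar := fun p q d s h => by
    obtain ⟨hp, hq, hd⟩ := eq_of_X_sq_mul_eq h
    exact ⟨hp, hq, _, eq_of_bDeriv_eq hd⟩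
  -- For each of the images x, y, z of e₁, e₂, e₃ the components are solved from the last to the
  -- first. The obstructions of degree 0 first kill the entries below the diagonal.
  obtain ⟨-, -, x2, e⟩ := solve 0 0 0 (x 2) (by rw [c0]; linear_combination -hx2)
  simp only [c0, zero_mul, add_zero] at e
  rw [e] at hx1 hy2
  obtain ⟨h, -, x1, e1⟩ := solve (-x2) (-(α' * x2)) 0 (x 1)
    (by rw [c0, cn, cn, cm]; linear_combination -hx1)
  obtain rfl : x2 = 0 := by simpa using h
  simp only [c0, zero_mul, mul_zero, add_zero] at e e1 hx1 hy2
  rw [e1] at hx0 hy1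
  obtain ⟨h, -, c, e0⟩ := solve (-x1) (-(β' * x1)) (-(γ' * x1)) (x 0)
    (by rw [cn, cn, cn, cm, cm]; linear_combination -hx0)
  obtain rfl : x1 = 0 := by simpa using h
  simp only [c0, zero_mul, mul_zero, neg_zero, add_zero] at e0 e1 hx0 hy1
  obtain ⟨-, -, y2, f2⟩ := solve 0 0 0 (y 2) (by rw [c0]; linear_combination -hy2)
  simp only [c0, zero_mul, add_zero] at f2
  rw [f2] at hy1 hz2
  obtain ⟨h, -, y1, f1⟩ := solve (-y2) (-(α' * y2)) 0 (y 1)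
    (by rw [c0, cn, cn, cm]; linear_combination -hy1)
  obtain rfl : y2 = 0 := by simpa using h
  simp only [c0, zero_mul, mul_zero, add_zero] at f1 f2 hy1 hz2
  rw [f1] at hy0 hz1
  rw [e0] at hy0
  -- Degree 0 equates two diagonal entries, and degree 1 gives the relation between β and β'; the
  -- same happens for α below.
  obtain ⟨h, hβ, k, f0⟩ := solve (c - y1) (β * c - β' * y1) (γ * c - γ' * y1) (y 0)
    (by simp only [cm, cs]; linear_combination -hy0)
  obtain rfl : c = y1 := sub_eq_zero.1 h
  obtain ⟨-, -, z2, g2⟩ := solve 0 0 0 (z 2) (by rw [c0]; linear_combination -hz2)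
  simp only [c0, zero_mul, add_zero] at g2
  rw [g2] at hz1
  obtain ⟨h, hα, z1, g1⟩ := solve (c - z2) (α * c - α' * z2) 0 (z 1)
    (by simp only [cm, cs, c0]; linear_combination -hz1)
  obtain rfl : c = z2 := sub_eq_zero.1 h
  simp only [c0, zero_mul, add_zero] at g1
  rw [g1, f0] at hz0
  have ca : ∀ p q : ℂ, cst (p + q) = cst p + cst q := fun p q => map_add _ p q
  -- Degree 0 equates the two entries k next to the diagonal, and degree 1 is the relation linking k
  -- to γ - γ'.
  obtain ⟨h, hk, l, g0⟩ := solve (k - z1) (α * k + (γ * c - γ' * c) - β' * z1)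
    (α * (γ * c - γ' * c) - γ' * z1) (z 0)
    (by simp only [cm, cs, ca] at hz0 ⊢; linear_combination -hz0)
  obtain rfl : k = z1 := sub_eq_zero.1 h
  refine ⟨c, k, l, by linear_combination -hβ, by linear_combination -hα,
    by linear_combination -hk, fun v => ?_⟩
  rw [huv]
  have r1 : (γ - γ') * c = γ * c - γ' * c := by ring
  have r2 : α * (γ - γ') * c = α * (γ * c - γ' * c) := by ring
  rw [r1, r2]
  funext i
  change v 0 * x i + v 1 * y i + v 2 * z i = _
  fin_cases i
  · simp only [Fin.zero_eta, Matrix.cons_val_zero, e0, f0, g0]; ring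
  · simp only [Fin.mk_one, Matrix.cons_val_one, Matrix.cons_val_zero, e1, f1, g1]; ring
  · simp only [Fin.reduceFinMk, Matrix.cons_val, e, f2, g2]; ring

/-- A surjection has c ≠ 0, so the relations can be divided by c; for α = β the unknown k drops out
of the third one. -/
theorem eq_of_abIsomorphic {lam : ℚ} {α β γ α' β' γ' : ℂ}
    (h : ABIsomorphic (CanonicalTheme lam α β γ) (CanonicalTheme lam α' β' γ')) :
    α' = α ∧ β' = β ∧ (α = β → γ' = γ) := by
  obtain ⟨u, hu, hb⟩ := h
  obtain ⟨c, k, l, hβ, hα, hk, huv⟩ := hom_canonicalTheme hu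
  have hc : c ≠ 0 := by
    rintro rfl
    obtain ⟨v, hv⟩ := hb.2 (themeBasis lam α' β' γ' 2)
    rw [huv, themeBasis_apply] at hv
    have := congrFun hv 2
    simp at this
  have hβ' := mul_right_cancel₀ hc hβ
  refine ⟨mul_right_cancel₀ hc hα, hβ', ?_⟩
  rintro rfl
  rw [hβ', sub_self, zero_mul] at hk
  rcases mul_eq_zero.1 hk.symm with h | h
  · exact (sub_eq_zero.1 h).symm
  · exact absurd h hc

theorem finrank_canonicalTheme (lam : ℚ) (α β γ : ℂ) :
    Module.finrank Cb (CanonicalTheme lam α β γ) = 3 := by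
  rw [Module.finrank_eq_card_basis (themeBasis lam α β γ), Fintype.card_fin]

/-- Here α ≠ β forces k = 0. With c = 0 the image lies in ℂ[[b]] e₁ and has rank at most 1; with c ≠
0 the endomorphism is injective, of rank 3. -/
theorem not_isInvariantTheme {lam : ℚ} {α β : ℂ} (hαβ : α ≠ β) (γ : ℂ) :
    ¬ IsInvariantTheme (CanonicalTheme lam α β γ) := by
  rintro ⟨u, hu, hr⟩
  rw [finrank_canonicalTheme] at hr
  obtain ⟨c, k, l, -, -, hk, huv⟩ := hom_canonicalTheme hu
  obtain rfl : k = 0 := by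
    rw [sub_self, zero_mul] at hk
    exact (mul_eq_zero.1 hk).resolve_left (sub_ne_zero.2 (Ne.symm hαβ))
  by_cases hc : c = 0
  · subst hc
    have hle : LinearMap.range u ≤ Submodule.span Cb {themeBasis lam α β γ 0} := by
      rintro _ ⟨v, rfl⟩
      rw [Submodule.mem_span_singleton, themeBasis_apply]
      refine ⟨u v 0, ?_⟩
      funext i
      change u v 0 * (Pi.single 0 1 : Fin 3 → Cb) i = u v i
      rw [huv]
      fin_cases i <;> simp
    have h1 := Submodule.finrank_mono hle
    have h2 := finrank_span_le_card (R := Cb) ({themeBasis lam α β γ 0} : Set (CanonicalTheme lam α β γ))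
    simp at h2
    omega
  · have hinj : Function.Injective u := by
      rw [injective_iff_map_eq_zero]
      intro v hv
      rw [huv] at hv
      have hc' := cst_ne_zero hc
      have h2 : v 2 = 0 := by
        have := congrFun hv 2
        change cst c * v 2 = 0 at this
        exact (mul_eq_zero.1 this).resolve_left hc'
      have h1 : v 1 = 0 := by
        have := congrFun hv 1
        change cst c * v 1 + cst 0 * v 2 = 0 at this
        rw [h2, mul_zero, add_zero] at this
        exact (mul_eq_zero.1 this).resolve_left hc'
      have h0 : v 0 = 0 := by
        have := congrFun hv 0
        change cst c * v 0 + _ * v 1 + _ * v 2 = 0 at this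
        rw [h2, h1, mul_zero, mul_zero, add_zero, add_zero] at this
        exact (mul_eq_zero.1 this).resolve_left hc'
      funext i
      fin_cases i <;> assumption
    rw [LinearMap.finrank_range_of_inj hinj, finrank_canonicalTheme] at hr
    omega

/-- The nilpotent endomorphism of `E(α,α,γ)` in coordinates. -/
noncomputable def nilpotentCoord (α γ : ℂ) (v : Fin 3 → Cb) : Fin 3 → Cb :=
  ![cst α * v 1 + (cst γ - cst (α * γ) * bVar) * v 2, cst α * v 2, 0]

/-- The nilpotent endomorphism of `E(α,α,γ)`. -/
noncomputable def nilpotentEnd (lam : ℚ) (α γ : ℂ) :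
    CanonicalTheme lam α α γ →ₗ[Cb] CanonicalTheme lam α α γ where
  toFun := nilpotentCoord α γ
  map_add' v w := by
    funext i
    change nilpotentCoord α γ (fun j => v j + w j) i
      = nilpotentCoord α γ v i + nilpotentCoord α γ w i
    fin_cases i <;> simp [nilpotentCoord] <;> ring
  map_smul' S v := by
    funext i
    change nilpotentCoord α γ (fun j => S * v j) i = S * nilpotentCoord α γ v i
    fin_cases i <;> simp [nilpotentCoord] <;> ring

/-- The endomorphism has c = 0, k = α, l = γ in the notation of `hom_canonicalTheme`; since k ≠ 0,
its image is spanned by e₁ and e₂. -/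
theorem isInvariantTheme_canonicalTheme {lam : ℚ} {α : ℂ} (hα : α ≠ 0) (γ : ℂ) :
    IsInvariantTheme (CanonicalTheme lam α α γ) := by
  refine ⟨nilpotentEnd lam α γ, fun v => ?_, ?_⟩
  · change nilpotentCoord α γ (canonicalA lam α α γ v) = canonicalA lam α α γ (nilpotentCoord α γ v)
    have cm : cst (α * γ) = cst α * cst γ := map_mul _ _ _
    have hd : bDeriv (cst γ - cst (α * γ) * bVar) = -cst (α * γ) := by
      simp [bDeriv, Derivation.leibniz]
    funext i
    fin_cases i
    · simp only [canonicalA, nilpotentCoord, Fin.zero_eta, Matrix.cons_val_zero, Matrix.cons_val_one,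
        Matrix.cons_val, map_add (PowerSeries.derivative ℂ), bDeriv, Derivation.leibniz,
        smul_eq_mul] at hd ⊢
      rw [hd, PowerSeries.derivative_C, cm]
      ring
    · simp [canonicalA, nilpotentCoord, Derivation.leibniz]
      ring
    · simp [canonicalA, nilpotentCoord]
  · have hrange : LinearMap.range (nilpotentEnd lam α γ) = Submodule.span Cb
        (Set.range fun i : Fin 2 => themeBasis lam α α γ (Fin.castSucc i)) := by
      apply le_antisymm
      · rintro _ ⟨v, rfl⟩
        rw [Submodule.mem_span_range_iff_exists_fun]
        refine ⟨![nilpotentEnd lam α γ v 0, nilpotentEnd lam α γ v 1], ?_⟩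
        rw [Fin.sum_univ_two, themeBasis_apply, themeBasis_apply]
        funext i
        change nilpotentCoord α γ v 0 * (Pi.single 0 1 : Fin 3 → Cb) i
          + nilpotentCoord α γ v 1 * (Pi.single 1 1 : Fin 3 → Cb) i = nilpotentCoord α γ v i
        fin_cases i <;> simp [nilpotentCoord]
      · have hi : cst α * cst α⁻¹ = 1 := by
          rw [cst, cst, ← map_mul, mul_inv_cancel₀ hα, map_one]
        rw [Submodule.span_le]
        rintro _ ⟨i, rfl⟩
        simp only [themeBasis_apply]
        fin_cases i
        · refine ⟨(![0, cst α⁻¹, 0] : Fin 3 → Cb), ?_⟩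
          change nilpotentCoord α γ _ = (Pi.single 0 1 : Fin 3 → Cb)
          funext i
          fin_cases i
          · simpa [nilpotentCoord] using hi
          · simp [nilpotentCoord]
          · simp [nilpotentCoord]
        · refine ⟨(![0, -(cst α⁻¹ * cst α⁻¹ * (cst γ - cst (α * γ) * bVar)), cst α⁻¹] :
            Fin 3 → Cb), ?_⟩
          change nilpotentCoord α γ _ = (Pi.single 1 1 : Fin 3 → Cb)
          funext i
          fin_cases i
          · change cst α * -(cst α⁻¹ * cst α⁻¹ * (cst γ - cst (α * γ) * bVar))
              + (cst γ - cst (α * γ) * bVar) * cst α⁻¹ = 0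
            linear_combination -cst α⁻¹ * (cst γ - cst (α * γ) * bVar) * hi
          · change cst α * cst α⁻¹ = 1
            exact hi
          · rfl
    have hli : LinearIndependent Cb (fun i : Fin 2 => themeBasis lam α α γ (Fin.castSucc i)) :=
      (themeBasis lam α α γ).linearIndependent.comp _ (Fin.castSucc_injective 2)
    rw [hrange, finrank_span_eq_card hli, finrank_canonicalTheme, Fintype.card_fin]

/-! ### Shears: isomorphisms that change only γ -/

/-- The coordinates of the image of a vector under `shearMap`. -/
noncomputable def shearCoord (α γ γ' x : ℂ) (v : Fin 3 → Cb) : Fin 3 → Cb :=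
  ![v 0 + (cst x + cst (γ - γ') * bVar) * v 1 + cst (α * (γ - γ') - x * γ') * bVar * v 2,
    v 1 + cst x * v 2, v 2]

/-- The map from `E(α,β,γ)` to `E(α',β',γ')` with
`e₁ ↦ e₁`, `e₂ ↦ e₂ + (x + (γ - γ') b) e₁`, `e₃ ↦ e₃ + x e₂ + (α (γ - γ') - x γ') b e₁`. -/
noncomputable def shearMap (lam : ℚ) (α β γ α' β' γ' x : ℂ) :
    CanonicalTheme lam α β γ →ₗ[Cb] CanonicalTheme lam α' β' γ' where
  toFun := shearCoord α γ γ' x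
  map_add' v w := by
    funext i
    change shearCoord α γ γ' x (fun j => v j + w j) i
      = shearCoord α γ γ' x v i + shearCoord α γ γ' x w i
    fin_cases i <;> simp [shearCoord] <;> ring
  map_smul' S v := by
    funext i
    change shearCoord α γ γ' x (fun j => S * v j) i = S * shearCoord α γ γ' x v i
    fin_cases i <;> simp [shearCoord] <;> ring

theorem shearMap_apply (lam : ℚ) (α β γ α' β' γ' x : ℂ) (v : CanonicalTheme lam α β γ) :
    shearMap lam α β γ α' β' γ' x v = shearCoord α γ γ' x v := rfl

theorem shearMap_bijective (lam : ℚ) (α β γ α' β' γ' x : ℂ) :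
    Function.Bijective (shearMap lam α β γ α' β' γ' x) := by
  refine ⟨?_, fun (w : Fin 3 → Cb) => ?_⟩
  · rw [injective_iff_map_eq_zero]
    intro v hv
    rw [shearMap_apply] at hv
    have h2 : v 2 = 0 := congrFun hv 2
    have h1 : v 1 + cst x * v 2 = 0 := congrFun hv 1
    have h0 : v 0 + _ * v 1 + _ * v 2 = 0 := congrFun hv 0
    rw [h2, mul_zero, add_zero] at h1
    rw [h2, h1, mul_zero, mul_zero, add_zero, add_zero] at h0
    funext i
    fin_cases i <;> assumption
  · refine ⟨(![w 0 - (cst x + cst (γ - γ') * bVar) * (w 1 - cst x * w 2)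
      - cst (α * (γ - γ') - x * γ') * bVar * w 2, w 1 - cst x * w 2, w 2] : Fin 3 → Cb), ?_⟩
    change shearCoord α γ γ' x _ = w
    funext i
    fin_cases i
    · simp only [shearCoord, Fin.zero_eta, Matrix.cons_val_zero, Matrix.cons_val_one,
        Matrix.cons_val]
      ring
    · simp [shearCoord]
    · simp [shearCoord]

/-- This is the case c = 1, k = x, l = 0 of `hom_canonicalTheme`; once α and β agree, `hx` is the
only relation left. -/
theorem isABLinear_shearMap {lam : ℚ} {α β γ α' β' γ' x : ℂ} (hα : α' = α) (hβ : β' = β)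
    (hx : x * (β - α) = γ - γ') : IsABLinear (shearMap lam α β γ α' β' γ' x) := by
  subst hα hβ
  obtain rfl : γ = x * (β' - α') + γ' := by linear_combination -hx
  intro v
  change shearCoord α' _ γ' x (canonicalA lam α' β' _ v)
    = canonicalA lam α' β' γ' (shearCoord α' _ γ' x v)
  have hd : ∀ (p q : ℂ) (s : Cb), bDeriv ((cst p + cst q * bVar) * s)
      = (cst p + cst q * bVar) * bDeriv s + cst q * s := fun p q s => by
    simp [bDeriv, Derivation.leibniz]; ring
  have hd' : ∀ (q : ℂ) (s : Cb), bDeriv (cst q * bVar * s)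
      = cst q * bVar * bDeriv s + cst q * s := fun q s => by
    simp [bDeriv, Derivation.leibniz]; ring
  have cm : ∀ p q : ℂ, cst (p * q) = cst p * cst q := fun p q => map_mul _ p q
  have cs : ∀ p q : ℂ, cst (p - q) = cst p - cst q := fun p q => map_sub _ p q
  have ca : ∀ p q : ℂ, cst (p + q) = cst p + cst q := fun p q => map_add _ p q
  funext i
  fin_cases i
  · simp only [canonicalA, shearCoord, Fin.zero_eta, Matrix.cons_val_zero, Matrix.cons_val_one,
      Matrix.cons_val, map_add (PowerSeries.derivative ℂ), hd, hd']
    simp only [cm, cs, ca]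
    ring
  · simp only [canonicalA, shearCoord, Fin.mk_one, Matrix.cons_val_zero, Matrix.cons_val_one,
      Matrix.cons_val, map_add (PowerSeries.derivative ℂ), bDeriv_cst_mul]
    ring
  · simp only [canonicalA, shearCoord, Fin.reduceFinMk, Matrix.cons_val_zero, Matrix.cons_val_one,
      Matrix.cons_val]

theorem abIsomorphic_canonicalTheme {lam : ℚ} {α β : ℂ} (h : α ≠ β) (γ γ' : ℂ) :
    ABIsomorphic (CanonicalTheme lam α β γ) (CanonicalTheme lam α β γ') :=
  ⟨shearMap lam α β γ α β γ' ((γ - γ') / (β - α)),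
    isABLinear_shearMap rfl rfl (div_mul_cancel₀ _ (sub_ne_zero.2 (Ne.symm h))),
    shearMap_bijective _ _ _ _ _ _ _ _⟩

open ReducedComplexSpace

/-! ### Holomorphic families of canonical themes -/

section Families

variable {M : Type u} [TopologicalSpace M] [ReducedComplexSpace M]

theorem isHolSeriesAt_canonicalA (lam : ℚ) {α β γ : M → ℂ} {x : M} (hα : IsHolAt α x)
    (hβ : IsHolAt β x) (hγ : IsHolAt γ x) {t : M → Fin 3 → Cb}
    (ht : ∀ i, IsHolSeriesAt (fun y => t y i) x) (i : Fin 3) :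
    IsHolSeriesAt (fun y => canonicalA lam (α y) (β y) (γ y) (t y) i) x := by
  have hX : IsHolSeriesAt (fun _ : M => bVar) x := .const _ x
  have hX2 : IsHolSeriesAt (fun _ : M => bVar ^ 2) x := .const _ x
  have h1 : IsHolSeriesAt (fun _ : M => (1 : Cb)) x := .const _ x
  have hd : ∀ i, IsHolSeriesAt
      (fun y => cst (lam : ℂ) * bVar * t y i + bVar ^ 2 * bDeriv (t y i)) x := fun i =>
    (((IsHolSeriesAt.const (cst (lam : ℂ) * bVar) x)).mul (ht i)).add (hX2.mul (ht i).deriv)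
  fin_cases i
  · exact (hd 0).add (((h1.add ((IsHolSeriesAt.of_cst hβ).mul hX)).add
      ((IsHolSeriesAt.of_cst hγ).mul hX2)).mul (ht 1))
  · exact (hd 1).add ((h1.add ((IsHolSeriesAt.of_cst hα).mul hX)).mul (ht 2))
  · exact hd 2

theorem isHolSeriesAt_iterate_canonicalA (lam : ℚ) {α β γ : M → ℂ} {x : M} (hα : IsHolAt α x)
    (hβ : IsHolAt β x) (hγ : IsHolAt γ x) {t : M → Fin 3 → Cb}
    (ht : ∀ i, IsHolSeriesAt (fun y => t y i) x) (j : ℕ) (i : Fin 3) :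
    IsHolSeriesAt (fun y => (canonicalA lam (α y) (β y) (γ y))^[j] (t y) i) x := by
  induction j generalizing i with
  | zero => exact ht i
  | succ n ih =>
    simp only [Function.iterate_succ_apply']
    exact isHolSeriesAt_canonicalA lam hα hβ hγ ih i

theorem isHolSeriesAt_embCoord (k : ℕ) {α β γ : M → ℂ} {x : M} (hα : IsHolAt α x)
    (hβ : IsHolAt β x) (hγ : IsHolAt γ x) {t : M → Fin 3 → Cb}
    (ht : ∀ i, IsHolSeriesAt (fun y => t y i) x) (i : Fin 3) :
    IsHolSeriesAt (fun y => embCoord k (α y) (β y) (γ y) (t y) i) x := by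
  have hX : ∀ n i, IsHolSeriesAt (fun y => bVar ^ n * t y i) x := fun n i =>
    (IsHolSeriesAt.const _ x).mul (ht i)
  have hc : ∀ {f : M → ℂ} (_ : IsHolAt f x) (n i), IsHolSeriesAt
      (fun y => cst (f y) * (bVar ^ n * t y i)) x := fun hf n i =>
    (IsHolSeriesAt.of_cst hf).mul (hX n i)
  fin_cases i
  · exact ((hX _ 0).add ((hc hγ _ 1).sub (hX _ 1))).add
      (((hc (isHolAt_const _ _) _ 2).sub (hc (hβ.sub hα) _ 2)).add (hc (hα.mul hγ) _ 2))
  · exact (hc hβ _ 1).add ((hc hγ _ 2).sub (hc hβ _ 2))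
  · exact hc (hα.mul hβ) _ 2

/-- The matrix from e₁, e₂, e₃ to c, a c, a² c is holomorphic with invertible determinant, so
Cramer's formula inverts it holomorphically. This reconciles sections given by coordinates with
sections generated by a thematic map. -/
theorem isHolSeriesAt_iff_cyclic {lam : ℚ} {α β γ : M → ℂ} {x : M} (hα : IsHolAt α x)
    (hβ : IsHolAt β x) (hγ : IsHolAt γ x) {c : ∀ y, CanonicalTheme lam (α y) (β y) (γ y)}
    (hc : ∀ i, IsHolSeriesAt (fun y => c y i) x)
    (hdet : ∀ᶠ z in 𝓝 x, IsUnit (cyclicMatrix lam (α z) (β z) (γ z) (c z)).det)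
    (t : ∀ y, CanonicalTheme lam (α y) (β y) (γ y)) :
    (∀ i, IsHolSeriesAt (fun y => t y i) x) ↔ ∃ g : Fin 3 → M → Cb,
      (∀ j, IsHolSeriesAt (g j) x) ∧
        ∀ᶠ z in 𝓝 x, t z = ∑ j : Fin 3, g j z • aPow (j : ℕ) (c z) := by
  have hA : ∀ i j, IsHolSeriesAt (fun y => cyclicMatrix lam (α y) (β y) (γ y) (c y) i j) x :=
    fun i j => isHolSeriesAt_iterate_canonicalA lam hα hβ hγ hc j i
  constructor
  · intro ht
    refine ⟨fun j z => (cyclicMatrix lam (α z) (β z) (γ z) (c z)).det⁻¹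
      * ((cyclicMatrix lam (α z) (β z) (γ z) (c z)).adjugate.mulVec (t z)) j,
      fun j => IsHolSeriesAt.adjugate_mulVec hA ht hdet.self_of_nhds j, ?_⟩
    filter_upwards [hdet] with z hz
    rw [← cyclicMatrix_mulVec]
    exact (Matrix.mulVec_det_inv_adjugate hz (t z)).symm
  · rintro ⟨g, hg, ht⟩ i
    refine IsHolSeriesAt.congr (S := fun z => ∑ j : Fin 3,
      cyclicMatrix lam (α z) (β z) (γ z) (c z) i j * g j z) ?_ ?_
    · exact IsHolSeriesAt.sum _ fun j _ => (hA i j).mul (hg j)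
    · filter_upwards [ht] with z hz
      rw [← cyclicMatrix_mulVec] at hz
      exact (congrFun hz i).symm

/-- The family with fibers `E(α(x),β(x),γ(x))`. -/
noncomputable def canonicalFamily (lam : ℚ) (α β γ : M → ℂ) (hα : ∀ x, IsHolAt α x)
    (hβ : ∀ x, IsHolAt β x) (hγ : ∀ x, IsHolAt γ x) : ABFamily.{u, 0} M where
  fib x := CanonicalTheme lam (α x) (β x) (γ x)
  IsHolAt t x := ∀ i, IsHolSeriesAt (fun y => t y i) x
  exists_frame x₀ := by
    refine ⟨Set.univ, 3, fun i x => themeBasis lam (α x) (β x) (γ x) i, isOpen_univ, trivial,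
      fun x _ => ⟨⟨(themeBasis lam (α x) (β x) (γ x)).linearIndependent,
        (themeBasis lam (α x) (β x) (γ x)).span_eq⟩, fun t => ?_⟩⟩
    have hsum : ∀ (z : M) (g : Fin 3 → Cb), ∑ i, g i • themeBasis lam (α z) (β z) (γ z) i = g :=
      fun z g => (themeBasis lam (α z) (β z) (γ z)).sum_repr g
    constructor
    · intro ht
      exact ⟨fun i z => t z i, ht, Eventually.of_forall fun z => (hsum z (t z)).symm⟩
    · rintro ⟨g, hg, ht⟩ i
      refine (hg i).congr ?_
      filter_upwards [ht] with z hz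
      have := hsum z fun i => g i z
      rw [hz, this]
  a_hol t x ht := isHolSeriesAt_canonicalA lam (hα x) (hβ x) (hγ x) ht

theorem linearIndependent_cyclic {lam : ℚ} {α β γ : ℂ} {c : CanonicalTheme lam α β γ}
    (h : IsUnit (cyclicMatrix lam α β γ c).det) :
    LinearIndependent Cb (fun j : Fin 3 => aPow (j : ℕ) c) := by
  rw [Fintype.linearIndependent_iff]
  intro g hg
  rw [← cyclicMatrix_mulVec] at hg
  have hinj := Matrix.mulVec_injective_of_isUnit ((Matrix.isUnit_iff_isUnit_det _).2 h)
  have hg0 := hinj (hg.trans (Matrix.mulVec_zero _).symm)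
  exact fun i => congrFun hg0 i

theorem isHolSeriesAt_themeGen (lam : ℚ) (α β γ : M → ℂ) (x : M) (i : Fin 3) :
    IsHolSeriesAt (fun y => themeGen lam (α y) (β y) (γ y) i) x :=
  IsHolSeriesAt.const ((![0, 0, 1] : Fin 3 → Cb) i) x

theorem isThematicOn_themeEmb {lam μ : ℚ} {k : ℕ} (hk : lam = μ + k + 2) {Λ : Finset ℚ}
    (hμ : μ ∈ Λ) {α β γ : M → ℂ} (hα : ∀ x, IsHolAt α x) (hβ : ∀ x, IsHolAt β x)
    (hγ : ∀ x, IsHolAt γ x) (hα0 : ∀ x, α x ≠ 0) (hβ0 : ∀ x, β x ≠ 0) :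
    IsThematicOn 3
      (fun x => themeEmb lam Λ μ k (α x) (β x) (γ x) (themeGen lam (α x) (β x) (γ x)))
      Set.univ := by
  have hι := fun x => isABLinear_themeEmb Λ hk (α x) (β x) (γ x)
  have hdet := fun x => isUnit_det_cyclicMatrix_themeGen lam (α x) (β x) (γ x)
  refine ⟨fun x _ ν j => ?_, fun x _ => ?_, ?_⟩
  · simp only [themeEmb_apply]
    split_ifs
    · exact isHolSeriesAt_embCoord k (hα x) (hβ x) (hγ x) (isHolSeriesAt_themeGen lam α β γ x) j
    · exact IsHolSeriesAt.const 0 x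
  · have hli := (linearIndependent_cyclic (hdet x)).map' _
      (LinearMap.ker_eq_bot.2 (themeEmb_injective lam hμ k (hα0 x) (hβ0 x) (γ x)))
    have heq : (themeEmb lam Λ μ k (α x) (β x) (γ x)
        ∘ fun j : Fin 3 => aPow (j : ℕ) (themeGen lam (α x) (β x) (γ x)))
        = fun j : Fin 3 => aPow (j : ℕ) (themeEmb lam Λ μ k (α x) (β x) (γ x)
          (themeGen lam (α x) (β x) (γ x))) := funext fun j => (hι x).map_aPow j _
    rwa [heq] at hli
  -- Cramer's formula expresses a³e₃ in the basis e₃, a e₃, a²e₃ with holomorphic coefficients.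
  · let A : M → Matrix (Fin 3) (Fin 3) Cb :=
      fun z => cyclicMatrix lam (α z) (β z) (γ z) (themeGen lam _ _ _)
    let cube : M → Fin 3 → Cb := fun x =>
      (canonicalA lam (α x) (β x) (γ x))^[3] (themeGen lam (α x) (β x) (γ x))
    have hA : ∀ x i j, IsHolSeriesAt (fun y => A y i j) x := fun x i j =>
      isHolSeriesAt_iterate_canonicalA lam (hα x) (hβ x) (hγ x)
        (isHolSeriesAt_themeGen lam α β γ x) j i
    have hcube : ∀ x i, IsHolSeriesAt (fun y => cube y i) x := fun x i =>
      isHolSeriesAt_iterate_canonicalA lam (hα x) (hβ x) (hγ x)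
        (isHolSeriesAt_themeGen lam α β γ x) 3 i
    refine ⟨fun j z => (A z).det⁻¹ * ((A z).adjugate.mulVec (cube z)) j,
      fun j x _ => IsHolSeriesAt.adjugate_mulVec (hA x) (hcube x) (hdet x) j, fun x _ => ?_⟩
    have h1 := (cyclicMatrix_mulVec lam (α x) (β x) (γ x) (themeGen lam _ _ _)
      fun j => (A x).det⁻¹ * ((A x).adjugate.mulVec (cube x)) j).symm.trans
        (Matrix.mulVec_det_inv_adjugate (hdet x) (cube x))
    rw [← (hι x).map_aPow]
    refine (congrArg (themeEmb lam Λ μ k (α x) (β x) (γ x)) h1.symm).trans ?_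
    rw [map_sum]
    refine Finset.sum_congr rfl fun j _ => ?_
    rw [map_smul, (hι x).map_aPow]

theorem range_eq_span_cyclic {lam : ℚ} {α β γ : ℂ} {c : CanonicalTheme lam α β γ}
    (h : IsUnit (cyclicMatrix lam α β γ c).det) {F : Type*} [AddCommGroup F] [Module Cb F]
    [ABModule F] {θ : CanonicalTheme lam α β γ →ₗ[Cb] F} (hθ : IsABLinear θ) :
    LinearMap.range θ = Submodule.span Cb (Set.range fun j : Fin 3 => aPow (j : ℕ) (θ c)) := by
  rw [LinearMap.range_eq_map, ← span_cyclic_of_isUnit_det h, Submodule.map_span, ← Set.range_comp]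
  congr 2
  funext j
  exact hθ.map_aPow j c

theorem isHolFamily_canonicalFamily {lam : ℚ} (hlam : 2 < lam) {α β γ : M → ℂ}
    (hα : ∀ x, IsHolAt α x) (hβ : ∀ x, IsHolAt β x) (hγ : ∀ x, IsHolAt γ x) (hα0 : ∀ x, α x ≠ 0)
    (hβ0 : ∀ x, β x ≠ 0) :
    (canonicalFamily lam α β γ hα hβ hγ).IsHolFamily (fun _ : Fin 3 => lam) := by
  refine ⟨fun x => isThemeWithInvariants_canonicalTheme hlam (hα0 x) (hβ0 x) (γ x), fun x₀ => ?_⟩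
  obtain ⟨μ, k, h0, h1, hk⟩ := exists_residue hlam
  have hμ := Finset.mem_singleton_self μ
  have hdet := fun x => isUnit_det_cyclicMatrix_themeGen lam (α x) (β x) (γ x)
  have hι := fun x => isABLinear_themeEmb {μ} hk (α x) (β x) (γ x)
  have hinj := fun x => themeEmb_injective lam hμ k (hα0 x) (hβ0 x) (γ x)
  refine ⟨Set.univ, {μ}, _, isOpen_univ, trivial, by simp [h0, h1],
    isThematicOn_themeEmb hk hμ hα hβ hγ hα0 hβ0,
    fun x => themeEmb lam {μ} μ k (α x) (β x) (γ x), fun x _ => ⟨hι x, hinj x,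
      range_eq_span_cyclic (hdet x) (hι x), fun t => ?_⟩⟩
  refine (isHolSeriesAt_iff_cyclic (hα x) (hβ x) (hγ x) (isHolSeriesAt_themeGen lam α β γ x)
      (Eventually.of_forall hdet) t).trans ?_
  refine exists_congr fun g => and_congr Iff.rfl (eventually_congr (Eventually.of_forall fun z => ?_))
  have h2 : themeEmb lam {μ} μ k (α z) (β z) (γ z)
      (∑ j : Fin 3, g j z • aPow (j : ℕ) (themeGen lam (α z) (β z) (γ z)))
      = ∑ j : Fin 3, g j z • aPow (j : ℕ) (themeEmb lam {μ} μ k (α z) (β z) (γ z)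
        (themeGen lam (α z) (β z) (γ z))) := by
    rw [map_sum]
    refine Finset.sum_congr rfl fun j _ => ?_
    rw [map_smul, (hι z).map_aPow]
  exact (hinj z).eq_iff.symm.trans (by rw [h2]; rfl)

end Families

/-! ### Pull backs and spaces open in ℂⁿ -/

section Pullback

variable {M : Type u} [TopologicalSpace M] [ReducedComplexSpace M]
  {N : Type v} [TopologicalSpace N] [ReducedComplexSpace N]

theorem IsHolMapOn.comp_series {f : N → M} {U : Set N} (hf : IsHolMapOn f U) (hU : IsOpen U) {y : N}
    (hy : y ∈ U) {S : M → Cb} (hS : IsHolSeriesAt S (f y)) :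
    IsHolSeriesAt (fun z => S (f z)) y := by
  filter_upwards [(hf.1.continuousAt (hU.mem_nhds hy)).eventually hS, hU.mem_nhds hy] with z hz hzU n
  exact hf.2 z hzU _ (hz n)

/-- The vectors e₁, e₂, e₃ are global sections with constant coordinates, so sections of the pull
back are again recognized on their coordinates. -/
theorem isPullbackHolAt_canonicalFamily {lam : ℚ} {α β γ : M → ℂ}
    (hα : ∀ x, IsHolAt α x) (hβ : ∀ x, IsHolAt β x) (hγ : ∀ x, IsHolAt γ x)
    {f : N → M} {U : Set N} (hf : IsHolMapOn f U) (hU : IsOpen U) {y : N} (hy : y ∈ U)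
    (t : ∀ y, CanonicalTheme lam (α (f y)) (β (f y)) (γ (f y))) :
    (canonicalFamily lam α β γ hα hβ hγ).IsPullbackHolAt f t y
      ↔ ∀ i, IsHolSeriesAt (fun z => t z i) y := by
  constructor
  · rintro ⟨n, s, g, hs, hg, ht⟩ i
    refine IsHolSeriesAt.congr (S := fun z => ∑ l, g l z * (s l (f z) : Fin 3 → Cb) i) ?_ ?_
    · exact IsHolSeriesAt.sum _ fun l _ => (hg l).mul (hf.comp_series hU hy (hs l i))
    · filter_upwards [ht] with z hz
      rw [hz]
      exact (Finset.sum_apply (M := fun _ : Fin 3 => Cb) i Finset.univ fun l =>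
        ((g l z • s l (f z) : CanonicalTheme lam (α (f z)) (β (f z)) (γ (f z))))).symm
  · intro ht
    refine ⟨3, fun i x => themeBasis lam (α x) (β x) (γ x) i, fun i z => t z i, fun i l => ?_, ht,
      Eventually.of_forall fun z => ?_⟩
    · simp only [themeBasis_apply]
      exact IsHolSeriesAt.const _ _
    · exact ((themeBasis lam (α (f z)) (β (f z)) (γ (f z))).sum_repr (t z)).symm

theorem isHolMapOn_of_coord {n : ℕ} {j : M → Fin n → ℂ} (hj : IsOpenEmbedding j)
    (hM : ∀ (f : M → ℂ) (x : M), IsHolAt f x ↔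
      ∃ G : (Fin n → ℂ) → ℂ, AnalyticAt ℂ G (j x) ∧ ∀ᶠ z in 𝓝 x, f z = G (j z))
    {p : N → M} {U : Set N} (hp : ∀ y ∈ U, ∀ i, IsHolAt (fun z => j (p z) i) y) :
    IsHolMapOn p U := by
  have hc : ∀ y ∈ U, ContinuousAt p y := fun y hy => by
    rw [hj.isInducing.continuousAt_iff]
    exact continuousAt_pi.2 fun i => (hp y hy i).continuousAt
  refine ⟨fun y hy => (hc y hy).continuousWithinAt, fun y hy g hg => ?_⟩
  obtain ⟨G, hG, hgG⟩ := (hM g (p y)).1 hg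
  refine (isHolAt_comp_analyticAt (hp y hy) hG).congr ?_
  filter_upwards [(hc y hy).eventually hgG] with z hz using hz.symm

end Pullback

/-- The complex structure on a space which is identified with an open subset of `ℂⁿ`. -/
@[reducible] noncomputable def ReducedComplexSpace.ofOpenEmbedding {M : Type u} [TopologicalSpace M] {n : ℕ}
    (j : M → Fin n → ℂ) (hj : IsOpenEmbedding j) : ReducedComplexSpace M where
  t2 := hj.isEmbedding.t2Space
  IsHolAt f x := ∃ G : (Fin n → ℂ) → ℂ, AnalyticAt ℂ G (j x) ∧ ∀ᶠ z in 𝓝 x, f z = G (j z)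
  exists_chart x := by
    have hs : Set.range j = {z : Fin n → ℂ | z ∈ Set.range j ∧
        ∀ i : Fin 0, (Fin.elim0 i : (Fin n → ℂ) → ℂ) z = 0} := by
      ext z; simp
    refine ⟨Set.univ, n, 0, Set.range j, fun i => i.elim0, isOpen_univ, trivial, hj.isOpen_range,
      fun i => i.elim0, ((Homeomorph.Set.univ M).trans hj.isEmbedding.toHomeomorph).trans
        (Homeomorph.setCongr hs), fun f y => exists_congr fun G => and_congr Iff.rfl ?_⟩
    rw [nhds_subtype_eq_comap, eventually_comap]
    exact eventually_congr (Eventually.of_forall fun z =>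
      ⟨fun h a ha => by subst ha; exact h, fun h => h ⟨z, trivial⟩ rfl⟩)

theorem isSmoothOfDim_ofOpenEmbedding {M : Type u} [TopologicalSpace M] {n : ℕ}
    (j : M → Fin n → ℂ) (hj : IsOpenEmbedding j) :
    letI := ReducedComplexSpace.ofOpenEmbedding j hj
    IsSmoothOfDim n M := by
  intro x
  refine ⟨Set.univ, Set.range j, isOpen_univ, trivial, hj.isOpen_range,
    (Homeomorph.Set.univ M).trans hj.isEmbedding.toHomeomorph,
    fun f y => exists_congr fun G => and_congr Iff.rfl ?_⟩
  rw [nhds_subtype_eq_comap, eventually_comap]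
  exact eventually_congr (Eventually.of_forall fun z =>
    ⟨fun h a ha => by subst ha; exact h, fun h => h ⟨z, trivial⟩ rfl⟩)

section PullbackSections

variable {M : Type u} [TopologicalSpace M] [ReducedComplexSpace M]
  {N : Type v} [TopologicalSpace N] [ReducedComplexSpace N]
  {𝔼 : ABFamily.{u, w} M} {f : N → M} {y : N}

theorem ABFamily.isPullbackHolAt_zero : 𝔼.IsPullbackHolAt f (fun _ => 0) y :=
  ⟨0, fun i => i.elim0, fun i => i.elim0, fun i => i.elim0, fun i => i.elim0,
    Eventually.of_forall fun _ => by simp⟩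

theorem ABFamily.IsPullbackHolAt.add {t t' : ∀ y, 𝔼.fib (f y)} (ht : 𝔼.IsPullbackHolAt f t y)
    (ht' : 𝔼.IsPullbackHolAt f t' y) : 𝔼.IsPullbackHolAt f (fun z => t z + t' z) y := by
  obtain ⟨n, s, g, hs, hg, h⟩ := ht
  obtain ⟨n', s', g', hs', hg', h'⟩ := ht'
  refine ⟨n + n', Fin.append s s', Fin.append g g', fun i => ?_, fun i => ?_, ?_⟩
  · refine Fin.addCases (fun i => ?_) (fun i => ?_) i
    · rw [Fin.append_left]; exact hs i
    · rw [Fin.append_right]; exact hs' i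
  · refine Fin.addCases (fun i => ?_) (fun i => ?_) i
    · rw [Fin.append_left]; exact hg i
    · rw [Fin.append_right]; exact hg' i
  · filter_upwards [h, h'] with z hz hz'
    simp only [hz, hz', Fin.sum_univ_add, Fin.append_left, Fin.append_right]

theorem ABFamily.IsPullbackHolAt.smul {t : ∀ y, 𝔼.fib (f y)} (ht : 𝔼.IsPullbackHolAt f t y)
    {S : N → Cb} (hS : IsHolSeriesAt S y) : 𝔼.IsPullbackHolAt f (fun z => S z • t z) y := by
  obtain ⟨n, s, g, hs, hg, h⟩ := ht
  refine ⟨n, s, fun i z => S z * g i z, hs, fun i => hS.mul (hg i), ?_⟩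
  filter_upwards [h] with z hz
  simp only [hz, Finset.smul_sum, smul_smul]

theorem ABFamily.IsPullbackHolAt.sum {ι : Type*} (A : Finset ι) {t : ι → ∀ y, 𝔼.fib (f y)}
    (ht : ∀ i, 𝔼.IsPullbackHolAt f (t i) y) :
    𝔼.IsPullbackHolAt f (fun z => ∑ i ∈ A, t i z) y := by
  classical
  induction A using Finset.induction_on with
  | empty => simpa using ABFamily.isPullbackHolAt_zero
  | insert a A ha ih =>
    simp only [Finset.sum_insert ha]
    exact (ht a).add ih

theorem ABFamily.IsPullbackHolAt.congr {t t' : ∀ y, 𝔼.fib (f y)} (ht : 𝔼.IsPullbackHolAt f t y)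
    (h : ∀ᶠ z in 𝓝 y, t z = t' z) : 𝔼.IsPullbackHolAt f t' y := by
  obtain ⟨n, s, g, hs, hg, h1⟩ := ht
  refine ⟨n, s, g, hs, hg, ?_⟩
  filter_upwards [h, h1] with z hz hz'
  rw [← hz, hz']

theorem ABFamily.isPullbackHolAt_comp {s : ∀ x, 𝔼.fib x} (hs : 𝔼.IsHolAt s (f y)) :
    𝔼.IsPullbackHolAt f (fun z => s (f z)) y :=
  ⟨1, fun _ => s, fun _ _ => 1, fun _ => hs, fun _ => IsHolSeriesAt.const 1 y,
    Eventually.of_forall fun _ => by simp⟩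

end PullbackSections

/-! ### Composition of classifying maps with shears -/

section Classifying

/-- A shear is unipotent triangular with holomorphic entries, so its inverse is holomorphic as well.
-/
theorem isHolSeriesAt_shearCoord_iff {N : Type v} [TopologicalSpace N] [ReducedComplexSpace N]
    {α γ γ' x : N → ℂ} {y : N} (hα : IsHolAt α y) (hγ : IsHolAt γ y) (hγ' : IsHolAt γ' y)
    (hx : IsHolAt x y) (t : N → Fin 3 → Cb) :
    (∀ i, IsHolSeriesAt (fun z => shearCoord (α z) (γ z) (γ' z) (x z) (t z) i) y)
      ↔ ∀ i, IsHolSeriesAt (fun z => t z i) y := by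
  have hX : IsHolSeriesAt (fun _ : N => bVar) y := .const _ y
  have hp : IsHolSeriesAt (fun z => cst (x z) + cst (γ z - γ' z) * bVar) y :=
    (IsHolSeriesAt.of_cst hx).add ((IsHolSeriesAt.of_cst (hγ.sub hγ')).mul hX)
  have hq : IsHolSeriesAt (fun z => cst (α z * (γ z - γ' z) - x z * γ' z) * bVar) y :=
    (IsHolSeriesAt.of_cst ((hα.mul (hγ.sub hγ')).sub (hx.mul hγ'))).mul hX
  constructor
  · intro h
    have h2 : IsHolSeriesAt (fun z => t z 2) y := h 2
    have h1 : IsHolSeriesAt (fun z => t z 1) y := by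
      refine ((h 1).sub ((IsHolSeriesAt.of_cst hx).mul h2)).congr (Eventually.of_forall fun z => ?_)
      simp [shearCoord]
    have h0 : IsHolSeriesAt (fun z => t z 0) y := by
      refine (((h 0).sub (hp.mul h1)).sub (hq.mul h2)).congr (Eventually.of_forall fun z => ?_)
      simp only [shearCoord, Matrix.cons_val_zero]
      ring
    intro i
    fin_cases i <;> assumption
  · intro h i
    fin_cases i
    · exact ((h 0).add (hp.mul (h 1))).add (hq.mul (h 2))
    · exact (h 1).add ((IsHolSeriesAt.of_cst hx).mul (h 2))
    · exact h 2

variable {M : Type u} [TopologicalSpace M] [ReducedComplexSpace M]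
  {N : Type v} [TopologicalSpace N] [ReducedComplexSpace N]
  {N' : Type w'} [TopologicalSpace N'] [ReducedComplexSpace N']
  {𝔼 : ABFamily.{u, w} M}

/-- Pull back the classifying isomorphism by p and follow it by a shear in each fiber. Different
maps p can thus lead to the same family, which is the source of non-uniqueness when α = β. -/
theorem IsClassifyingMapAt.comp_shear {lam : ℚ} {x₀ : M} {α β γ : N → ℂ} {hα : ∀ x, IsHolAt α x}
    {hβ : ∀ x, IsHolAt β x} {hγ : ∀ x, IsHolAt γ x} {y₀ : N} {f : N → M}
    (hf : IsClassifyingMapAt 𝔼 x₀ (canonicalFamily lam α β γ hα hβ hγ) y₀ f)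
    {p : N' → N} (hp : IsHolMapOn p Set.univ) {y₁ : N'} (hpy : p y₁ = y₀) {α' β' γ' x : N' → ℂ}
    {hα' : ∀ x, IsHolAt α' x} {hβ' : ∀ x, IsHolAt β' x} {hγ' : ∀ x, IsHolAt γ' x}
    (hx : ∀ y, IsHolAt x y) (hαp : ∀ y, α' y = α (p y)) (hβp : ∀ y, β' y = β (p y))
    (hxp : ∀ y, x y * (β (p y) - α (p y)) = γ (p y) - γ' y) :
    IsClassifyingMapAt 𝔼 x₀ (canonicalFamily lam α' β' γ' hα' hβ' hγ') y₁ (f ∘ p) := by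
  obtain ⟨hfx, U, hU, hy, hfU, θ, hθ⟩ := hf
  have hpc : Continuous p := continuousOn_univ.1 hp.1
  have hcomp : ∀ {g : N → ℂ} (_ : ∀ x, IsHolAt g x) (y : N'), IsHolAt (fun z => g (p z)) y :=
    fun hg y => hp.2 y trivial _ (hg (p y))
  refine ⟨by rw [Function.comp_apply, hpy, hfx], p ⁻¹' U, hU.preimage hpc, by rwa [Set.mem_preimage, hpy],
    ⟨hfU.1.comp hpc.continuousOn fun _ h => h, fun y hyU g hg =>
      hp.2 y trivial _ (hfU.2 (p y) hyU g hg)⟩,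
    fun y => shearMap lam (α (p y)) (β (p y)) (γ (p y)) (α' y) (β' y) (γ' y) (x y) ∘ₗ θ (p y),
    fun y hyU => ⟨(hθ _ hyU).1.comp (isABLinear_shearMap (hαp y) (hβp y) (hxp y)),
      (shearMap_bijective lam _ _ _ (α' y) (β' y) (γ' y) (x y)).comp (hθ _ hyU).2.1, fun t => ?_⟩⟩
  refine Iff.trans ?_ (isHolSeriesAt_shearCoord_iff (hcomp hα y) (hcomp hγ y) (hγ' y) (hx y)
    (fun z => θ (p z) (t z))).symm
  constructor
  · rintro ⟨n, s, g, hs, hg, ht⟩ i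
    have hsθ : ∀ l, IsHolSeriesAt (fun z => (θ (p z) (s l (f (p z))) : Fin 3 → Cb) i) y := by
      intro l
      have h1 := ((hθ (p y) hyU).2.2 (fun z => s l (f z))).1 (ABFamily.isPullbackHolAt_comp (hs l))
      exact hp.comp_series isOpen_univ trivial (h1 i)
    refine IsHolSeriesAt.congr
      (S := fun z => ∑ l, g l z * (θ (p z) (s l (f (p z))) : Fin 3 → Cb) i)
      (IsHolSeriesAt.sum _ fun l _ => (hg l).mul (hsθ l)) ?_
    filter_upwards [ht] with z hz
    rw [hz, map_sum]
    simp only [map_smul]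
    exact (Finset.sum_apply (M := fun _ : Fin 3 => Cb) i Finset.univ fun l =>
      (g l z • θ (p z) (s l (f (p z))) : CanonicalTheme lam (α (p z)) (β (p z)) (γ (p z)))).symm
  · intro ht
    classical
    -- The preimages of e₁, e₂, e₃ under θ are sections of the pull back by f. Pulled back by p,
    -- they express t with the coordinates of θ(t) as coefficients. The value 0 outside U is
    -- immaterial.
    have hsec : ∀ i : Fin 3, ∃ τ : ∀ z, 𝔼.fib (f z), ∀ z ∈ U,
        θ z (τ z) = themeBasis lam (α z) (β z) (γ z) i := fun i => by
      refine ⟨fun z => if h : z ∈ U then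
        ((hθ z h).2.1.2 (themeBasis lam (α z) (β z) (γ z) i)).choose else 0, fun z hz => ?_⟩
      simp only [dif_pos hz]
      exact ((hθ z hz).2.1.2 (themeBasis lam (α z) (β z) (γ z) i)).choose_spec
    choose τ hτ using hsec
    have hτhol : ∀ i, 𝔼.IsPullbackHolAt f (τ i) (p y) := fun i => by
      refine ((hθ (p y) hyU).2.2 (τ i)).2 fun l => ?_
      refine (IsHolSeriesAt.const ((Pi.single i 1 : Fin 3 → Cb) l) (p y)).congr ?_
      filter_upwards [hU.mem_nhds hyU] with z hz
      rw [hτ i z hz, themeBasis_apply]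
    have hτp : ∀ i, 𝔼.IsPullbackHolAt (f ∘ p) (fun z => τ i (p z)) y := fun i => by
      obtain ⟨n, s, g, hs, hg, h⟩ := hτhol i
      exact ⟨n, s, fun l z => g l (p z), hs,
        fun l => hp.comp_series isOpen_univ trivial (hg l), hpc.continuousAt.eventually h⟩
    refine (ABFamily.IsPullbackHolAt.sum Finset.univ fun i => (hτp i).smul (ht i)).congr ?_
    filter_upwards [(hU.preimage hpc).mem_nhds hyU] with z hz
    apply (hθ (p z) hz).2.1.1
    rw [map_sum]
    simp only [map_smul, hτ _ _ hz]
    exact (themeBasis lam (α (p z)) (β (p z)) (γ (p z))).sum_repr (θ (p z) (t z))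

end Classifying

/-! ### No universal family at α = β -/

section NonUniversality

/-- The standard complex structure on `ℂ²`. -/
noncomputable instance planeComplexSpace : ReducedComplexSpace (Fin 2 → ℂ) :=
  ReducedComplexSpace.ofOpenEmbedding id IsOpenEmbedding.id

theorem isHolAt_plane_iff {f : (Fin 2 → ℂ) → ℂ} {x : Fin 2 → ℂ} :
    IsHolAt f x ↔ AnalyticAt ℂ f x :=
  ⟨fun ⟨_, hG, h⟩ => hG.congr (h.mono fun _ hz => hz.symm),
    fun h => ⟨f, h, Eventually.of_forall fun _ => rfl⟩⟩

/-- A function of two variables which is analytic near the origin and constant along the curves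
`c ↦ (s, c (exp s - 1))` for small `c` is constant on the axis `s = 0`. -/
theorem eq_of_constant_on_curves {h : (Fin 2 → ℂ) → ℂ} {ε : ℝ}
    (hh : ∀ z, ‖z 0‖ < ε → ‖z 1‖ < ε → AnalyticAt ℂ h z)
    (hc : ∀ s c : ℂ, ‖s‖ < ε → ‖c‖ < ε → h ![s, c * (Complex.exp s - 1)] = h ![s, 0])
    {t : ℂ} (ht : ‖t‖ < ε) : h ![0, t] = h ![0, 0] := by
  have hε : 0 < ε := (norm_nonneg t).trans_lt ht
  have hexp : ∀ᶠ s : ℂ in 𝓝[≠] 0, Complex.exp s ≠ 1 := by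
    have := (Complex.hasDerivAt_exp 0).eventually_ne (c := 1) (by simp)
    exact this
  have hsmall : ∀ᶠ s : ℂ in 𝓝[≠] 0, ‖s‖ < ε :=
    eventually_nhdsWithin_of_eventually_nhds
      (continuous_norm.continuousAt.eventually_lt continuousAt_const (by simpa using hε))
  have hline : ∀ s τ : ℂ, AnalyticAt ℂ (fun τ : ℂ => (![s, τ] : Fin 2 → ℂ)) τ := fun s τ => by
    refine AnalyticAt.pi fun i => ?_
    fin_cases i
    · exact analyticAt_const
    · exact analyticAt_id
  have hev : ∀ᶠ s : ℂ in 𝓝[≠] 0, h ![s, t] = h ![s, 0] := by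
    filter_upwards [hexp, hsmall] with s hs hsε
    have hs' : Complex.exp s - 1 ≠ 0 := sub_ne_zero.2 hs
    have hA : AnalyticOnNhd ℂ (fun τ : ℂ => h ![s, τ]) (Metric.ball 0 ε) := fun τ hτ =>
      AnalyticAt.fun_comp (hh ![s, τ] hsε (by simpa using hτ)) (hline s τ)
    have hB : AnalyticOnNhd ℂ (fun _ : ℂ => h ![s, 0]) (Metric.ball 0 ε) :=
      fun _ _ => analyticAt_const
    -- For fixed s with eˢ ≠ 1, the points c(eˢ - 1) with c small fill a neighbourhood of 0, whose
    -- size depends on s. The identity theorem extends the equality to the whole disc of radius ε.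
    have hnear : (fun τ : ℂ => h ![s, τ]) =ᶠ[𝓝 0] fun _ => h ![s, 0] := by
      have hcont : ContinuousAt (fun τ : ℂ => ‖τ / (Complex.exp s - 1)‖) 0 :=
        (continuous_id.div_const _).norm.continuousAt
      filter_upwards [hcont.eventually_lt continuousAt_const (by simpa using hε)] with τ hτ
      have := hc s (τ / (Complex.exp s - 1)) hsε hτ
      rwa [div_mul_cancel₀ _ hs'] at this
    exact hA.eqOn_of_preconnected_of_eventuallyEq hB (convex_ball 0 ε).isPreconnected
      (Metric.mem_ball_self hε) hnear (by simpa using ht)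
  have hcont : ∀ t : ℂ, ‖t‖ < ε → Tendsto (fun s : ℂ => h ![s, t]) (𝓝[≠] 0) (𝓝 (h ![0, t])) := by
    intro t ht
    have h1 : ContinuousAt (fun s : ℂ => (![s, t] : Fin 2 → ℂ)) 0 := by
      refine continuousAt_pi.2 fun i => ?_
      fin_cases i
      · exact continuousAt_id
      · exact continuousAt_const
    have h2 : ContinuousAt (fun s : ℂ => h ![s, t]) 0 :=
      ContinuousAt.comp (f := fun s : ℂ => (![s, t] : Fin 2 → ℂ))
        (hh ![0, t] (by simpa using hε) ht).continuousAt h1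
    exact h2.tendsto.mono_left nhdsWithin_le_nhds
  -- Both sides pass to the limit s → 0, s ≠ 0.
  exact tendsto_nhds_unique ((hcont t ht).congr' hev) (hcont 0 (by simpa using hε))

theorem abIsomorphic_of_eq {lam : ℚ} {α β γ α' β' γ' : ℂ} (hα : α = α') (hβ : β = β')
    (hγ : γ = γ') : ABIsomorphic (CanonicalTheme lam α β γ) (CanonicalTheme lam α' β' γ') := by
  subst hα hβ hγ
  exact ⟨LinearMap.id, fun _ => rfl, Function.bijective_id⟩

theorem not_isUniversalNear {lam : ℚ} (hlam : 2 < lam) {α : ℂ} (hα : α ≠ 0) (γ : ℂ)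
    {M : Type u} [TopologicalSpace M] [ReducedComplexSpace M] (𝔼 : ABFamily.{u, w} M) (x₀ : M)
    (hiso : ABIsomorphic (𝔼.fib x₀) (CanonicalTheme lam α α γ)) :
    ¬ ABFamily.IsUniversalNear.{u, 0, w, 0} 𝔼 (fun _ : Fin 3 => lam) x₀ := by
  intro huniv
  have hcoord : ∀ (i : Fin 2) (z : Fin 2 → ℂ), IsHolAt (fun z : Fin 2 → ℂ => z i) z :=
    fun i z => isHolAt_plane_iff.2 (analyticAt_coord i z)
  have hexp : ∀ z, IsHolAt (fun z : Fin 2 → ℂ => Complex.exp (z 0)) z := fun z =>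
    (hcoord 0 z).comp_analyticAt (analyticAt_cexp)
  have hexp1 : ∀ z, IsHolAt (fun z : Fin 2 → ℂ => Complex.exp (z 0) - 1) z := fun z =>
    (hexp z).sub (isHolAt_const 1 z)
  have hA : ∀ z, IsHolAt (fun _ : Fin 2 → ℂ => α) z := fun z => isHolAt_const α z
  have hB : ∀ z, IsHolAt (fun z : Fin 2 → ℂ => α * Complex.exp (z 0)) z := fun z =>
    (hA z).mul (hexp z)
  have hC : ∀ z, IsHolAt (fun z : Fin 2 → ℂ => γ + z 1) z := fun z =>
    (isHolAt_const γ z).add (hcoord 1 z)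
  have hC' : ∀ z, IsHolAt (fun z : Fin 2 → ℂ => γ + z 1 * (Complex.exp (z 0) - 1)) z := fun z =>
    (isHolAt_const γ z).add ((hcoord 1 z).mul (hexp1 z))
  -- With β = αeˢ, which never vanishes, both test families live over all of ℂ².
  have hB0 : ∀ z : Fin 2 → ℂ, α * Complex.exp (z 0) ≠ 0 := fun z =>
    mul_ne_zero hα (Complex.exp_ne_zero _)
  obtain ⟨⟨f, hf⟩, -⟩ := huniv (Fin 2 → ℂ) (canonicalFamily lam _ _ _ hA hB hC) 0
    (isHolFamily_canonicalFamily hlam hA hB hC (fun _ => hα) hB0)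
    ((abIsomorphic_of_eq rfl (by simp) (by simp)).trans hiso.symm)
  have huniq := (huniv (Fin 2 → ℂ) (canonicalFamily lam _ _ _ hA hB hC') 0
    (isHolFamily_canonicalFamily hlam hA hB hC' (fun _ => hα) hB0)
    ((abIsomorphic_of_eq rfl (by simp) (by simp)).trans hiso.symm)).2
  have hp : IsHolMapOn (fun z : Fin 2 → ℂ => (![z 0, z 1 * (Complex.exp (z 0) - 1)] : Fin 2 → ℂ))
      Set.univ := by
    refine isHolMapOn_of_coord IsOpenEmbedding.id (fun _ _ => Iff.rfl) fun z _ i => ?_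
    fin_cases i
    · exact hcoord 0 z
    · exact (hcoord 1 z).mul (hexp1 z)
  have hq : IsHolMapOn (fun z : Fin 2 → ℂ => (![z 0, 0] : Fin 2 → ℂ)) Set.univ := by
    refine isHolMapOn_of_coord IsOpenEmbedding.id (fun _ _ => Iff.rfl) fun z _ i => ?_
    fin_cases i
    · exact hcoord 0 z
    · exact isHolAt_const 0 z
  -- The second family is the pull back of the first by p on the nose. By q it is so up to the shear
  -- with x = -t/α, since x(β - α) = -t(eˢ - 1).
  have heq := huniq _ _
    (hf.comp_shear (hα' := hA) (hβ' := hB) (hγ' := hC') hp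
      (by ext i; fin_cases i <;> simp) (x := fun _ => 0) (fun z => isHolAt_const 0 z)
      (fun _ => rfl) (fun _ => rfl) (fun z => by simp))
    (hf.comp_shear (hα' := hA) (hβ' := hB) (hγ' := hC') hq
      (by ext i; fin_cases i <;> simp) (x := fun z => -z 1 * α⁻¹)
      (fun z => (hcoord 1 z).neg.mul (isHolAt_const α⁻¹ z))
      (fun _ => rfl) (fun _ => rfl) (fun z => by
        simp only [Matrix.cons_val_zero, Matrix.cons_val_one]
        field_simp
        ring))
  obtain ⟨hf0, U, hU, h0U, hfU, θ, hθ⟩ := hf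
  obtain ⟨W, n, m, D, P, hW, hxW, -, -, e, he⟩ := exists_chart x₀
  classical
  -- Chart coordinates, extended by 0 outside W, reduce the constancy of f to that of scalar
  -- functions.
  let co : Fin n → M → ℂ := fun i x => if h : x ∈ W then (e ⟨x, h⟩ : Fin n → ℂ) i else 0
  have hco : ∀ i, ∀ x ∈ W, IsHolAt (co i) x := fun i x hx =>
    (he (co i) ⟨x, hx⟩).2 ⟨fun z => z i, analyticAt_coord i _,
      Eventually.of_forall fun z => by simp only [co, dif_pos z.2]⟩
  have hfc : ContinuousAt f 0 := hfU.1.continuousAt (hU.mem_nhds h0U)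
  have hall : ∀ᶠ z in 𝓝 (0 : Fin 2 → ℂ), z ∈ U ∧ f z ∈ W ∧
      f ![z 0, z 1 * (Complex.exp (z 0) - 1)] = f ![z 0, 0] := by
    filter_upwards [hU.mem_nhds h0U, hfc.eventually (by rw [hf0]; exact hW.mem_nhds hxW), heq]
      with z h1 h2 h3 using ⟨h1, h2, h3⟩
  obtain ⟨ε, hε, hball⟩ := Metric.eventually_nhds_iff_ball.1 hall
  have hmem : ∀ z : Fin 2 → ℂ, ‖z 0‖ < ε → ‖z 1‖ < ε → z ∈ Metric.ball 0 ε := fun z h0 h1 => by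
    rw [mem_ball_zero_iff, pi_norm_lt_iff hε]
    intro i
    fin_cases i <;> assumption
  have hconst : ∀ t : ℂ, ‖t‖ < ε → f ![0, t] = f ![0, 0] := by
    intro t ht
    have hW1 : f ![0, t] ∈ W := (hball _ (hmem ![0, t] (by simpa using hε) (by simpa using ht))).2.1
    have hW0 : f ![0, 0] ∈ W := (hball _ (hmem ![0, 0] (by simpa using hε) (by simpa using hε))).2.1
    have hi : ∀ i, co i (f ![0, t]) = co i (f ![0, 0]) := fun i => by
      refine eq_of_constant_on_curves (h := fun z => co i (f z)) (ε := ε) (fun z h0 h1 => ?_)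
        (fun s c hs hc => ?_) ht
      · obtain ⟨hzU, hzW, -⟩ := hball z (hmem z h0 h1)
        exact isHolAt_plane_iff.1 (hfU.2 z hzU _ (hco i _ hzW))
      · exact congrArg (co i) (hball _ (hmem ![s, c] hs hc)).2.2
    simp only [co, dif_pos hW1, dif_pos hW0] at hi
    have := e.injective (Subtype.ext (funext hi))
    exact congrArg Subtype.val this
  have ht0 : ‖((ε / 2 : ℝ) : ℂ)‖ < ε := by
    rw [Complex.norm_real, Real.norm_of_nonneg (by positivity)]; linarith
  set t : ℂ := ((ε / 2 : ℝ) : ℂ)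
  have htne : t ≠ 0 := by
    simp only [t, ne_eq, Complex.ofReal_eq_zero]; positivity
  have hft : f ![0, t] = x₀ := by
    rw [hconst t ht0, ← hf0]
    congr 1
    ext i; fin_cases i <;> simp
  have htU := (hball _ (hmem ![0, t] (by simpa using hε) (by simpa using ht0))).1
  -- As f(0,t) = x₀, the themes E(α,α,γ + t) and E(α,α,γ) would be isomorphic with t ≠ 0.
  have hiso' : ABIsomorphic (𝔼.fib (f ![0, t]))
      (CanonicalTheme lam α (α * Complex.exp ((![0, t] : Fin 2 → ℂ) 0))
        (γ + (![0, t] : Fin 2 → ℂ) 1)) := ⟨θ ![0, t], (hθ _ htU).1, (hθ _ htU).2.1⟩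
  rw [hft] at hiso'
  have := (eq_of_abIsomorphic (hiso.symm.trans hiso')).2.2 rfl
  simp at this
  exact htne this

end NonUniversality

/-! ### Submodules of Ξ with fundamental invariants λ, λ, λ -/

theorem coeff_X_sq_mul_bDeriv (n : ℕ) (p : Cb) :
    PowerSeries.coeff (n + 1) (bVar ^ 2 * bDeriv p) = n * PowerSeries.coeff n p := by
  cases n with
  | zero => rw [PowerSeries.coeff_X_pow_mul']; simp
  | succ n =>
    rw [show n + 1 + 1 = n + 2 from rfl, PowerSeries.coeff_X_pow_mul, bDeriv,
      PowerSeries.coeff_derivative]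
    push_cast
    ring

/-- Both b and b² d/db raise degrees by one, so the equation decouples degree by degree. The factor
ν + n - l vanishes for at most one n, the resonant degree. -/
theorem coeff_of_a_eq {ν l : ℂ} {p q R : Cb}
    (h : cst ν * bVar * p + bVar ^ 2 * bDeriv p + bVar * q = cst l * bVar * p + R) (n : ℕ) :
    (ν + n - l) * PowerSeries.coeff n p + PowerSeries.coeff n q = PowerSeries.coeff (n + 1) R := by
  have h1 := congrArg (PowerSeries.coeff (n + 1)) h
  simp only [map_add, coeff_X_sq_mul_bDeriv, mul_assoc, cst, PowerSeries.coeff_C_mul,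
    PowerSeries.coeff_succ_X_mul] at h1
  linear_combination h1

theorem exists_eq_head_add {k : ℕ} {p : Cb} (h : ∀ n < k, PowerSeries.coeff n p = 0) :
    ∃ r : Cb, p = cst (PowerSeries.coeff k p) * bVar ^ k + bVar ^ (k + 1) * r := by
  have hd : bVar ^ (k + 1) ∣ p - cst (PowerSeries.coeff k p) * bVar ^ k := by
    rw [PowerSeries.X_pow_dvd_iff]
    intro n hn
    rw [map_sub, PowerSeries.coeff_C_mul, PowerSeries.coeff_X_pow]
    rcases Nat.lt_succ_iff_lt_or_eq.1 hn with hn | rfl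
    · simp [h n hn, hn.ne]
    · simp
  obtain ⟨r, hr⟩ := hd
  exact ⟨r, by rw [← hr]; ring⟩

theorem eq_cst_mul_X_pow {m : ℕ} {p : Cb}
    (h : ∀ n : ℕ, ((n : ℂ) - m) * PowerSeries.coeff n p = 0) :
    p = cst (PowerSeries.coeff m p) * bVar ^ m := by
  ext n
  rw [PowerSeries.coeff_C_mul, PowerSeries.coeff_X_pow]
  split_ifs with hn
  · rw [hn, mul_one]
  · rw [mul_zero]
    refine (mul_eq_zero.1 (h n)).resolve_left (sub_ne_zero.2 ?_)
    exact_mod_cast hn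

theorem eq_zero_of_xiA_eq {ν : ℂ} {l : ℂ} (hν : ∀ n : ℕ, ν + n - l ≠ 0) {x : Fin 3 → Cb}
    (h : xiA ν x = fun i => cst l * bVar * x i) : x = 0 := by
  have step : ∀ p q : Cb, q = 0 → cst ν * bVar * p + bVar ^ 2 * bDeriv p + bVar * q
      = cst l * bVar * p → p = 0 := fun p q hq hp => by
    ext n
    have h1 := coeff_of_a_eq (R := 0) (by rw [add_zero]; exact hp) n
    rw [hq] at h1
    simpa [hν n] using h1
  have h2 : x 2 = 0 := step _ 0 rfl (by rw [mul_zero, add_zero]; exact congrFun h 2)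
  have h1 : x 1 = 0 := step _ _ h2 (congrFun h 1)
  have h0 : x 0 = 0 := step _ _ h1 (congrFun h 0)
  funext i
  fin_cases i <;> assumption

/-- A solution of `(a - λ b) x = y` in `Ξ_μ^{(2)}`, where `λ = μ + m`. -/
theorem coeff_of_xiA_eq {ν l : ℂ} {m : ℕ} (hl : l = ν + m) {x y : Fin 3 → Cb}
    (h : xiA ν x = fun i => cst l * bVar * x i + y i) (n : ℕ) :
    (((n : ℂ) - m) * PowerSeries.coeff n (x 0) + PowerSeries.coeff n (x 1)
      = PowerSeries.coeff (n + 1) (y 0)) ∧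
    (((n : ℂ) - m) * PowerSeries.coeff n (x 1) + PowerSeries.coeff n (x 2)
      = PowerSeries.coeff (n + 1) (y 1)) ∧
    ((n : ℂ) - m) * PowerSeries.coeff n (x 2) = PowerSeries.coeff (n + 1) (y 2) := by
  have e : ν + n - l = (n : ℂ) - m := by rw [hl]; ring
  rw [← e]
  refine ⟨coeff_of_a_eq (congrFun h 0) n, coeff_of_a_eq (congrFun h 1) n, ?_⟩
  have h2 := coeff_of_a_eq (p := x 2) (q := 0) (R := y 2)
    (by rw [mul_zero, add_zero]; exact congrFun h 2) n
  rwa [map_zero, add_zero] at h2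

/-- Three independent elements of `Ξ_μ^{(2)}` on which `a - λ b` acts in a triangular way, with
invertible coefficients next to the diagonal, form a triangular basis of the image of a canonical
theme. -/
theorem exists_eq_embCoord {μ l : ℂ} {k : ℕ} (hl : l = μ + (k + 2 : ℕ)) {x y z : Fin 3 → Cb}
    {S T T' : Cb} (hx : xiA μ x = fun i => cst l * bVar * x i)
    (hy : xiA μ y = fun i => cst l * bVar * y i + S * x i)
    (hz : xiA μ z = fun i => cst l * bVar * z i + (T * y i + T' * x i))
    (hli : LinearIndependent Cb ![x, y, z]) (hS : PowerSeries.constantCoeff S ≠ 0)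
    (hT : PowerSeries.constantCoeff T ≠ 0) :
    ∃ α β γ c s u : ℂ, ∃ P Q R : Cb, α ≠ 0 ∧ β ≠ 0 ∧ c ≠ 0 ∧ s ≠ 0 ∧ u ≠ 0 ∧
      x = embCoord k α β γ ![cst c, 0, 0] ∧ y = embCoord k α β γ ![P, cst s, 0] ∧
      z = embCoord k α β γ ![R, Q, cst u] := by
  have hx' := coeff_of_xiA_eq hl (y := 0) (by simpa using hx)
  have hy' := coeff_of_xiA_eq hl hy
  have hz' := coeff_of_xiA_eq hl hz
  simp only [Pi.zero_apply, map_zero] at hx'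
  have hm : ((k + 2 : ℕ) : ℂ) - ((k + 2 : ℕ) : ℂ) = 0 := sub_self _
  -- Only the resonant degree k + 2 can survive, and the equation of the preceding component in that
  -- degree kills it. Hence x lies on e_{μ,0} alone, and in the same way y has no component on
  -- e_{μ,2}.
  have x2 := eq_cst_mul_X_pow fun n => (hx' n).2.2
  have x2c : PowerSeries.coeff (k + 2) (x 2) = 0 := by
    have := (hx' (k + 2)).2.1
    rwa [hm, zero_mul, zero_add] at this
  rw [x2c, cst, map_zero, zero_mul] at x2
  have x1 := eq_cst_mul_X_pow (m := k + 2) (p := x 1) fun n => by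
    have := (hx' n).2.1
    rwa [x2, map_zero, add_zero] at this
  have x1c : PowerSeries.coeff (k + 2) (x 1) = 0 := by
    have := (hx' (k + 2)).1
    rwa [hm, zero_mul, zero_add] at this
  rw [x1c, cst, map_zero, zero_mul] at x1
  have x0 := eq_cst_mul_X_pow (m := k + 2) (p := x 0) fun n => by
    have := (hx' n).1
    rwa [x1, map_zero, add_zero] at this
  generalize PowerSeries.coeff (k + 2) (x 0) = c at x0
  simp only [x1, x2, mul_zero, map_zero] at hy'
  have y2 := eq_cst_mul_X_pow fun n => (hy' n).2.2
  have y2c : PowerSeries.coeff (k + 2) (y 2) = 0 := by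
    have := (hy' (k + 2)).2.1
    rwa [hm, zero_mul, zero_add] at this
  rw [y2c, cst, map_zero, zero_mul] at y2
  have y1 := eq_cst_mul_X_pow (m := k + 2) (p := y 1) fun n => by
    have := (hy' n).2.1
    rwa [y2, map_zero, add_zero] at this
  generalize PowerSeries.coeff (k + 2) (y 1) = d at y1
  have hcoef : ∀ (A : Cb) (c : ℂ) (m n : ℕ), PowerSeries.coeff n (A * (cst c * bVar ^ m))
      = if m ≤ n then c * PowerSeries.coeff (n - m) A else 0 := fun A c m n => by
    rw [mul_left_comm, cst, PowerSeries.coeff_C_mul, PowerSeries.coeff_mul_X_pow']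
    split_ifs <;> simp
  have hne : ∀ n : ℕ, n < k + 2 → (n : ℂ) - (k + 2 : ℕ) ≠ 0 := fun n hn =>
    sub_ne_zero.2 (by exact_mod_cast hn.ne)
  have hXk : ∀ n : ℕ, n < k + 2 → ∀ c : ℂ, PowerSeries.coeff n (cst c * bVar ^ (k + 2)) = 0 :=
    fun n hn c => by
      rw [cst, PowerSeries.coeff_C_mul, PowerSeries.coeff_X_pow, if_neg hn.ne, mul_zero]
  obtain ⟨P, y0⟩ : ∃ P, y 0 = cst (PowerSeries.coeff (k + 1) (y 0)) * bVar ^ (k + 1)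
      + bVar ^ (k + 1 + 1) * P := by
    refine exists_eq_head_add fun n hn => ?_
    have := (hy' n).1
    rw [x0, y1, hcoef, if_neg (by omega), hXk n (by omega), add_zero] at this
    exact (mul_eq_zero.1 this).resolve_left (hne n (by omega))
  -- The constants s, τ, u are dictated by the equations one and two degrees below the resonance,
  -- where the factors are -1 and -2; the latter yields u/2 as leading coefficient of z 0.
  obtain ⟨s, hs⟩ : ∃ s, s = c * PowerSeries.constantCoeff S := ⟨_, rfl⟩
  have y0c : PowerSeries.coeff (k + 1) (y 0) = -s := by
    have := (hy' (k + 1)).1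
    rw [x0, y1, hcoef, if_pos (by omega), hXk (k + 1) (by omega), add_zero] at this
    simp only [show k + 1 + 1 - (k + 2) = 0 by omega, PowerSeries.coeff_zero_eq_constantCoeff] at this
    push_cast at this
    rw [hs]
    linear_combination -this
  rw [y0c] at y0
  simp only [x1, x2, y2, mul_zero, add_zero, map_zero] at hz'
  have z2 := eq_cst_mul_X_pow fun n => (hz' n).2.2
  generalize PowerSeries.coeff (k + 2) (z 2) = e at z2
  obtain ⟨τ, hτ⟩ : ∃ τ, τ = d * PowerSeries.constantCoeff T := ⟨_, rfl⟩
  have z1n : ∀ n < k + 1, PowerSeries.coeff n (z 1) = 0 := fun n hn => by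
    have := (hz' n).2.1
    rw [y1, z2, hcoef, if_neg (by omega), hXk n (by omega), add_zero] at this
    exact (mul_eq_zero.1 this).resolve_left (hne n (by omega))
  obtain ⟨Q, z1⟩ := exists_eq_head_add z1n
  have z1c : PowerSeries.coeff (k + 1) (z 1) = -τ := by
    have := (hz' (k + 1)).2.1
    rw [y1, z2, hcoef, if_pos (by omega), hXk (k + 1) (by omega), add_zero] at this
    simp only [show k + 1 + 1 - (k + 2) = 0 by omega, PowerSeries.coeff_zero_eq_constantCoeff] at this
    push_cast at this
    rw [hτ]
    linear_combination -this
  rw [z1c] at z1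
  have hR : ∀ n < k + 2, PowerSeries.coeff n (T * y 0 + T' * x 0)
      = if k + 1 ≤ n then -s * PowerSeries.coeff (n - (k + 1)) T else 0 := fun n hn => by
    have e1 : T * y 0 + T' * x 0 = T * (cst (-s) * bVar ^ (k + 1))
        + bVar ^ (k + 2) * (T * P + T' * cst c) := by rw [y0, x0]; ring
    have e2 : PowerSeries.coeff n (bVar ^ (k + 2) * (T * P + T' * cst c)) = 0 := by
      rw [PowerSeries.coeff_X_pow_mul', if_neg (by omega)]
    rw [e1, map_add, hcoef, e2, add_zero]
  obtain ⟨W, z0⟩ : ∃ W, z 0 = cst (PowerSeries.coeff k (z 0)) * bVar ^ k + bVar ^ (k + 1) * W := by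
    refine exists_eq_head_add fun n hn => ?_
    have := (hz' n).1
    rw [hR _ (by omega), if_neg (by omega), z1n n (by omega), add_zero] at this
    exact (mul_eq_zero.1 this).resolve_left (hne n (by omega))
  obtain ⟨u, hu⟩ : ∃ u, u = s * PowerSeries.constantCoeff T := ⟨_, rfl⟩
  have z0c : PowerSeries.coeff k (z 0) = 1 / 2 * u := by
    have := (hz' k).1
    rw [hR _ (by omega), if_pos (by omega), z1n k (by omega), add_zero] at this
    simp only [Nat.sub_self, PowerSeries.coeff_zero_eq_constantCoeff] at this
    push_cast at this
    rw [hu]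
    linear_combination -this / 2
  rw [z0c] at z0
  -- The matrix is triangular with diagonal c, d, e times b^(k+2), so independence makes these
  -- constants nonzero.
  have hdet : (Matrix.of ![x, y, z]).det ≠ 0 := by
    intro h0
    obtain ⟨v, hv, hv0⟩ := Matrix.exists_vecMul_eq_zero_iff.2 h0
    refine hv (funext (Fintype.linearIndependent_iff.1 hli v ?_))
    rw [← hv0]
    funext i
    simp [Matrix.vecMul, dotProduct, Fin.sum_univ_three]
  have hcde : c ≠ 0 ∧ d ≠ 0 ∧ e ≠ 0 := by
    rw [Matrix.det_fin_three] at hdet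
    simp only [Matrix.of_apply, Matrix.cons_val_zero, Matrix.cons_val_one, Matrix.cons_val, x1, x2,
      y2, x0, y1, z2] at hdet
    refine ⟨?_, ?_, ?_⟩ <;> rintro rfl <;> simp at hdet
  obtain ⟨hc, hd, he⟩ := hcde
  have hs0 : s ≠ 0 := hs ▸ mul_ne_zero hc hS
  have hτ0 : τ ≠ 0 := hτ ▸ mul_ne_zero hd hT
  have hu0 : u ≠ 0 := hu ▸ mul_ne_zero hs0 hT
  obtain ⟨Q', hQ⟩ := exists_eq_head_add (k := 0) (p := Q) (by simp)
  obtain ⟨W', hW⟩ := exists_eq_head_add (k := 0) (p := W) (by simp)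
  generalize PowerSeries.coeff 0 Q = q at hQ
  generalize PowerSeries.coeff 0 W = r at hW
  -- The ratios d/s and e/τ come from comparison with the leading coefficients in `embCoord`. γ is
  -- fixed by the coefficient of b^(k+1) in z 0, which the term b^(k+2) R cannot absorb.
  obtain ⟨β, hβ⟩ : ∃ β, β = d / s := ⟨_, rfl⟩
  obtain ⟨α, hα⟩ : ∃ α, α = e / τ := ⟨_, rfl⟩
  obtain ⟨γ, hγ⟩ : ∃ γ, γ = (β * (r + (β - α) * u) + q) / u := ⟨_, rfl⟩
  have hβ0 : β ≠ 0 := hβ ▸ div_ne_zero hd hs0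
  have eβs : cst β * cst s = cst d := by
    rw [cst, cst, ← map_mul, hβ, div_mul_cancel₀ _ hs0]
  have eβu : cst β * cst u = cst τ := by
    rw [cst, cst, ← map_mul, hβ, hu, hτ]; congr 1; field_simp
  have eαu : cst (α * β) * cst u = cst e := by
    rw [cst, cst, ← map_mul]; congr 1
    rw [hα, hβ, hu, hτ]; field_simp
  have eβ' : cst β * cst β⁻¹ = 1 := by
    rw [cst, cst, ← map_mul, mul_inv_cancel₀ hβ0, map_one]
  have eγ : cst β⁻¹ * (cst q - cst γ * cst u) + cst (β - α) * cst u + cst r = 0 := by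
    simp only [cst, ← map_mul, ← map_sub, ← map_add]
    rw [← map_zero PowerSeries.C]
    congr 1
    rw [hγ]
    field_simp
    ring
  have en : ∀ t : ℂ, cst (-t) = -cst t := fun t => map_neg _ t
  have em : ∀ t t' : ℂ, cst (t * t') = cst t * cst t' := fun t t' => map_mul _ t t'
  refine ⟨α, β, γ, c, s, u, P - cst γ * cst s * bVar, cst β⁻¹ * (Q - cst γ * cst u),
    W' + cst β⁻¹ * Q' - cst γ * bVar * (cst β⁻¹ * (Q - cst γ * cst u))
      - cst (α * γ) * cst u * bVar, hα ▸ div_ne_zero he hτ0, hβ0, hc, hs0, hu0, ?_, ?_, ?_⟩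
  · funext i
    fin_cases i
    · simp only [embCoord, Fin.zero_eta, Matrix.cons_val_zero, Matrix.cons_val_one, Matrix.cons_val, x0]
      ring
    · simp [embCoord, x1]
    · simp [embCoord, x2]
  · funext i
    fin_cases i
    · simp only [embCoord, Fin.zero_eta, Matrix.cons_val_zero, Matrix.cons_val_one, Matrix.cons_val, y0, en]
      ring
    · simp only [embCoord, Fin.mk_one, Matrix.cons_val_zero, Matrix.cons_val_one, Matrix.cons_val, y1]
      linear_combination -bVar ^ (k + 2) * eβs
    · simp [embCoord, y2]
  · funext i
    fin_cases i
    · simp only [embCoord, Fin.zero_eta, Matrix.cons_val_zero, Matrix.cons_val_one, Matrix.cons_val, z0, hW, em]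
      rw [hQ]
      linear_combination bVar ^ (k + 1) * eγ
    · simp only [embCoord, Fin.mk_one, Matrix.cons_val_zero, Matrix.cons_val_one, Matrix.cons_val, z1, en]
      linear_combination -bVar ^ (k + 2) * (Q - cst γ * cst u) * eβ' + bVar ^ (k + 1) * eβu
    · simp only [embCoord, Fin.reduceFinMk, Matrix.cons_val_zero, Matrix.cons_val_one, Matrix.cons_val, z2]
      linear_combination -bVar ^ (k + 2) * eαu

/-- In a cyclic module with a triangular basis the coefficients next to the diagonal are
invertible. -/
theorem constantCoeff_ne_zero_of_cyclic {E : Type*} [AddCommGroup E] [Module Cb E] [ABModule E]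
    {l : ℂ} (e : Module.Basis (Fin 3) Cb E) {S T T' : Cb}
    (h0 : ABModule.a (e 0) = (cst l * bVar) • e 0)
    (h1 : ABModule.a (e 1) = (cst l * bVar) • e 1 + S • e 0)
    (h2 : ABModule.a (e 2) = (cst l * bVar) • e 2 + (T • e 1 + T' • e 0)) {φ : E}
    (hφ : Submodule.span Cb (Set.range fun j : Fin 3 => aPow (j : ℕ) φ) = ⊤) :
    PowerSeries.constantCoeff S ≠ 0 ∧ PowerSeries.constantCoeff T ≠ 0 := by
  -- r is reduction modulo b, through which a acts as a strictly triangular matrix with entries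
  -- S(0), T(0) next to the diagonal. A cyclic vector exists only if this is a single Jordan block,
  -- i.e. S(0)T(0) ≠ 0.
  obtain ⟨r, hr⟩ : ∃ r : E → Fin 3 → ℂ, r = fun v i => PowerSeries.constantCoeff (e.repr v i) :=
    ⟨_, rfl⟩
  have ra : ∀ v w i, r (v + w) i = r v i + r w i := fun v w i => by simp [hr]
  have rs : ∀ (A : Cb) v i, r (A • v) i = PowerSeries.constantCoeff A * r v i := fun A v i => by
    simp [hr]
  have re : ∀ i j, r (e i) j = if i = j then 1 else 0 := fun i j => by
    simp only [hr, Module.Basis.repr_self, Finsupp.single_apply]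
    split_ifs <;> simp
  have hra : ∀ v, r (ABModule.a v) 0 = PowerSeries.constantCoeff S * r v 1
      + PowerSeries.constantCoeff T' * r v 2 ∧
      r (ABModule.a v) 1 = PowerSeries.constantCoeff T * r v 2 ∧ r (ABModule.a v) 2 = 0 := by
    intro v
    have hv : v = e.repr v 0 • e 0 + e.repr v 1 • e 1 + e.repr v 2 • e 2 := by
      rw [← Fin.sum_univ_three (fun i => e.repr v i • e i), e.sum_repr]
    have hv' : ∀ i, PowerSeries.constantCoeff (e.repr v i) = r v i := fun i => by rw [hr]
    have hav : ABModule.a v = e.repr v 0 • ABModule.a (e 0) + (bVar ^ 2 * bDeriv (e.repr v 0)) • e 0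
        + (e.repr v 1 • ABModule.a (e 1) + (bVar ^ 2 * bDeriv (e.repr v 1)) • e 1)
        + (e.repr v 2 • ABModule.a (e 2) + (bVar ^ 2 * bDeriv (e.repr v 2)) • e 2) := by
      conv_lhs => rw [hv]
      rw [map_add, map_add, ABModule.a_smul, ABModule.a_smul, ABModule.a_smul]
    rw [hav, h0, h1, h2]
    simp only [ra, rs, re, map_mul, map_pow, PowerSeries.constantCoeff_X, hv']
    refine ⟨?_, ?_, ?_⟩ <;> simp <;> ring
  have hcomb : ∀ v, ∃ n0 n1 n2 : ℂ, r v 2 = n0 * r φ 2 ∧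
      r v 1 = n0 * r φ 1 + n1 * (PowerSeries.constantCoeff T * r φ 2) ∧
      r v 0 = n0 * r φ 0 + n1 * (PowerSeries.constantCoeff S * r φ 1
        + PowerSeries.constantCoeff T' * r φ 2)
        + n2 * (PowerSeries.constantCoeff S * (PowerSeries.constantCoeff T * r φ 2)) := by
    intro v
    have hv : v ∈ Submodule.span Cb (Set.range fun j : Fin 3 => aPow (j : ℕ) φ) := by
      rw [hφ]; trivial
    obtain ⟨g, rfl⟩ := (Submodule.mem_span_range_iff_exists_fun Cb).1 hv
    refine ⟨PowerSeries.constantCoeff (g 0), PowerSeries.constantCoeff (g 1),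
      PowerSeries.constantCoeff (g 2), ?_⟩
    have e0 : aPow 0 φ = φ := rfl
    have e1 : aPow 1 φ = ABModule.a φ := rfl
    have e2 : aPow 2 φ = ABModule.a (ABModule.a φ) := rfl
    simp only [Fin.sum_univ_three, Fin.val_zero, Fin.val_one, Fin.val_two, e0, e1, e2, ra, rs,
      (hra φ).1, (hra φ).2.1, (hra φ).2.2, (hra (ABModule.a φ)).1, (hra (ABModule.a φ)).2.1,
      (hra (ABModule.a φ)).2.2, mul_zero, add_zero, and_self]
  obtain ⟨a0, -, -, ha, -, -⟩ := hcomb (e 2)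
  rw [re, if_pos rfl] at ha
  have hφ2 : r φ 2 ≠ 0 := right_ne_zero_of_mul (ha ▸ one_ne_zero)
  obtain ⟨b0, b1, -, hb, hb', -⟩ := hcomb (e 1)
  obtain ⟨c0, c1, c2, hc, hc', hc''⟩ := hcomb (e 0)
  rw [re, if_neg (by decide)] at hb hc hc'
  rw [re, if_pos rfl] at hb' hc''
  obtain rfl : b0 = 0 := (mul_eq_zero.1 hb.symm).resolve_right hφ2
  obtain rfl : c0 = 0 := (mul_eq_zero.1 hc.symm).resolve_right hφ2
  rw [zero_mul, zero_add] at hb' hc'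
  have hT := left_ne_zero_of_mul (right_ne_zero_of_mul (hb' ▸ one_ne_zero))
  obtain rfl : c1 = 0 := (mul_eq_zero.1 hc'.symm).resolve_right (mul_ne_zero hT hφ2)
  rw [zero_mul, zero_mul, zero_add, zero_add] at hc''
  exact ⟨left_ne_zero_of_mul (right_ne_zero_of_mul (hc'' ▸ one_ne_zero)), hT⟩

theorem exists_triangular_basis {l : ℚ} {E : Type*} [AddCommGroup E] [Module Cb E] [ABModule E]
    (h : HasFundamentalInvariants (fun _ : Fin 3 => l) E) :
    ∃ (e : Module.Basis (Fin 3) Cb E) (S T T' : Cb),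
      ABModule.a (e 0) = (cst (l : ℂ) * bVar) • e 0 ∧
      ABModule.a (e 1) = (cst (l : ℂ) * bVar) • e 1 + S • e 0 ∧
      ABModule.a (e 2) = (cst (l : ℂ) * bVar) • e 2 + (T • e 1 + T' • e 0) := by
  obtain ⟨e, he⟩ := h
  have i0 : {i : Fin 3 | i < 0} = ∅ := by ext i; simp
  have i1 : {i : Fin 3 | i < 1} = {0} := by ext i; fin_cases i <;> simp
  have i2 : {i : Fin 3 | i < 2} = {1, 0} := by ext i; fin_cases i <;> simp
  have h0 := he 0
  have h1 := he 1
  have h2 := he 2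
  rw [i0, Set.image_empty, Submodule.span_empty, Submodule.mem_bot] at h0
  rw [i1, Set.image_singleton, Submodule.mem_span_singleton] at h1
  rw [i2, Set.image_pair, Submodule.mem_span_pair] at h2
  obtain ⟨S, hS⟩ := h1
  obtain ⟨T, T', hT⟩ := h2
  refine ⟨e, S, T, T', sub_eq_zero.1 h0, ?_, ?_⟩
  · rw [hS]; abel
  · rw [hT]; abel

/-- The image in `Ξ_Λ^{(2)}` of a cyclic module with fundamental invariants `λ, λ, λ` is the image of
a canonical theme. -/
theorem exists_range_eq_range_themeEmb {lam μ : ℚ} {k : ℕ} (hμ0 : 0 < μ) (hμ1 : μ ≤ 1)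
    (hk : lam = μ + k + 2) {Λ : Finset ℚ} (hΛ : ∀ ν ∈ Λ, 0 < ν ∧ ν ≤ 1)
    {E : Type*} [AddCommGroup E] [Module Cb E] [ABModule E]
    (hE : HasFundamentalInvariants (fun _ : Fin 3 => lam) E) {θ : E →ₗ[Cb] Xi Λ 2}
    (hθ : IsABLinear θ) (hinj : Function.Injective θ) {φ : Xi Λ 2}
    (hr : LinearMap.range θ = Submodule.span Cb (Set.range fun j : Fin 3 => aPow (j : ℕ) φ)) :
    μ ∈ Λ ∧ ∃ α β γ : ℂ, α ≠ 0 ∧ β ≠ 0 ∧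
      LinearMap.range (themeEmb lam Λ μ k α β γ) = LinearMap.range θ := by
  obtain ⟨e, S, T, T', h0, h1, h2⟩ := exists_triangular_basis hE
  obtain ⟨φ', hφ'⟩ : φ ∈ LinearMap.range θ := by
    rw [hr]; exact Submodule.subset_span ⟨0, rfl⟩
  have hcyc : Submodule.span Cb (Set.range fun j : Fin 3 => aPow (j : ℕ) φ') = ⊤ := by
    apply Submodule.map_injective_of_injective hinj
    rw [Submodule.map_span, ← Set.range_comp, Submodule.map_top, hr, ← hφ']
    congr 2
    funext j
    exact hθ.map_aPow j φ'
  obtain ⟨hS, hT⟩ := constantCoeff_ne_zero_of_cyclic e h0 h1 h2 hcyc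
  have g0 : ∀ ν : Λ, xiA ((ν : ℚ) : ℂ) (θ (e 0) ν) = fun i => cst (lam : ℂ) * bVar * θ (e 0) ν i :=
    fun ν => by
      rw [← a_xi_apply, ← hθ, h0, map_smul]; rfl
  have g1 : ∀ ν : Λ, xiA ((ν : ℚ) : ℂ) (θ (e 1) ν)
      = fun i => cst (lam : ℂ) * bVar * θ (e 1) ν i + S * θ (e 0) ν i :=
    fun ν => by
      rw [← a_xi_apply, ← hθ, h1, map_add, map_smul, map_smul]; rfl
  have g2 : ∀ ν : Λ, xiA ((ν : ℚ) : ℂ) (θ (e 2) ν)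
      = fun i => cst (lam : ℂ) * bVar * θ (e 2) ν i + (T * θ (e 1) ν i + T' * θ (e 0) ν i) :=
    fun ν => by
      rw [← a_xi_apply, ← hθ, h2, map_add, map_add, map_smul, map_smul, map_smul]; rfl
  -- Since Λ lies in ]0,1], only ν = μ is congruent to λ modulo ℤ. The other summands have no
  -- resonance, and the triangular relations make the images of e₁, e₂, e₃ vanish there.
  have hν : ∀ ν : Λ, (ν : ℚ) ≠ μ → ∀ n : ℕ, ((ν : ℚ) : ℂ) + n - (lam : ℂ) ≠ 0 := by
    intro ν hne n h
    have h' : (ν : ℚ) + n - lam = 0 := by exact_mod_cast h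
    obtain ⟨a1, a2⟩ := hΛ ν ν.2
    rw [hk] at h'
    have b1 : (n : ℚ) < k + 3 := by linarith
    have b2 : (k : ℚ) + 1 < n := by linarith
    have b3 : n = k + 2 := by
      have c1 : n < k + 3 := by exact_mod_cast b1
      have c2 : k + 1 < n := by exact_mod_cast b2
      omega
    rw [b3] at h'
    push_cast at h'
    exact hne (by linarith)
  have v0 : ∀ ν : Λ, (ν : ℚ) ≠ μ → θ (e 0) ν = 0 := fun ν h => eq_zero_of_xiA_eq (hν ν h) (g0 ν)
  have v1 : ∀ ν : Λ, (ν : ℚ) ≠ μ → θ (e 1) ν = 0 := fun ν h =>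
    eq_zero_of_xiA_eq (hν ν h) (by simpa [v0 ν h] using g1 ν)
  have v2 : ∀ ν : Λ, (ν : ℚ) ≠ μ → θ (e 2) ν = 0 := fun ν h =>
    eq_zero_of_xiA_eq (hν ν h) (by simpa [v0 ν h, v1 ν h] using g2 ν)
  have hμ : μ ∈ Λ := by
    by_contra hμ
    have hz : θ (e 0) = 0 := funext fun ν => v0 ν fun h => hμ (h ▸ ν.2)
    exact e.ne_zero 0 (hinj (hz.trans (map_zero θ).symm))
  have hli : LinearIndependent Cb ![θ (e 0) ⟨μ, hμ⟩, θ (e 1) ⟨μ, hμ⟩, θ (e 2) ⟨μ, hμ⟩] := by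
    rw [Fintype.linearIndependent_iff]
    intro g hg
    refine Fintype.linearIndependent_iff.1 e.linearIndependent g (hinj ?_)
    rw [map_zero, map_sum]
    simp only [map_smul, Fin.sum_univ_three, Matrix.cons_val_zero, Matrix.cons_val_one,
      Matrix.cons_val] at hg ⊢
    funext ν
    change g 0 • θ (e 0) ν + g 1 • θ (e 1) ν + g 2 • θ (e 2) ν = 0
    by_cases h : (ν : ℚ) = μ
    · obtain rfl : ν = ⟨μ, hμ⟩ := Subtype.ext h
      exact hg
    · rw [v0 ν h, v1 ν h, v2 ν h]; simp
  obtain ⟨α, β, γ, c, s, u, P, Q, R, hα, hβ, hc, hs, hu, x0, x1, x2⟩ :=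
    exists_eq_embCoord (k := k) (by rw [hk]; push_cast; ring) (g0 ⟨μ, hμ⟩) (g1 ⟨μ, hμ⟩) (g2 ⟨μ, hμ⟩)
      hli hS hT
  refine ⟨hμ, α, β, γ, hα, hβ, ?_⟩
  let ψ := themeEmb lam Λ μ k α β γ
  have lift : ∀ (i : Fin 3) (y : CanonicalTheme lam α β γ), (∀ ν : Λ, (ν : ℚ) ≠ μ → θ (e i) ν = 0) →
      θ (e i) ⟨μ, hμ⟩ = embCoord k α β γ y → θ (e i) = ψ y := fun i y hv hy => by
    funext ν
    rw [themeEmb_apply]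
    split_ifs with h
    · obtain rfl : ν = ⟨μ, hμ⟩ := Subtype.ext h
      exact hy
    · exact hv ν h
  have y0 := lift 0 _ v0 x0
  have y1 := lift 1 _ v1 x1
  have y2 := lift 2 _ v2 x2
  have hinv : ∀ {c : ℂ}, c ≠ 0 → cst c⁻¹ * cst c = 1 := fun hc => by
    rw [cst, cst, ← map_mul, inv_mul_cancel₀ hc, map_one]
  obtain ⟨b, hb⟩ : ∃ b, b = themeBasis lam α β γ := ⟨_, rfl⟩
  have hcoord : ∀ A B C : Cb, ((![A, B, C] : Fin 3 → Cb) : CanonicalTheme lam α β γ)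
      = A • b 0 + B • b 1 + C • b 2 := fun A B C => by
    rw [hb]
    refine ((themeBasis lam α β γ).sum_repr (![A, B, C] : Fin 3 → Cb)).symm.trans ?_
    rw [Fin.sum_univ_three]
    rfl
  rw [hcoord] at y0 y1 y2
  simp only [zero_smul, add_zero, map_add, map_smul] at y0 y1 y2
  -- The two triples are related by a triangular matrix with nonzero constants c, s, u on the
  -- diagonal, so they span the same submodule.
  have m0 : ψ (b 0) ∈ LinearMap.range θ := by
    refine ⟨cst c⁻¹ • e 0, ?_⟩
    rw [map_smul, y0, smul_smul, hinv hc, one_smul]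
  have m1 : ψ (b 1) ∈ LinearMap.range θ := by
    have : ψ (b 1) = cst s⁻¹ • (θ (e 1) - P • ψ (b 0)) := by
      rw [y1, add_sub_cancel_left, smul_smul, hinv hs, one_smul]
    rw [this]
    exact Submodule.smul_mem _ _ (Submodule.sub_mem _ ⟨_, rfl⟩ (Submodule.smul_mem _ _ m0))
  have m2 : ψ (b 2) ∈ LinearMap.range θ := by
    have : ψ (b 2) = cst u⁻¹ • (θ (e 2) - (R • ψ (b 0) + Q • ψ (b 1))) := by
      rw [y2, add_sub_cancel_left, smul_smul, hinv hu, one_smul]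
    rw [this]
    exact Submodule.smul_mem _ _ (Submodule.sub_mem _ ⟨_, rfl⟩
      (Submodule.add_mem _ (Submodule.smul_mem _ _ m0) (Submodule.smul_mem _ _ m1)))
  have p : ∀ y, ψ y ∈ LinearMap.range ψ := fun y => ⟨y, rfl⟩
  have q0 : θ (e 0) ∈ LinearMap.range ψ := y0 ▸ Submodule.smul_mem _ _ (p _)
  have q1 : θ (e 1) ∈ LinearMap.range ψ :=
    y1 ▸ Submodule.add_mem _ (Submodule.smul_mem _ _ (p _)) (Submodule.smul_mem _ _ (p _))
  have q2 : θ (e 2) ∈ LinearMap.range ψ := y2 ▸ Submodule.add_mem _ (Submodule.add_mem _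
    (Submodule.smul_mem _ _ (p _)) (Submodule.smul_mem _ _ (p _))) (Submodule.smul_mem _ _ (p _))
  apply le_antisymm
  · rw [LinearMap.range_eq_map, ← b.span_eq, Submodule.map_span_le]
    rintro _ ⟨i, rfl⟩
    fin_cases i
    exacts [m0, m1, m2]
  · rw [LinearMap.range_eq_map θ, ← e.span_eq, Submodule.map_span_le]
    rintro _ ⟨i, rfl⟩
    fin_cases i
    exacts [q0, q1, q2]

/-! ### Local canonical form of a holomorphic family -/

theorem exists_lift_of_range_eq {E F G : Type*} [AddCommGroup E] [Module Cb E] [ABModule E]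
    [AddCommGroup F] [Module Cb F] [ABModule F] [AddCommGroup G] [Module Cb G] [ABModule G]
    {θ : E →ₗ[Cb] F} {ψ : G →ₗ[Cb] F} (hθ : IsABLinear θ) (hψ : IsABLinear ψ)
    (hθi : Function.Injective θ) (hψi : Function.Injective ψ)
    (h : LinearMap.range ψ = LinearMap.range θ) :
    ∃ Θ : G →ₗ[Cb] E, IsABLinear Θ ∧ Function.Bijective Θ ∧ ∀ v, θ (Θ v) = ψ v := by
  obtain ⟨Θ, hΘ⟩ : ∃ Θ : G →ₗ[Cb] E, ∀ v, θ (Θ v) = ψ v := by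
    refine ⟨(LinearEquiv.ofInjective θ hθi).symm.toLinearMap ∘ₗ
      ψ.codRestrict (LinearMap.range θ) fun v => h ▸ ⟨v, rfl⟩, fun v => ?_⟩
    exact congrArg Subtype.val ((LinearEquiv.ofInjective θ hθi).apply_symm_apply
      (ψ.codRestrict (LinearMap.range θ) (fun v => h ▸ ⟨v, rfl⟩) v))
  refine ⟨Θ, fun v => hθi ?_, ⟨fun v w hvw => hψi ?_, fun e => ?_⟩, hΘ⟩
  · rw [hΘ, hψ, hθ, hΘ]
  · rw [← hΘ, ← hΘ, hvw]
  · obtain ⟨v, hv⟩ : θ e ∈ LinearMap.range ψ := h ▸ ⟨e, rfl⟩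
    exact ⟨v, hθi (by rw [hΘ, hv])⟩

/-- The parameters of a canonical theme are determined by coefficients of the image of a generator. -/
theorem params_of_embCoord {k : ℕ} {α β γ : ℂ} (hα : α ≠ 0) (hβ : β ≠ 0) {c p : Fin 3 → Cb}
    (hp : p = embCoord k α β γ c) (hc : PowerSeries.constantCoeff (c 2) ≠ 0) :
    PowerSeries.coeff k (p 0) ≠ 0 ∧ PowerSeries.coeff (k + 1) (p 1) ≠ 0 ∧
    β = -PowerSeries.coeff (k + 1) (p 1) / (2 * PowerSeries.coeff k (p 0)) ∧
    α = -PowerSeries.coeff (k + 2) (p 2) / PowerSeries.coeff (k + 1) (p 1) ∧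
    γ = (PowerSeries.coeff (k + 2) (p 1)
      - β * (1 / 2 * (PowerSeries.coeff (k + 3) (p 2) / (α * β))
        - (β - α) * (2 * PowerSeries.coeff k (p 0)) - PowerSeries.coeff (k + 1) (p 0))
      + β * (PowerSeries.coeff (k + 3) (p 2) / (α * β))) / (2 * PowerSeries.coeff k (p 0)) := by
  have hcoef : ∀ (i : Fin 3) (m n : ℕ), PowerSeries.coeff n (bVar ^ m * c i)
      = if m ≤ n then PowerSeries.coeff (n - m) (c i) else 0 := fun i m n => by
    rw [PowerSeries.coeff_X_pow_mul']
  have e1 : ∀ a : ℕ, ¬ (a + 1 ≤ a) := fun a => by omega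
  have e2 : ∀ a : ℕ, ¬ (a + 2 ≤ a) := fun a => by omega
  have e3 : ∀ a : ℕ, ¬ (a + 3 ≤ a) := fun a => by omega
  have e4 : ∀ a : ℕ, ¬ (a + 2 ≤ a + 1) := fun a => by omega
  have e5 : ∀ a : ℕ, ¬ (a + 3 ≤ a + 1) := fun a => by omega
  have s1 : ∀ a : ℕ, a + 1 - a = 1 := fun a => by omega
  have s2 : ∀ a : ℕ, a + 2 - (a + 1) = 1 := fun a => by omega
  have s3 : ∀ a : ℕ, a + 3 - (a + 2) = 1 := fun a => by omega
  have l1 : ∀ a : ℕ, a ≤ a + 1 := fun a => by omega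
  have l2 : ∀ a : ℕ, a + 1 ≤ a + 2 := fun a => by omega
  have l3 : ∀ a : ℕ, a + 2 ≤ a + 3 := fun a => by omega
  -- Six coefficients of p involve exactly six unknowns: α, β, γ, the constant terms of c 1 and c 2,
  -- and the linear coefficient of c 2. The formulas result from elimination.
  have p0k : PowerSeries.coeff k (p 0) = 1 / 2 * PowerSeries.constantCoeff (c 2) := by
    simp only [hp, embCoord, Matrix.cons_val_zero, map_add, map_sub, sub_mul, cst,
      PowerSeries.coeff_C_mul, hcoef, e1, e2, e3, if_false, le_refl, if_true, Nat.sub_self,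
      PowerSeries.coeff_zero_eq_constantCoeff]
    simp
  have p0k1 : PowerSeries.coeff (k + 1) (p 0) = -PowerSeries.constantCoeff (c 1)
      + 1 / 2 * PowerSeries.coeff 1 (c 2) - (β - α) * PowerSeries.constantCoeff (c 2) := by
    simp only [hp, embCoord, Matrix.cons_val_zero, map_add, map_sub, sub_mul, cst, PowerSeries.coeff_C_mul,
      hcoef, e4, e5, if_false, le_refl, if_true, Nat.sub_self, l1, s1,
      PowerSeries.coeff_zero_eq_constantCoeff]
    ring
  have p1k1 : PowerSeries.coeff (k + 1) (p 1) = -β * PowerSeries.constantCoeff (c 2) := by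
    simp only [hp, embCoord, Matrix.cons_val_one, Matrix.cons_val_zero, map_add, map_sub, cst,
      PowerSeries.coeff_C_mul, hcoef, e4, if_false, le_refl, if_true, Nat.sub_self,
      PowerSeries.coeff_zero_eq_constantCoeff]
    ring
  have p1k2 : PowerSeries.coeff (k + 2) (p 1) = β * PowerSeries.constantCoeff (c 1)
      + γ * PowerSeries.constantCoeff (c 2) - β * PowerSeries.coeff 1 (c 2) := by
    simp only [hp, embCoord, Matrix.cons_val_one, Matrix.cons_val_zero, map_add, map_sub, cst,
      PowerSeries.coeff_C_mul, hcoef, le_refl, if_true, Nat.sub_self, l2, s2,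
      PowerSeries.coeff_zero_eq_constantCoeff]
    ring
  have p2k2 : PowerSeries.coeff (k + 2) (p 2) = α * β * PowerSeries.constantCoeff (c 2) := by
    simp only [hp, embCoord, Matrix.cons_val, cst,
      PowerSeries.coeff_C_mul, hcoef, le_refl, if_true, Nat.sub_self,
      PowerSeries.coeff_zero_eq_constantCoeff]
  have p2k3 : PowerSeries.coeff (k + 3) (p 2) = α * β * PowerSeries.coeff 1 (c 2) := by
    simp only [hp, embCoord, Matrix.cons_val, cst,
      PowerSeries.coeff_C_mul, hcoef, if_true, l3, s3]
  rw [p0k, p0k1, p1k1, p1k2, p2k2, p2k3]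
  refine ⟨by simpa using hc, by simpa using ⟨hβ, hc⟩, ?_, ?_, ?_⟩
  · field_simp
  · field_simp
  · field_simp
    ring

/-- Modulo b the operator a has no component on e₃, so the last row of the matrix reduces to the
single entry c 2. -/
theorem constantCoeff_ne_zero_of_isUnit_det {lam : ℚ} {α β γ : ℂ} {c : CanonicalTheme lam α β γ}
    (h : IsUnit (cyclicMatrix lam α β γ c).det) : PowerSeries.constantCoeff (c 2) ≠ 0 := by
  intro h0
  have := ((PowerSeries.isUnit_iff_constantCoeff).1 h).ne_zero
  rw [Matrix.det_fin_three] at this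
  apply this
  have e0 : ∀ i, cyclicMatrix lam α β γ c i 0 = c i := fun _ => rfl
  have e1 : ∀ i, cyclicMatrix lam α β γ c i 1 = canonicalA lam α β γ c i := fun _ => rfl
  have e2 : ∀ i, cyclicMatrix lam α β γ c i 2
    = canonicalA lam α β γ (canonicalA lam α β γ c) i := fun _ => rfl
  simp only [e0, e1, e2, map_add, map_sub, map_mul, h0]
  simp [canonicalA, h0]

section LocalForm

variable {N : Type v} [TopologicalSpace N] [ReducedComplexSpace N]

/-- Back substitution in the triangular system of `embCoord`: α, β are invertible near x, and
dividing by b^(k+2) only shifts coefficients. -/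
theorem IsHolSeriesAt.of_embCoord {k : ℕ} {α β γ : N → ℂ} {x : N} (hα : IsHolAt α x)
    (hβ : IsHolAt β x) (hγ : IsHolAt γ x) (hα0 : ∀ᶠ z in 𝓝 x, α z ≠ 0)
    (hβ0 : ∀ᶠ z in 𝓝 x, β z ≠ 0) {c : N → Fin 3 → Cb}
    (h : ∀ i, IsHolSeriesAt (fun y => embCoord k (α y) (β y) (γ y) (c y) i) x) (i : Fin 3) :
    IsHolSeriesAt (fun y => c y i) x := by
  have hinv : ∀ {a : ℂ}, a ≠ 0 → cst a⁻¹ * cst a = 1 := fun ha => by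
    rw [cst, cst, ← map_mul, inv_mul_cancel₀ ha, map_one]
  have hX : ∀ n {S : N → Cb}, IsHolSeriesAt S x → IsHolSeriesAt (fun y => bVar ^ n * S y) x :=
    fun n _ hS => (IsHolSeriesAt.const _ x).mul hS
  have h2 : IsHolSeriesAt (fun y => c y 2) x := by
    refine IsHolSeriesAt.of_X_pow_mul (k := k + 2) (((IsHolSeriesAt.of_cst
      ((hα.mul hβ).inv (mul_ne_zero hα0.self_of_nhds hβ0.self_of_nhds))).mul (h 2)).congr ?_)
    filter_upwards [hα0, hβ0] with z hz hz'
    simp only [embCoord, Matrix.cons_val]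
    rw [← mul_assoc, hinv (mul_ne_zero hz hz'), one_mul]
  have h1 : IsHolSeriesAt (fun y => c y 1) x := by
    refine IsHolSeriesAt.of_X_pow_mul (k := k + 2) (((IsHolSeriesAt.of_cst
      (hβ.inv hβ0.self_of_nhds)).mul ((h 1).sub (((IsHolSeriesAt.of_cst hγ).mul (hX (k + 2) h2)).sub
        ((IsHolSeriesAt.of_cst hβ).mul (hX (k + 1) h2))))).congr ?_)
    filter_upwards [hβ0] with z hz
    simp only [embCoord, Matrix.cons_val_zero, Matrix.cons_val_one]
    rw [add_sub_cancel_right, ← mul_assoc, hinv hz, one_mul]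
  have h0 : IsHolSeriesAt (fun y => c y 0) x := by
    refine IsHolSeriesAt.of_X_pow_mul (k := k + 2) ((((h 0).sub
      (((IsHolSeriesAt.of_cst (isHolAt_const (1 / 2) x)).mul (hX k h2)).sub
        ((IsHolSeriesAt.of_cst (hβ.sub hα)).mul (hX (k + 1) h2)) |>.add
        ((IsHolSeriesAt.of_cst (hα.mul hγ)).mul (hX (k + 3) h2)))).sub
      (((IsHolSeriesAt.of_cst hγ).mul (hX (k + 3) h1)).sub (hX (k + 1) h1))).congr
        (Eventually.of_forall fun z => ?_))
    simp only [embCoord, Matrix.cons_val_zero]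
    ring
  fin_cases i <;> assumption

/-- Every holomorphic family of themes with fundamental invariants `λ, λ, λ` is locally isomorphic
to a family of canonical themes whose parameters are holomorphic. -/
theorem exists_local_canonical_form {lam : ℚ} (hlam : 2 < lam) {ℍ : ABFamily.{v, w'} N}
    (hH : ℍ.IsHolFamily (fun _ : Fin 3 => lam)) (y₀ : N) :
    ∃ (U : Set N) (α β γ : N → ℂ)
      (Θ : ∀ y, CanonicalTheme lam (α y) (β y) (γ y) →ₗ[Cb] ℍ.fib y),
      IsOpen U ∧ y₀ ∈ U ∧ ∀ y ∈ U, (IsHolAt α y ∧ IsHolAt β y ∧ IsHolAt γ y ∧ α y ≠ 0 ∧ β y ≠ 0) ∧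
        IsABLinear (Θ y) ∧ Function.Bijective (Θ y) ∧
        ∀ t : ∀ y, CanonicalTheme lam (α y) (β y) (γ y),
          (∀ i, IsHolSeriesAt (fun z => t z i) y) ↔ ℍ.IsHolAt (fun z => Θ z (t z)) y := by
  classical
  obtain ⟨μ, k, hμ0, hμ1, hk⟩ := exists_residue hlam
  obtain ⟨U, Λ, φ, hU, hy₀, hΛ, hφ, θ, hθ⟩ := hH.2 y₀
  change N → Xi Λ 2 at φ
  have hcl := fun y (hy : y ∈ U) => exists_range_eq_range_themeEmb hμ0 hμ1 hk hΛ (hH.1 y).2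
    (hθ y hy).1 (hθ y hy).2.1 (hθ y hy).2.2.1
  have hμ : μ ∈ Λ := (hcl y₀ hy₀).1
  -- The parameters are chosen point by point, with no regularity and with default values outside U.
  -- Holomorphy follows because φ determines them.
  have hpar : ∀ y, ∃ α β γ : ℂ, ∃ c : CanonicalTheme lam α β γ,
      ∃ Θ : CanonicalTheme lam α β γ →ₗ[Cb] ℍ.fib y, y ∈ U →
      α ≠ 0 ∧ β ≠ 0 ∧ IsABLinear Θ ∧ Function.Bijective Θ ∧
      (∀ v, θ y (Θ v) = themeEmb lam Λ μ k α β γ v) ∧ themeEmb lam Λ μ k α β γ c = φ y ∧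
      IsUnit (cyclicMatrix lam α β γ c).det := by
    intro y
    by_cases hy : y ∈ U
    · obtain ⟨-, α, β, γ, hα, hβ, hr⟩ := hcl y hy
      have hι := isABLinear_themeEmb Λ hk α β γ
      have hιi := themeEmb_injective lam hμ k hα hβ γ
      obtain ⟨Θ, h1, h2, h3⟩ := exists_lift_of_range_eq (hθ y hy).1 hι (hθ y hy).2.1 hιi hr
      have hr' := hr.trans (hθ y hy).2.2.1
      obtain ⟨c, hc⟩ : φ y ∈ LinearMap.range (themeEmb lam Λ μ k α β γ) := by
        rw [hr']; exact Submodule.subset_span ⟨0, rfl⟩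
      refine ⟨α, β, γ, c, Θ, fun _ => ⟨hα, hβ, h1, h2, h3, hc, isUnit_det_cyclicMatrix ?_⟩⟩
      apply Submodule.map_injective_of_injective hιi
      rw [Submodule.map_span, ← Set.range_comp, Submodule.map_top, hr', ← hc]
      congr 2
      funext j
      exact hι.map_aPow j c
    · exact ⟨0, 0, 0, 0, 0, fun h => absurd h hy⟩
  choose α β γ c Θ hpar using hpar
  have hUn : ∀ {y}, y ∈ U → ∀ᶠ z in 𝓝 y, z ∈ U := fun hy => hU.mem_nhds hy
  have hp : ∀ y ∈ U, φ y ⟨μ, hμ⟩ = embCoord k (α y) (β y) (γ y) (c y) := fun y hy => by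
    rw [← (hpar y hy).2.2.2.2.2.1, themeEmb_apply, if_pos rfl]
  have hpp := fun y (hy : y ∈ U) => params_of_embCoord (hpar y hy).1 (hpar y hy).2.1 (hp y hy)
    (constantCoeff_ne_zero_of_isUnit_det (hpar y hy).2.2.2.2.2.2)
  have hco : ∀ y ∈ U, ∀ j n, IsHolAt (fun z => PowerSeries.coeff n (φ z ⟨μ, hμ⟩ j)) y :=
    fun y hy j n => (hφ.1 y hy ⟨μ, hμ⟩ j).coeff n
  have h20 : ∀ y ∈ U, IsHolAt (fun z => 2 * PowerSeries.coeff k (φ z ⟨μ, hμ⟩ 0)) y := fun y hy =>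
    (isHolAt_const 2 y).mul (hco y hy 0 k)
  have hβ : ∀ y ∈ U, IsHolAt β y := fun y hy => by
    refine ((hco y hy 1 (k + 1)).neg.div (h20 y hy)
      (mul_ne_zero two_ne_zero (hpp y hy).1)).congr ?_
    filter_upwards [hUn hy] with z hz using (hpp z hz).2.2.1.symm
  have hα : ∀ y ∈ U, IsHolAt α y := fun y hy => by
    refine ((hco y hy 2 (k + 2)).neg.div (hco y hy 1 (k + 1)) (hpp y hy).2.1).congr ?_
    filter_upwards [hUn hy] with z hz using (hpp z hz).2.2.2.1.symm
  have hγ : ∀ y ∈ U, IsHolAt γ y := fun y hy => by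
    have hq := (hco y hy 2 (k + 3)).div ((hα y hy).mul (hβ y hy))
      (mul_ne_zero (hpar y hy).1 (hpar y hy).2.1)
    refine ((((hco y hy 1 (k + 2)).sub ((hβ y hy).mul ((((isHolAt_const (1 / 2) y).mul hq).sub
      (((hβ y hy).sub (hα y hy)).mul (h20 y hy))).sub (hco y hy 0 (k + 1))))).add
        ((hβ y hy).mul hq)).div (h20 y hy) (mul_ne_zero two_ne_zero (hpp y hy).1)).congr ?_
    filter_upwards [hUn hy] with z hz using (hpp z hz).2.2.2.2.symm
  have hc : ∀ y ∈ U, ∀ i, IsHolSeriesAt (fun z => c z i) y := fun y hy => by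
    refine IsHolSeriesAt.of_embCoord (k := k) (hα y hy) (hβ y hy) (hγ y hy)
      ((hUn hy).mono fun z hz => (hpar z hz).1) ((hUn hy).mono fun z hz => (hpar z hz).2.1)
      fun i => (hφ.1 y hy ⟨μ, hμ⟩ i).congr ?_
    filter_upwards [hUn hy] with z hz
    rw [← hp z hz]
  refine ⟨U, α, β, γ, Θ, hU, hy₀, fun y hy => ⟨⟨hα y hy, hβ y hy, hγ y hy, (hpar y hy).1,
    (hpar y hy).2.1⟩, (hpar y hy).2.2.1, (hpar y hy).2.2.2.1, fun t => ?_⟩⟩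
  -- Both notions of section are expressed in the cyclic bases of c and φ, which the embedding
  -- identifies.
  refine (isHolSeriesAt_iff_cyclic (hα y hy) (hβ y hy) (hγ y hy) (hc y hy)
    ((hUn hy).mono fun z hz => (hpar z hz).2.2.2.2.2.2) t).trans
      (Iff.trans ?_ ((hθ y hy).2.2.2 _).symm)
  refine exists_congr fun g => and_congr Iff.rfl (eventually_congr ?_)
  filter_upwards [hUn hy] with z hz
  obtain ⟨hα0, hβ0, -, -, hΘ, hcφ, -⟩ := hpar z hz
  have hι := isABLinear_themeEmb Λ hk (α z) (β z) (γ z)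
  have h2 : themeEmb lam Λ μ k (α z) (β z) (γ z) (∑ j : Fin 3, g j z • aPow (j : ℕ) (c z))
      = ∑ j : Fin 3, g j z • aPow (j : ℕ) (φ z) := by
    rw [map_sum]
    refine Finset.sum_congr rfl fun j _ => ?_
    rw [map_smul, hι.map_aPow, hcφ]
  rw [hΘ]
  exact (themeEmb_injective lam hμ k hα0 hβ0 (γ z)).eq_iff.symm.trans (by rw [h2])

end LocalForm

/-! ### The universal family over pairs α ≠ β -/

section Universality

/-- The space of the pairs `(α, β)` of distinct nonzero complex numbers. -/
def ThemeParam : Type := {z : Fin 2 → ℂ // z 0 ≠ 0 ∧ z 1 ≠ 0 ∧ z 0 ≠ z 1}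

noncomputable instance : TopologicalSpace ThemeParam := instTopologicalSpaceSubtype

theorem isOpenEmbedding_themeParam : IsOpenEmbedding (Subtype.val : ThemeParam → Fin 2 → ℂ) := by
  refine IsOpen.isOpenEmbedding_subtypeVal ?_
  exact (isOpen_ne_fun (continuous_apply 0) continuous_const).inter
    ((isOpen_ne_fun (continuous_apply 1) continuous_const).inter
      (isOpen_ne_fun (continuous_apply 0) (continuous_apply 1)))

noncomputable instance themeParamComplexSpace : ReducedComplexSpace ThemeParam :=
  ReducedComplexSpace.ofOpenEmbedding Subtype.val isOpenEmbedding_themeParam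

theorem isHolAt_themeParam_coord (i : Fin 2) (x : ThemeParam) :
    IsHolAt (fun z : ThemeParam => z.1 i) x :=
  ⟨fun z => z i, analyticAt_coord i _, Eventually.of_forall fun _ => rfl⟩

/-- The family over `ThemeParam` with fibers `E(α,β,0)`. -/
noncomputable def universalFamily (lam : ℚ) : ABFamily.{0, 0} ThemeParam :=
  canonicalFamily lam (fun z => z.1 0) (fun z => z.1 1) (fun _ => 0) (isHolAt_themeParam_coord 0)
    (isHolAt_themeParam_coord 1) (isHolAt_const 0)

theorem eq_of_abIsomorphic_universalFamily {lam : ℚ} {x y : ThemeParam}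
    (h : ABIsomorphic ((universalFamily lam).fib x) ((universalFamily lam).fib y)) : x = y := by
  have h' := eq_of_abIsomorphic (γ := 0) (γ' := 0) h
  refine Subtype.ext (funext fun i => ?_)
  fin_cases i
  exacts [h'.1.symm, h'.2.1.symm]

theorem isUniversalNear_universalFamily {lam : ℚ} (hlam : 2 < lam) (x : ThemeParam) :
    ABFamily.IsUniversalNear.{0, u, 0, w} (universalFamily lam) (fun _ : Fin 3 => lam) x := by
  classical
  intro N _ _ ℍ y₀ hH hiso
  constructor
  · obtain ⟨U, α, β, γ, Θ, hU, hy₀, hΘ⟩ := exists_local_canonical_form hlam hH y₀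
    have hx := eq_of_abIsomorphic (γ' := 0)
      (ABIsomorphic.trans ⟨Θ y₀, (hΘ y₀ hy₀).2.1, (hΘ y₀ hy₀).2.2.1⟩ hiso)
    let V : Set N := {y | y ∈ U ∧ α y ≠ β y}
    have hV : IsOpen V := by
      rw [isOpen_iff_mem_nhds]
      rintro y ⟨hy, hne⟩
      filter_upwards [hU.mem_nhds hy, ((hΘ y hy).1.1.sub (hΘ y hy).1.2.1).continuousAt.eventually_ne
        (sub_ne_zero.2 hne)] with z h1 h2 using ⟨h1, sub_ne_zero.1 h2⟩
    -- The default value x only makes f total; f is used on the open set V alone.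
    let f : N → ThemeParam := fun y => if h : α y ≠ 0 ∧ β y ≠ 0 ∧ α y ≠ β y then
      ⟨![α y, β y], h⟩ else x
    have hfV : ∀ y ∈ V, (f y).1 = ![α y, β y] := fun y hy =>
      congrArg Subtype.val (dif_pos (show α y ≠ 0 ∧ β y ≠ 0 ∧ α y ≠ β y from
        ⟨(hΘ y hy.1).1.2.2.2.1, (hΘ y hy.1).1.2.2.2.2, hy.2⟩))
    have hy₀V : y₀ ∈ V := ⟨hy₀, by rw [← hx.1, ← hx.2.1]; exact x.2.2.2⟩
    have hf0 : f y₀ = x := by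
      refine Subtype.ext ((hfV y₀ hy₀V).trans (funext fun i => ?_))
      fin_cases i
      exacts [hx.1.symm, hx.2.1.symm]
    have hfα : ∀ y ∈ V, (f y).1 0 = α y := fun y hy => by rw [hfV y hy]; rfl
    have hfβ : ∀ y ∈ V, (f y).1 1 = β y := fun y hy => by rw [hfV y hy]; rfl
    have hfc : ∀ y ∈ V, ∀ i, IsHolAt (fun z => (f z).1 i) y := fun y hy i => by
      fin_cases i
      · refine (hΘ y hy.1).1.1.congr ?_
        filter_upwards [hV.mem_nhds hy] with z hz using (hfα z hz).symm
      · refine (hΘ y hy.1).1.2.1.congr ?_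
        filter_upwards [hV.mem_nhds hy] with z hz using (hfβ z hz).symm
    have hfhol : IsHolMapOn f V :=
      isHolMapOn_of_coord (M := ThemeParam) isOpenEmbedding_themeParam (fun _ _ => Iff.rfl) hfc
    -- Parameter of the shear from E(α,β,0) to E(α,β,γ), holomorphic because β - α does not vanish
    -- on V.
    let ξ : N → ℂ := fun y => (0 - γ y) / (β y - α y)
    have hξ : ∀ y ∈ V, IsHolAt ξ y := fun y hy =>
      ((isHolAt_const 0 y).sub (hΘ y hy.1).1.2.2.1).div
        ((hΘ y hy.1).1.2.1.sub (hΘ y hy.1).1.1) (sub_ne_zero.2 hy.2.symm)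
    refine ⟨f, hf0, V, hV, hy₀V, hfhol,
      fun y => Θ y ∘ₗ shearMap lam ((f y).1 0) ((f y).1 1) 0 (α y) (β y) (γ y) (ξ y),
      fun y hy => ⟨IsABLinear.comp (isABLinear_shearMap (hfα y hy).symm (hfβ y hy).symm ?_)
        (hΘ y hy.1).2.1, (hΘ y hy.1).2.2.1.comp
          (shearMap_bijective lam _ _ _ (α y) (β y) (γ y) (ξ y)), fun t => ?_⟩⟩
    · rw [hfα y hy, hfβ y hy]
      exact div_mul_cancel₀ _ (sub_ne_zero.2 hy.2.symm)
    · refine (isPullbackHolAt_canonicalFamily (isHolAt_themeParam_coord 0)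
        (isHolAt_themeParam_coord 1) (isHolAt_const 0) hfhol hV hy t).trans ?_
      refine (isHolSeriesAt_shearCoord_iff (hfc y hy 0) (isHolAt_const 0 y)
        (hΘ y hy.1).1.2.2.1 (hξ y hy) t).symm.trans ?_
      exact (hΘ y hy.1).2.2.2 fun z => shearMap lam ((f z).1 0) ((f z).1 1) 0 (α z) (β z) (γ z)
        (ξ z) (t z)
  -- Uniqueness holds pointwise: the fibers at f z and f' z are both isomorphic to that of ℍ at z,
  -- and no class occurs twice.
  · rintro f f' ⟨-, U, hU, hy, -, θ, hθ⟩ ⟨-, U', hU', hy', -, θ', hθ'⟩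
    filter_upwards [hU.mem_nhds hy, hU'.mem_nhds hy'] with z hz hz'
    have h1 : ABIsomorphic ((universalFamily lam).fib (f z)) (ℍ.fib z) :=
      ⟨θ z, (hθ z hz).1, (hθ z hz).2.1⟩
    have h2 : ABIsomorphic ((universalFamily lam).fib (f' z)) (ℍ.fib z) :=
      ⟨θ' z, (hθ' z hz').1, (hθ' z hz').2.1⟩
    exact eq_of_abIsomorphic_universalFamily (h1.trans h2.symm)

end Universality

theorem proposition2p3p1 (lam : ℚ) (hlam : 2 < lam) :
    (∀ α β γ : ℂ, α ≠ 0 → β ≠ 0 →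
      IsThemeWithInvariants (fun _ : Fin 3 => lam) (CanonicalTheme lam α β γ)) ∧
    (∀ α β γ : ℂ, α ≠ 0 → β ≠ 0 → α ≠ β →
      ¬ IsInvariantTheme (CanonicalTheme lam α β γ) ∧
      ∃ α' β' γ' : ℂ, α' ≠ 0 ∧ β' ≠ 0 ∧ (α', β', γ') ≠ (α, β, γ) ∧
        ABIsomorphic (CanonicalTheme lam α β γ) (CanonicalTheme lam α' β' γ')) ∧
    (∀ α γ : ℂ, α ≠ 0 →
      IsInvariantTheme (CanonicalTheme lam α α γ) ∧
      ∀ (M : Type u) [TopologicalSpace M] [ReducedComplexSpace M] (𝔼 : ABFamily.{u, w} M) (x₀ : M),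
        𝔼.IsHolFamily (fun _ : Fin 3 => lam) →
        ABIsomorphic (𝔼.fib x₀) (CanonicalTheme lam α α γ) →
          ¬ ABFamily.IsUniversalNear.{u, 0, w, 0} 𝔼 (fun _ : Fin 3 => lam) x₀) ∧
    (∀ α β γ : ℂ, α ≠ 0 → β ≠ 0 → α ≠ β →
      ∃ (M : Type) (_ : TopologicalSpace M) (_ : ReducedComplexSpace M) (𝔼 : ABFamily.{0, 0} M),
        IsSmoothOfDim 2 M ∧
        𝔼.IsHolFamily (fun _ : Fin 3 => lam) ∧
        (∃ x₀ : M, ABIsomorphic (𝔼.fib x₀) (CanonicalTheme lam α β γ)) ∧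
        (∀ x : M, ABFamily.IsUniversalNear.{0, u, 0, w} 𝔼 (fun _ : Fin 3 => lam) x) ∧
        (∀ x y : M, ABIsomorphic (𝔼.fib x) (𝔼.fib y) → x = y)) := by
  refine ⟨fun α β γ hα hβ => isThemeWithInvariants_canonicalTheme hlam hα hβ γ,
    fun α β γ hα hβ hαβ => ⟨not_isInvariantTheme hαβ γ, α, β, γ + 1, hα, hβ, by simp,
      abIsomorphic_canonicalTheme hαβ γ (γ + 1)⟩,
    fun α γ hα => ⟨isInvariantTheme_canonicalTheme hα γ, fun M _ _ 𝔼 x₀ _ hiso =>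
      not_isUniversalNear hlam hα γ 𝔼 x₀ hiso⟩,
    fun α β γ hα hβ hαβ => ⟨ThemeParam, inferInstance, inferInstance, universalFamily lam,
      isSmoothOfDim_ofOpenEmbedding _ isOpenEmbedding_themeParam,
      isHolFamily_canonicalFamily hlam _ _ _ (fun x => x.2.1) (fun x => x.2.2.1),
      ⟨⟨![α, β], hα, hβ, hαβ⟩, abIsomorphic_canonicalTheme hαβ 0 γ⟩,
      isUniversalNear_universalFamily hlam, fun _ _ => eq_of_abIsomorphic_universalFamily⟩⟩
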